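/- Let $k$ be a field, and let $A$ and $B$ be finite-dimensional $k$-algebras without nonzero semisimple direct summands (i.e. if $A\cong A_1\times A_2$ as algebras with $A_1$ semisimple, then $A_1=0$; similarly for $B$). Let $A\text{-mod}$ denote the category of finitely generated left $A$-modules and $A\text{-}\underline{\mathrm{mod}}$ its stable category, with the same objects and with $\underline{\mathrm{Hom}}_A(X,Y)$ the quotient of $\mathrm{Hom}_A(X,Y)$ by the homomorphisms that factorize through projective modules. Let ${}_AM_B$ and ${}_BN_A$ be finite-dimensional bimodules (with $k$ acting centrally), without nonzero projective direct summands as bimodules, that define a stable equivalence of Morita type between $A$ and $B$: the one-sided modules ${}_AM$, $M_B$, ${}_BN$, $N_A$ are projective, and there are a projective $A$-$A$-bimodule $P$ and a projective $B$-$B$-bimodule $Q$ with $M\otimes_BN\cong A\oplus P$ and $N\otimes_AM\cong B\oplus Q$ as bimodules. Let $\Phi_N\colon A\text{-}\underline{\mathrm{mod}}\to B\text{-}\underline{\mathrm{mod}}$ be the functor induced by $N\otimes_A-$. Then the following are equivalent: (1) $N\otimes_A-\colon A\text{-mod}\to B\text{-mod}$ is an equivalence; that is, $P=0=Q$ (these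 two conditions being equivalent to each other). (2) $N\otimes_AS$ is a simple $B$-module for every simple $A$-module $S$. If, moreover, $A/\mathrm{rad}(A)$ and $B/\mathrm{rad}(B)$ are separable $k$-algebras, then (1) and (2) are also equivalent to each of the following two conditions: (3) $\Phi_N$ lifts to a Morita equivalence, i.e. there is a $k$-linear equivalence $F\colon A\text{-mod}\to B\text{-mod}$ such that the composite of $F$ with the canonical functor $B\text{-mod}\to B\text{-}\underline{\mathrm{mod}}$ is isomorphic to the composite of the canonical functor $A\text{-mod}\to A\text{-}\underline{\mathrm{mod}}$ with $\Phi_N$. (4) For every simple $A$-module $S$, the module $N\otimes_AS$ is isomorphic in $B\text{-}\underline{\mathrm{mod}}$ to a simple $B$-module. -/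

import Mathlib

open scoped TensorProduct
open CategoryTheory MulOpposite

universe u u₁ u₂ u₃ u₄

/-!
Conventions: a right `A`-module is a module over `Aᵐᵒᵖ`.  For algebras `A`, `B` over a field `k`, an
`A`-`B`-bimodule is a `k`-vector space with compatible, commuting actions of `A` and `Bᵐᵒᵖ`, so that
`k` acts centrally.
-/

section BalancedTensor

variable (A : Type u₁) [Ring A]

/-- The relations `(n · a) ⊗ x - n ⊗ (a · x)` that define `N ⊗_A X` as a quotient of `N ⊗_ℤ X`. -/
def balancedRelations (N : Type u₂) (X : Type u₃) [AddCommGroup N] [Module Aᵐᵒᵖ N]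
    [AddCommGroup X] [Module A X] : Submodule ℤ (N ⊗[ℤ] X) :=
  Submodule.span ℤ {z | ∃ (n : N) (a : A) (x : X), z = (op a • n) ⊗ₜ[ℤ] x - n ⊗ₜ[ℤ] (a • x)}

/-- The tensor product `N ⊗_A X` of a right module `N` and a left module `X` over a possibly
noncommutative ring `A`. -/
def BalTensor (N : Type u₂) (X : Type u₃) [AddCommGroup N] [Module Aᵐᵒᵖ N]
    [AddCommGroup X] [Module A X] : Type (max u₂ u₃) :=
  (N ⊗[ℤ] X) ⧸ balancedRelations A N X

namespace BalTensor

variable {N N' N'' : Type u₂} {X X' X'' : Type u₃}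
  [AddCommGroup N] [Module Aᵐᵒᵖ N] [AddCommGroup N'] [Module Aᵐᵒᵖ N']
  [AddCommGroup N''] [Module Aᵐᵒᵖ N'']
  [AddCommGroup X] [Module A X] [AddCommGroup X'] [Module A X'] [AddCommGroup X''] [Module A X'']

instance instAddCommGroup : AddCommGroup (BalTensor A N X) :=
  inferInstanceAs (AddCommGroup ((N ⊗[ℤ] X) ⧸ balancedRelations A N X))

/-- The pure tensor `n ⊗ x` in `N ⊗_A X`. -/
def tmul (n : N) (x : X) : BalTensor A N X :=
  (balancedRelations A N X).mkQ (n ⊗ₜ[ℤ] x)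

theorem add_tmul (n n' : N) (x : X) : tmul A (n + n') x = tmul A n x + tmul A n' x := by
  simp only [tmul, TensorProduct.add_tmul]
  exact map_add _ _ _

theorem tmul_add (n : N) (x x' : X) : tmul A n (x + x') = tmul A n x + tmul A n x' := by
  simp only [tmul, TensorProduct.tmul_add]
  exact map_add _ _ _

theorem smul_tmul (n : N) (a : A) (x : X) : tmul A (op a • n) x = tmul A n (a • x) := by
  refine (Submodule.Quotient.eq _).2 (Submodule.subset_span ⟨n, a, x, rfl⟩)

theorem tmul_zero (n : N) : tmul A n (0 : X) = 0 := by
  have h := tmul_add A n (0 : X) 0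
  simpa using h

@[elab_as_elim]
theorem induction_on {p : BalTensor A N X → Prop} (z : BalTensor A N X) (h0 : p 0)
    (ht : ∀ n x, p (tmul A n x)) (ha : ∀ z w, p z → p w → p (z + w)) : p z := by
  obtain ⟨t, rfl⟩ := (balancedRelations A N X).mkQ_surjective z
  induction t using TensorProduct.induction_on with
  | zero => rw [map_zero]; exact h0
  | tmul n x => exact ht n x
  | add s t hs ht' => rw [map_add]; exact ha _ _ hs ht'

/-- The universal property: a balanced biadditive map `N × X → G` induces `N ⊗_A X → G`. -/
def lift {G : Type u₄} [AddCommGroup G] (f : N →+ X →+ G)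
    (hf : ∀ n (a : A) x, f (op a • n) x = f n (a • x)) : BalTensor A N X →+ G :=
  ((balancedRelations A N X).liftQ
    (TensorProduct.liftAddHom f (by intro r m n; simp)).toIntLinearMap (by
      refine Submodule.span_le.2 ?_
      rintro _ ⟨n, a, x, rfl⟩
      simp [hf])).toAddMonoidHom

@[simp]
theorem lift_tmul {G : Type u₄} [AddCommGroup G] (f : N →+ X →+ G)
    (hf : ∀ n (a : A) x, f (op a • n) x = f n (a • x)) (n : N) (x : X) :
    lift A f hf (tmul A n x) = f n x := rfl

theorem addHom_ext {G : Type u₄} [AddCommGroup G] {f g : BalTensor A N X →+ G}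
    (h : ∀ n x, f (tmul A n x) = g (tmul A n x)) : f = g := by
  ext z
  induction z using induction_on with
  | h0 => simp
  | ht n x => exact h n x
  | ha z w hz hw => simp [hz, hw]

/-- The additive map `g ⊗ f : N ⊗_A X → N' ⊗_A X'`. -/
def map (g : N →ₗ[Aᵐᵒᵖ] N') (f : X →ₗ[A] X') : BalTensor A N X →+ BalTensor A N' X' :=
  lift A
    (AddMonoidHom.mk' (fun n => AddMonoidHom.mk' (fun x => tmul A (g n) (f x))
        (fun x x' => by rw [map_add, tmul_add]))
      (fun n n' => by
        ext x
        simp only [AddMonoidHom.mk'_apply, AddMonoidHom.add_apply, map_add, add_tmul]))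
    (fun n a x => by
      simp only [AddMonoidHom.mk'_apply, map_smul, smul_tmul])

@[simp]
theorem map_tmul (g : N →ₗ[Aᵐᵒᵖ] N') (f : X →ₗ[A] X') (n : N) (x : X) :
    map A g f (tmul A n x) = tmul A (g n) (f x) := rfl

variable (N X) in
/-- Endomorphisms of the right module `N` act on `N ⊗_A X`. -/
def endLeft : Module.End Aᵐᵒᵖ N →+* AddMonoid.End (BalTensor A N X) where
  toFun g := map A g LinearMap.id
  map_one' := addHom_ext A fun _ _ => rfl
  map_mul' _ _ := addHom_ext A fun _ _ => rfl
  map_zero' := addHom_ext A fun n x => by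
    change tmul A (0 : N) x = 0
    have h := add_tmul A (0 : N) 0 x
    simpa using h
  map_add' _ _ := addHom_ext A fun _ _ => add_tmul A _ _ _

variable (N X) in
/-- Endomorphisms of the left module `X` act on `N ⊗_A X`. -/
def endRight : Module.End A X →+* AddMonoid.End (BalTensor A N X) where
  toFun f := map A LinearMap.id f
  map_one' := addHom_ext A fun _ _ => rfl
  map_mul' _ _ := addHom_ext A fun _ _ => rfl
  map_zero' := addHom_ext A fun n _ => tmul_zero A n
  map_add' _ _ := addHom_ext A fun _ _ => tmul_add A _ _ _

variable {B : Type u₄} [Ring B]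

/-- The left `B`-module structure `b · (n ⊗ x) = (b · n) ⊗ x` on `N ⊗_A X`, for a
`B`-`A`-bimodule `N`. -/
instance instModuleLeft [Module B N] [SMulCommClass B Aᵐᵒᵖ N] : Module B (BalTensor A N X) :=
  Module.compHom (BalTensor A N X) ((endLeft A N X).comp (Module.toModuleEnd Aᵐᵒᵖ (S := B) N))

theorem smul_left_tmul [Module B N] [SMulCommClass B Aᵐᵒᵖ N] (b : B) (n : N) (x : X) :
    b • tmul A n x = tmul A (b • n) x := rfl

/-- The right `B`-module structure `(n ⊗ x) · b = n ⊗ (x · b)` on `N ⊗_A X`, for an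
`A`-`B`-bimodule `X`. -/
instance instModuleRight [Module Bᵐᵒᵖ X] [SMulCommClass A Bᵐᵒᵖ X] :
    Module Bᵐᵒᵖ (BalTensor A N X) :=
  haveI : SMulCommClass Bᵐᵒᵖ A X := SMulCommClass.symm A Bᵐᵒᵖ X
  Module.compHom (BalTensor A N X) ((endRight A N X).comp (Module.toModuleEnd A (S := Bᵐᵒᵖ) X))

theorem smul_right_tmul [Module Bᵐᵒᵖ X] [SMulCommClass A Bᵐᵒᵖ X] (b : B) (n : N) (x : X) :
    op b • tmul A n x = tmul A n (op b • x) := rfl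

section Functoriality

variable [Module B N] [SMulCommClass B Aᵐᵒᵖ N]

variable (B N) in
/-- The `B`-linear map `N ⊗_A f : N ⊗_A X → N ⊗_A X'`. -/
def lTensor (f : X →ₗ[A] X') : BalTensor A N X →ₗ[B] BalTensor A N X' where
  toFun := map A LinearMap.id f
  map_add' := map_add _
  map_smul' b z := by
    induction z using induction_on with
    | h0 => simp
    | ht n x => rfl
    | ha z w hz hw => rw [smul_add, map_add, map_add, smul_add, hz, hw]

@[simp]
theorem lTensor_tmul (f : X →ₗ[A] X') (n : N) (x : X) :
    lTensor A N B f (tmul A n x) = tmul A n (f x) := rfl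

theorem lTensor_id : lTensor A N B (LinearMap.id : X →ₗ[A] X) = LinearMap.id := by
  apply LinearMap.toAddMonoidHom_injective
  exact addHom_ext A fun _ _ => rfl

theorem lTensor_comp (g : X' →ₗ[A] X'') (f : X →ₗ[A] X') :
    lTensor A N B (g ∘ₗ f) = lTensor A N B g ∘ₗ lTensor A N B f := by
  apply LinearMap.toAddMonoidHom_injective
  exact addHom_ext A fun _ _ => rfl

theorem lTensor_sub (f g : X →ₗ[A] X') :
    lTensor A N B (f - g) = lTensor A N B f - lTensor A N B g := by
  rw [eq_sub_iff_add_eq]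
  apply LinearMap.toAddMonoidHom_injective
  refine addHom_ext A fun n x => ?_
  change tmul A n ((f - g) x) + tmul A n (g x) = tmul A n (f x)
  rw [← tmul_add, LinearMap.sub_apply, sub_add_cancel]

theorem finite [Module.Finite B N] [Module.Finite A X] : Module.Finite B (BalTensor A N X) := by
  classical
  obtain ⟨s, hs⟩ := Module.Finite.fg_top (R := B) (M := N)
  obtain ⟨t, ht⟩ := Module.Finite.fg_top (R := A) (M := X)
  refine ⟨⟨(s ×ˢ t).image fun p => tmul A p.1 p.2, eq_top_iff.2 fun z _ => ?_⟩⟩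
  set S := Submodule.span B (((s ×ˢ t).image fun p => tmul A p.1 p.2 : Finset _) :
    Set (BalTensor A N X)) with hS
  have h1 : ∀ x ∈ t, ∀ n : N, tmul A n x ∈ S := by
    intro x hx n
    have hn : n ∈ Submodule.span B (s : Set N) := hs ▸ Submodule.mem_top
    induction hn using Submodule.span_induction with
    | mem n hn =>
      exact Submodule.subset_span (Finset.mem_coe.2
        (Finset.mem_image.2 ⟨(n, x), Finset.mem_product.2 ⟨hn, hx⟩, rfl⟩))
    | zero =>
      have : tmul A (0 : N) x = 0 := by simpa using add_tmul A (0 : N) 0 x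
      rw [this]; exact S.zero_mem
    | add n n' _ _ h h' => rw [add_tmul]; exact S.add_mem h h'
    | smul b n _ h => rw [← smul_left_tmul]; exact S.smul_mem b h
  have h2 : ∀ (x : X) (n : N), tmul A n x ∈ S := by
    intro x
    have hx : x ∈ Submodule.span A (t : Set X) := ht ▸ Submodule.mem_top
    induction hx using Submodule.span_induction with
    | mem x hx => exact h1 x hx
    | zero => intro n; rw [tmul_zero]; exact S.zero_mem
    | add x x' _ _ h h' => intro n; rw [tmul_add]; exact S.add_mem (h n) (h' n)
    | smul a x _ h => intro n; rw [← smul_tmul]; exact h _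
  induction z using induction_on with
  | h0 => exact S.zero_mem
  | ht n x => exact h2 x n
  | ha z w hz hw => exact S.add_mem (hz trivial) (hw trivial)

/-- If `N` is projective as a left `B`-module, then `N ⊗_A -` preserves projective modules. -/
theorem projective [Module.Projective B N] [Module.Projective A X] :
    Module.Projective B (BalTensor A N X) := by
  classical
  have : SMulCommClass Aᵐᵒᵖ B N := SMulCommClass.symm B Aᵐᵒᵖ N
  have : Module.Projective B (X →₀ N) :=
    Module.Projective.of_equiv (finsuppLEquivDirectSum B N X).symm
  obtain ⟨s, hs⟩ := (Module.projective_def (R := A) (P := X)).1 inferInstance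
  let r (n : N) : A →+ N := AddMonoidHom.mk' (fun a => op a • n) (fun a a' => by
    rw [MulOpposite.op_add, add_smul])
  have hr (n n' : N) : r (n + n') = r n + r n' := by
    ext a; exact smul_add _ _ _
  let i₀ : BalTensor A N X →+ (X →₀ N) := lift A
    (AddMonoidHom.mk' (fun n => (Finsupp.mapRange.addMonoidHom (r n)).comp s.toAddMonoidHom)
      (fun n n' => by
        ext x y
        simp [hr]))
    (fun n a x => by
      ext y
      simp [r, mul_smul])
  have hi₀ (n : N) (x y : X) : i₀ (tmul A n x) y = op (s x y) • n := rfl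
  let i : BalTensor A N X →ₗ[B] (X →₀ N) :=
    { toFun := i₀
      map_add' := map_add i₀
      map_smul' := fun b z => by
        induction z using induction_on with
        | h0 => simp
        | ht n x =>
          ext y
          rw [smul_left_tmul, RingHom.id_apply, Finsupp.smul_apply, hi₀, hi₀, smul_comm]
        | ha z w hz hw => rw [smul_add, map_add, map_add, smul_add, hz, hw] }
  let q : (X →₀ N) →ₗ[B] BalTensor A N X := Finsupp.lsum ℕ fun x =>
    { toFun := fun n => tmul A n x
      map_add' := fun n n' => add_tmul A n n' x
      map_smul' := fun _ _ => rfl }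
  refine Module.Projective.of_split i q ?_
  apply LinearMap.toAddMonoidHom_injective
  refine addHom_ext A fun n x => ?_
  change (i₀ (tmul A n x)).sum (fun y m => tmul A m y) = tmul A n x
  have h1 : i₀ (tmul A n x) = Finsupp.mapRange (r n) (map_zero _) (s x) := rfl
  rw [h1, Finsupp.sum_mapRange_index]
  · conv_rhs => rw [← hs x, Finsupp.linearCombination_apply, Finsupp.sum]
    have h2 : ∀ (t : Finset X) (g : X → X), tmul A n (∑ y ∈ t, g y) = ∑ y ∈ t, tmul A n (g y) := by
      intro t g
      induction t using Finset.induction_on with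
      | empty => simp [tmul_zero]
      | insert a t ha ih => rw [Finset.sum_insert ha, Finset.sum_insert ha, tmul_add, ih]
    rw [h2, Finsupp.sum]
    refine Finset.sum_congr rfl fun y _ => ?_
    exact smul_tmul A n _ y
  · intro y
    simpa using add_tmul A (0 : N) 0 y

end Functoriality

end BalTensor

end BalancedTensor

section Bimodules

/-- Isomorphisms of `A`-`B`-bimodules. -/
structure BimoduleIso (A B : Type u) [Ring A] [Ring B] (X Y : Type u)
    [AddCommGroup X] [Module A X] [Module Bᵐᵒᵖ X]
    [AddCommGroup Y] [Module A Y] [Module Bᵐᵒᵖ Y] extends X ≃ₗ[A] Y where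
  map_op_smul' : ∀ (b : B) (x : X), toFun (op b • x) = op b • toFun x

variable (k A B : Type u) [Field k] [Ring A] [Algebra k A] [Ring B] [Algebra k B]
  (M : Type u) [AddCommGroup M] [Module k M] [Module A M] [Module Bᵐᵒᵖ M]
  [IsScalarTower k A M] [IsScalarTower k Bᵐᵒᵖ M] [SMulCommClass A Bᵐᵒᵖ M]

/-- The `A`-`B`-bimodule `M` is projective, i.e. projective as a module over `A ⊗_k Bᵐᵒᵖ`. -/
def IsProjectiveBimodule : Prop :=
  letI : Module (A ⊗[k] Bᵐᵒᵖ) M := TensorProduct.Algebra.module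
  Module.Projective (A ⊗[k] Bᵐᵒᵖ) M

/-- The module `M` has no nonzero projective direct summand. -/
def HasNoProjectiveSummand (R : Type u) [Ring R] (M : Type u) [AddCommGroup M] [Module R M] :
    Prop :=
  ∀ W W' : Submodule R M, IsCompl W W' → Module.Projective R W → W = ⊥

/-- The `A`-`B`-bimodule `M` has no nonzero projective direct summand (as a bimodule). -/
def BimoduleHasNoProjectiveSummand : Prop :=
  letI : Module (A ⊗[k] Bᵐᵒᵖ) M := TensorProduct.Algebra.module
  HasNoProjectiveSummand (A ⊗[k] Bᵐᵒᵖ) M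

/-- The algebra `A` has no nonzero semisimple direct summand (as an algebra). -/
def HasNoSemisimpleSummand : Prop :=
  ∀ (A₁ A₂ : Type u) [Ring A₁] [Algebra k A₁] [Ring A₂] [Algebra k A₂],
    Nonempty (A ≃ₐ[k] A₁ × A₂) → IsSemisimpleRing A₁ → Subsingleton A₁

/-- The (not necessarily commutative) `k`-algebra `A` is separable, i.e. projective as an
`A`-`A`-bimodule. -/
def IsSeparableAlgebra : Prop :=
  IsProjectiveBimodule k A A A

/-- The bimodules `_A M_B` and `_B N_A` define a stable equivalence of Morita type between `A` and
`B`, with `M ⊗_B N ≅ A ⊕ P` and `N ⊗_A M ≅ B ⊕ Q` as bimodules, `P` and `Q` being projective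
bimodules. -/
structure IsStableEquivOfMoritaType
    (N : Type u) [AddCommGroup N] [Module k N] [Module B N] [Module Aᵐᵒᵖ N]
    [IsScalarTower k B N] [IsScalarTower k Aᵐᵒᵖ N] [SMulCommClass B Aᵐᵒᵖ N]
    (P : Type u) [AddCommGroup P] [Module k P] [Module A P] [Module Aᵐᵒᵖ P]
    [IsScalarTower k A P] [IsScalarTower k Aᵐᵒᵖ P] [SMulCommClass A Aᵐᵒᵖ P]
    (Q : Type u) [AddCommGroup Q] [Module k Q] [Module B Q] [Module Bᵐᵒᵖ Q]
    [IsScalarTower k B Q] [IsScalarTower k Bᵐᵒᵖ Q] [SMulCommClass B Bᵐᵒᵖ Q] : Prop where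
  projective_left_M : Module.Projective A M
  projective_right_M : Module.Projective Bᵐᵒᵖ M
  projective_left_N : Module.Projective B N
  projective_right_N : Module.Projective Aᵐᵒᵖ N
  projective_P : IsProjectiveBimodule k A A P
  projective_Q : IsProjectiveBimodule k B B Q
  iso_P : Nonempty (BimoduleIso A A (BalTensor B M N) (A × P))
  iso_Q : Nonempty (BimoduleIso B B (BalTensor A N M) (B × Q))

end Bimodules

section StableCategory

/-- The homomorphism `f` factorizes through a (finitely generated) projective module. -/
def FactorsThroughProjective {A : Type u} [Ring A] {X Y : FGModuleCat.{u} A} (f : X ⟶ Y) : Prop :=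
  ∃ (Z : FGModuleCat.{u} A) (g : X ⟶ Z) (h : Z ⟶ Y), Module.Projective A Z ∧ g ≫ h = f

/-- Two homomorphisms are identified in the stable category if their difference factorizes through
a projective module. -/
def stableRel (A : Type u) [Ring A] : HomRel (FGModuleCat.{u} A) :=
  fun _ _ f g => FactorsThroughProjective (f - g)

instance stableRel_congruence (A : Type u) [Ring A] : Congruence (stableRel A) where
  equivalence {X Y} :=
    { refl := fun f => ⟨FGModuleCat.of A PUnit.{u + 1}, 0, 0,
        inferInstanceAs (Module.Projective A PUnit.{u + 1}), by simp⟩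
      symm := by
        rintro f g ⟨Z, i, p, hZ, h⟩
        exact ⟨Z, i, -p, hZ, by rw [Preadditive.comp_neg, h, neg_sub]⟩
      trans := by
        rintro f g e ⟨Z, i, p, hZ, h⟩ ⟨Z', i', p', hZ', h'⟩
        refine ⟨FGModuleCat.of A (Z × Z'),
          FGModuleCat.ofHom (i.hom.hom.prod i'.hom.hom),
          FGModuleCat.ofHom (p.hom.hom.coprod p'.hom.hom),
          inferInstanceAs (Module.Projective A (Z × Z')), ?_⟩
        rw [← sub_add_sub_cancel f g e, ← h, ← h']
        ext x
        rfl }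
  comp_left := by
    rintro X Y W f g g' ⟨Z, i, p, hZ, h⟩
    exact ⟨Z, f ≫ i, p, hZ, by rw [Category.assoc, h, Preadditive.comp_sub]⟩
  comp_right := by
    rintro X Y W f f' g ⟨Z, i, p, hZ, h⟩
    exact ⟨Z, i, p ≫ g, hZ, by rw [← Category.assoc, h, Preadditive.sub_comp]⟩

/-- The stable module category of `A`. -/
abbrev StableModuleCat (A : Type u) [Ring A] := CategoryTheory.Quotient (stableRel A)

/-- The canonical functor from the category of finitely generated modules to the stable module
category. -/
abbrev toStable (A : Type u) [Ring A] : FGModuleCat.{u} A ⥤ StableModuleCat A :=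
  CategoryTheory.Quotient.functor (stableRel A)

variable (k A B : Type u) [Field k] [Ring A] [Algebra k A] [Ring B] [Algebra k B]

section Tensor

variable (N : Type u) [AddCommGroup N] [Module k N] [Module B N] [Module Aᵐᵒᵖ N]
  [IsScalarTower k B N] [SMulCommClass B Aᵐᵒᵖ N] [FiniteDimensional k N]

/-- The functor `N ⊗_A -` from finitely generated `A`-modules to finitely generated
`B`-modules. -/
noncomputable def tensorFunctor : FGModuleCat.{u} A ⥤ FGModuleCat.{u} B where
  obj X := ⟨ModuleCat.of B (BalTensor A N X), by
    have : Module.Finite B N := Module.Finite.of_restrictScalars_finite k B N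
    exact BalTensor.finite A (B := B) (N := N) (X := X)⟩
  map f := ObjectProperty.homMk (ModuleCat.ofHom (BalTensor.lTensor A N B f.hom.hom))
  map_id X := by
    apply FGModuleCat.hom_ext
    exact BalTensor.lTensor_id A
  map_comp f g := by
    apply FGModuleCat.hom_ext
    exact BalTensor.lTensor_comp A _ _

/-- The functor `Φ_N` between stable module categories that is induced by `N ⊗_A -`, for a bimodule
`N` that is projective as a left module. -/
noncomputable def stableTensorFunctor (hN : Module.Projective B N) :
    StableModuleCat A ⥤ StableModuleCat B :=
  CategoryTheory.Quotient.lift (stableRel A) (tensorFunctor k A B N ⋙ toStable B) (by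
    rintro X Y f g ⟨Z, i, p, hZ, h⟩
    refine CategoryTheory.Quotient.sound (stableRel B)
      ⟨(tensorFunctor k A B N).obj Z, (tensorFunctor k A B N).map i,
        (tensorFunctor k A B N).map p, ?_, ?_⟩
    · exact BalTensor.projective A (B := B) (N := N) (X := Z)
    · rw [← Functor.map_comp, h]
      apply FGModuleCat.hom_ext
      exact BalTensor.lTensor_sub A _ _)

end Tensor

open scoped ModuleCat.Algebra in
/-- The functor `Φ` between stable module categories lifts to a Morita equivalence, i.e. to a
`k`-linear equivalence between the categories of finitely generated modules. -/
def LiftsToMoritaEquivalence (Φ : StableModuleCat A ⥤ StableModuleCat B) : Prop :=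
  ∃ F : FGModuleCat.{u} A ⥤ FGModuleCat.{u} B, F.IsEquivalence ∧
    (∃ _ : F.Additive, F.Linear k) ∧ Nonempty (F ⋙ toStable B ≅ toStable A ⋙ Φ)

end StableCategory

/-! The functors `M ⊗ -` and `N ⊗ -` behave like a two-sided adjoint pair, up to invertible errors.
From the inclusion of `B` in `N ⊗ M` and the projection of `M ⊗ N` onto `A` one forms `adj` and
`adj'` between `Hom(M ⊗ Y, X)` and `Hom(Y, N ⊗ X)`. The triangle composites on `M ⊗ Y` need not be
the identity. Their product, however, differs from the identity by a map through `M ⊗ Q ⊗ Y`. For `Y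
= B` this is an endomorphism of the bimodule `M` through a projective bimodule, hence nilpotent by
Fitting's lemma because `M` has no projective summand (`isNilpotent_error`). So the triangle maps
are surjective, and bijective on finitely generated modules, and `adj` is injective
(`eq_zero_of_adj_eq_zero`).

If `N ⊗ -` preserves simple modules, let `S` be a nonprojective simple module. A map from `P ⊗ S` to
a simple module `S'` gives, by adjunction, a map `N ⊗ S → N ⊗ S'` of simple modules through a
projective module. If it were nonzero, `N ⊗ S` and hence `S` would be projective, so `P ⊗ S = 0`. A
projective simple module is the submodule of a nonsplit extension by a simple module
(`exists_nonsplit`), since otherwise it would produce a central idempotent cutting out a semisimple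
factor; comparing with this extension again gives `P ⊗ S = 0`. Induction on length yields `P = P ⊗ A
= 0`, whence `Q = 0` and `N ⊗ -` is an equivalence.

It remains to deduce from condition (4) that `N ⊗ S` is really simple. Injectivity of both adjunct
maps gives equality of Hom dimensions, and from this `P ⊗ Y` is injective relative to finitely
generated modules as well as projective (`exists_extension_to_balTensor_P`). If `S` is projective, a
nonsplit extension then forces `P ⊗ S = 0`, so `M ⊗ N ⊗ S ≅ S` and `N ⊗ S` is simple. If `S` is not
projective, `N ⊗ S` is the sum of a simple module and a projective module `R`. To kill `R`, embed
`S` in the dual `DA` of `A` and extend `S → M ⊗ R` to `DA`. A map `N ⊗ DA → B` is a bimodule map `N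
→ B ⊗ Aᵐᵒᵖ`, whose values lie in the Jacobson radical because `N` has no projective summand.
Separability makes `B/rad B ⊗ (A/rad A)ᵐᵒᵖ` semisimple, so all linear forms on `R` have values in
`rad B`, and Nakayama's lemma gives `R = 0`. -/

section BalancedTensorLemmas

namespace BalTensor

/-! ### Functoriality and exactness of the balanced tensor product. -/

section Basic

variable (A : Type u₁) [Ring A] {N N' : Type u₂} {X X' X'' : Type u₃}
  [AddCommGroup N] [Module Aᵐᵒᵖ N] [AddCommGroup N'] [Module Aᵐᵒᵖ N']
  [AddCommGroup X] [Module A X] [AddCommGroup X'] [Module A X'] [AddCommGroup X''] [Module A X'']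

theorem zero_tmul (x : X) : tmul A (0 : N) x = 0 := by
  simpa using add_tmul A (0 : N) 0 x

/-- `x ↦ n ⊗ x` as an additive map. -/
def tmulRight (n : N) : X →+ BalTensor A N X :=
  AddMonoidHom.mk' (fun x => tmul A n x) fun x x' => tmul_add A n x x'

/-- `n ↦ n ⊗ x` as an additive map. -/
def tmulLeft (x : X) : N →+ BalTensor A N X :=
  AddMonoidHom.mk' (fun n => tmul A n x) fun n n' => add_tmul A n n' x

@[simp] theorem tmulRight_apply (n : N) (x : X) : tmulRight A n x = tmul A n x := rfl

@[simp] theorem tmulLeft_apply (n : N) (x : X) : tmulLeft A x n = tmul A n x := rfl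

theorem tmul_sum {ι : Type*} (n : N) (s : Finset ι) (f : ι → X) :
    tmul A n (∑ i ∈ s, f i) = ∑ i ∈ s, tmul A n (f i) :=
  map_sum (tmulRight A n) f s

theorem sum_tmul {ι : Type*} (s : Finset ι) (f : ι → N) (x : X) :
    tmul A (∑ i ∈ s, f i) x = ∑ i ∈ s, tmul A (f i) x :=
  map_sum (tmulLeft A x) f s

variable {B : Type u₄} [Ring B] [Module B N] [SMulCommClass B Aᵐᵒᵖ N]
  [Module B N'] [SMulCommClass B Aᵐᵒᵖ N']

variable (N X) in
/-- The universal property, for `B`-linear maps. -/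
def liftLinear {Z : Type*} [AddCommGroup Z] [Module B Z] (f : N →+ X →+ Z)
    (hf : ∀ n (a : A) x, f (op a • n) x = f n (a • x))
    (hB : ∀ (b : B) n x, f (b • n) x = b • f n x) : BalTensor A N X →ₗ[B] Z where
  toFun := lift A f hf
  map_add' := map_add _
  map_smul' b z := by
    induction z using induction_on with
    | h0 => simp
    | ht n x => rw [smul_left_tmul]; exact hB b n x
    | ha z w hz hw => rw [smul_add, map_add, map_add, smul_add, hz, hw]

@[simp]
theorem liftLinear_tmul {Z : Type*} [AddCommGroup Z] [Module B Z] (f : N →+ X →+ Z)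
    (hf : ∀ n (a : A) x, f (op a • n) x = f n (a • x))
    (hB : ∀ (b : B) n x, f (b • n) x = b • f n x) (n : N) (x : X) :
    liftLinear A N X f hf hB (tmul A n x) = f n x := rfl

variable {A} in
theorem linearMap_ext {Z : Type*} [AddCommGroup Z] [Module B Z] {f g : BalTensor A N X →ₗ[B] Z}
    (h : ∀ n x, f (tmul A n x) = g (tmul A n x)) : f = g :=
  LinearMap.toAddMonoidHom_injective (addHom_ext A h)

theorem lTensor_comp_apply (g : X' →ₗ[A] X'') (f : X →ₗ[A] X') (z : BalTensor A N X) :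
    lTensor A N B (g ∘ₗ f) z = lTensor A N B g (lTensor A N B f z) := by
  rw [lTensor_comp]; rfl

theorem lTensor_id_apply (z : BalTensor A N X) : lTensor A N B (.id : X →ₗ[A] X) z = z := by
  rw [lTensor_id]; rfl

theorem lTensor_add (f g : X →ₗ[A] X') :
    lTensor A N B (f + g) = lTensor A N B f + lTensor A N B g :=
  linearMap_ext fun n x => tmul_add A n (f x) (g x)

theorem lTensor_zero : lTensor A N B (0 : X →ₗ[A] X') = 0 :=
  linearMap_ext fun n _ => tmul_zero A n

theorem lTensor_surjective {f : X →ₗ[A] X'} (hf : Function.Surjective f) :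
    Function.Surjective (lTensor A N B f) := by
  intro z
  induction z using induction_on with
  | h0 => exact ⟨0, map_zero _⟩
  | ht n x =>
    obtain ⟨x, rfl⟩ := hf x
    exact ⟨tmul A n x, rfl⟩
  | ha z w hz hw =>
    obtain ⟨z, rfl⟩ := hz
    obtain ⟨w, rfl⟩ := hw
    exact ⟨z + w, map_add _ _ _⟩

theorem lTensor_injective_of_leftInverse {f : X →ₗ[A] X'} {g : X' →ₗ[A] X} (h : g ∘ₗ f = .id) :
    Function.Injective (lTensor A N B f) := by
  refine Function.LeftInverse.injective (g := lTensor A N B g) fun z => ?_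
  rw [← lTensor_comp_apply, h, lTensor_id_apply]

/-- A `B`-linear map on `N ⊗_A X'` that vanishes on the image of `N ⊗_A X` factors through
`N ⊗_A X''` if `X → X' → X'' → 0` is exact. -/
theorem exists_factor_lTensor {f : X →ₗ[A] X'} {g : X' →ₗ[A] X''} (hg : Function.Surjective g)
    (hfg : LinearMap.ker g ≤ LinearMap.range f) {Z : Type*} [AddCommGroup Z] [Module B Z]
    (h : BalTensor A N X' →ₗ[B] Z) (hh : h ∘ₗ lTensor A N B f = 0) :
    ∃ h' : BalTensor A N X'' →ₗ[B] Z, h' ∘ₗ lTensor A N B g = h := by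
  -- Elements of `X'` with the same image in `X''` differ by an element from `X`, so any
  -- set-theoretic section `s` of `g` defines the factorization.
  have key (n : N) {x y : X'} (hxy : g x = g y) : h (tmul A n x) = h (tmul A n y) := by
    obtain ⟨w, hw⟩ := hfg (show x - y ∈ LinearMap.ker g by simp [hxy])
    have h1 : h (tmul A n (f w)) = 0 := LinearMap.congr_fun hh (tmul A n w)
    rw [← sub_add_cancel x y, ← hw, tmul_add, map_add, h1, zero_add]
  let s := Function.surjInv hg
  have hs : ∀ x, g (s x) = x := Function.surjInv_eq hg
  refine ⟨liftLinear A N X'' (AddMonoidHom.mk' (fun n => AddMonoidHom.mk'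
    (fun x => h (tmul A n (s x))) fun x y => ?_) fun n n' => ?_) ?_ ?_, ?_⟩
  · rw [← map_add, ← tmul_add]
    exact key n (by rw [map_add, hs, hs, hs])
  · ext x
    simp [add_tmul]
  · intro n a x
    simp only [AddMonoidHom.mk'_apply, smul_tmul]
    exact key n (by rw [map_smul, hs, hs])
  · intro b n x
    simp only [AddMonoidHom.mk'_apply, ← smul_left_tmul, map_smul]
  · refine linearMap_ext fun n x => ?_
    simpa using key n (hs _)

/-- By right exactness the identity of `N ⊗ X'`, which vanishes on the zero module `N ⊗ X`, factors
through the zero module `N ⊗ X''`. -/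
theorem subsingleton_of_exact (N : Type u₂) [AddCommGroup N] [Module Aᵐᵒᵖ N]
    (B : Type u₄) [Ring B] [Module B N] [SMulCommClass B Aᵐᵒᵖ N] {f : X →ₗ[A] X'}
    {g : X' →ₗ[A] X''} (hg : Function.Surjective g)
    (hfg : LinearMap.ker g ≤ LinearMap.range f) [Subsingleton (BalTensor A N X)]
    [Subsingleton (BalTensor A N X'')] : Subsingleton (BalTensor A N X') := by
  obtain ⟨h', hh'⟩ := exists_factor_lTensor (B := B) A hg hfg
    (LinearMap.id : BalTensor A N X' →ₗ[B] BalTensor A N X')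
    (LinearMap.ext fun z => by rw [Subsingleton.elim z 0]; simp)
  refine subsingleton_of_forall_eq 0 fun z => ?_
  have := LinearMap.congr_fun hh' z
  rw [LinearMap.comp_apply, Subsingleton.elim (lTensor A N B g z) 0, map_zero] at this
  exact this.symm

/-- The quotient map onto the cokernel of `N ⊗ f` factors through `N ⊗ X'' = 0`, so the cokernel
vanishes. -/
theorem lTensor_surjective_of_exact {f : X →ₗ[A] X'} {g : X' →ₗ[A] X''}
    (hg : Function.Surjective g) (hfg : LinearMap.ker g ≤ LinearMap.range f)
    [Subsingleton (BalTensor A N X'')] : Function.Surjective (lTensor A N B f) := by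
  obtain ⟨h', hh'⟩ := exists_factor_lTensor (B := B) A hg hfg
    (LinearMap.range (lTensor A N B f)).mkQ (by ext z; simp)
  intro z
  have := LinearMap.congr_fun hh' z
  rw [LinearMap.comp_apply, Subsingleton.elim (lTensor A N B g z) 0, map_zero] at this
  simpa using this.symm

/-- Projective right modules are flat. -/
theorem lTensor_injective [Module.Projective Aᵐᵒᵖ N] {f : X →ₗ[A] X'}
    (hf : Function.Injective f) : Function.Injective (lTensor A N B f) := by
  classical
  obtain ⟨s, hs⟩ := (Module.projective_def (R := Aᵐᵒᵖ) (P := N)).1 inferInstance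
  -- Coordinates of `N ⊗ Y` with respect to a dual basis of `N`: they are natural in `Y`, and
  -- finitely many of them recover a given element.
  let c (Y : Type u₃) [AddCommGroup Y] [Module A Y] (m : N) : BalTensor A N Y →+ Y := lift A
    (AddMonoidHom.mk' (fun n => AddMonoidHom.mk' (fun y => unop (s n m) • y)
      fun y y' => smul_add _ _ _) fun n n' => by ext y; simp [add_smul])
    (fun n a y => by simp [mul_smul])
  have hc (Y : Type u₃) [AddCommGroup Y] [Module A Y] (m n : N) (y : Y) :
      c Y m (tmul A n y) = unop (s n m) • y := rfl
  have hfin (Y : Type u₃) [AddCommGroup Y] [Module A Y] (z : BalTensor A N Y) :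
      ∃ t : Finset N, z = ∑ m ∈ t, tmul A m (c Y m z) := by
    -- The stronger form, valid for every larger finite set, survives addition by taking unions.
    suffices ∃ t : Finset N, ∀ t', t ⊆ t' → z = ∑ m ∈ t', tmul A m (c Y m z) by
      obtain ⟨t, ht⟩ := this
      exact ⟨t, ht t subset_rfl⟩
    induction z using induction_on with
    | h0 => exact ⟨∅, by simp [tmul_zero]⟩
    | ht n y =>
      refine ⟨(s n).support, fun t' ht' => ?_⟩
      conv_lhs => rw [← hs n, Finsupp.linearCombination_apply,
        Finsupp.sum_of_support_subset _ ht' _ (by simp), sum_tmul]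
      refine Finset.sum_congr rfl fun m _ => ?_
      rw [hc, ← smul_tmul]; rfl
    | ha z w hz hw =>
      obtain ⟨t, ht⟩ := hz
      obtain ⟨t', ht'⟩ := hw
      refine ⟨t ∪ t', fun r hr => ?_⟩
      conv_lhs => rw [ht r (Finset.union_subset_left hr), ht' r (Finset.union_subset_right hr)]
      rw [← Finset.sum_add_distrib]
      simp only [map_add, tmul_add]
  have hnat (m : N) (z : BalTensor A N X) : c X' m (lTensor A N B f z) = f (c X m z) := by
    induction z using induction_on with
    | h0 => simp
    | ht n y => simp [hc]
    | ha z w hz hw => simp only [map_add, hz, hw]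
  refine (injective_iff_map_eq_zero _).2 fun z hz => ?_
  obtain ⟨t, ht⟩ := hfin X z
  rw [ht]
  refine Finset.sum_eq_zero fun m _ => ?_
  have : f (c X m z) = 0 := by rw [← hnat, hz, map_zero]
  rw [hf (this.trans (map_zero f).symm), tmul_zero]

/-- The map `g ⊗ X`, for a homomorphism `g` of bimodules. -/
def rTensor (X : Type u₃) [AddCommGroup X] [Module A X] (g : N →+ N')
    (hg : ∀ (a : A) n, g (op a • n) = op a • g n)
    (hB : ∀ (b : B) n, g (b • n) = b • g n) : BalTensor A N X →ₗ[B] BalTensor A N' X :=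
  liftLinear A N X (AddMonoidHom.mk' (fun n => tmulRight A (g n)) fun n n' => by
      ext x; simp [add_tmul])
    (fun n a x => by simp [hg, smul_tmul]) (fun b n x => by simp [hB, smul_left_tmul])

@[simp]
theorem rTensor_tmul (g : N →+ N') (hg : ∀ (a : A) n, g (op a • n) = op a • g n)
    (hB : ∀ (b : B) n, g (b • n) = b • g n) (n : N) (x : X) :
    rTensor A X g hg hB (tmul A n x) = tmul A (g n) x := rfl

variable (X) in
/-- The canonical isomorphism `A ⊗_A X ≅ X`. -/
def lid (X : Type u₁) [AddCommGroup X] [Module A X] : BalTensor A A X ≃ₗ[A] X :=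
  LinearEquiv.ofLinearMap
    (liftLinear A A X (AddMonoidHom.mk' (fun a => AddMonoidHom.mk' (fun x => a • x)
      fun x y => smul_add a x y) fun a b => by ext x; simp [add_smul])
      (fun n a x => by simp [mul_smul]) (fun b n x => by simp [mul_smul]))
    { toFun := fun x => tmul A (1 : A) x
      map_add' := tmul_add A _
      map_smul' := fun a x => by
        rw [RingHom.id_apply, smul_left_tmul, ← smul_tmul]; simp }
    (by ext x; simp)
    (linearMap_ext fun a x => by
      simp only [LinearMap.comp_apply, liftLinear_tmul, AddMonoidHom.mk'_apply, LinearMap.coe_mk,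
        AddHom.coe_mk, LinearMap.id_apply]
      rw [← smul_tmul]; simp)

end Basic

/-! ### Scalars and bimodule structures on tensor products. -/

section Bimodule

variable (A : Type u₁) [Ring A] {N : Type u₂} {X X' : Type u₃}
  [AddCommGroup N] [Module Aᵐᵒᵖ N] [AddCommGroup X] [Module A X] [AddCommGroup X'] [Module A X']
  {B : Type u₄} [Ring B] [Module B N] [SMulCommClass B Aᵐᵒᵖ N]

instance smulCommClass {C : Type*} [Ring C] [Module Cᵐᵒᵖ X] [SMulCommClass A Cᵐᵒᵖ X] :
    SMulCommClass B Cᵐᵒᵖ (BalTensor A N X) where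
  smul_comm b c z := by
    induction z using induction_on with
    | h0 => simp
    | ht n x => rfl
    | ha z w hz hw => simp only [smul_add, hz, hw]

variable {k : Type*} [Field k] [Module k N]

instance isScalarTower [Algebra k B] [IsScalarTower k B N] [SMulCommClass k Aᵐᵒᵖ N] :
    IsScalarTower k B (BalTensor A N X) where
  smul_assoc c b z := by
    induction z using induction_on with
    | h0 => simp
    | ht n x => simp only [smul_left_tmul, smul_assoc]
    | ha z w hz hw => simp only [smul_add, hz, hw]

variable [Algebra k A] [IsScalarTower k Aᵐᵒᵖ N]

theorem algebra_smul_tmul [Module k X] [IsScalarTower k A X] (c : k) (n : N) (x : X) :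
    tmul A (c • n) x = tmul A n (c • x) := by
  rw [← algebraMap_smul A c x, ← smul_tmul, ← MulOpposite.algebraMap_apply,
    algebraMap_smul]

theorem smul_left_tmul' [Module k X] [IsScalarTower k A X] (c : k) (n : N) (x : X) :
    c • tmul A n x = tmul A n (c • x) := by
  rw [← algebra_smul_tmul]; rfl

theorem lTensor_smul [Module k X'] [IsScalarTower k A X'] [Algebra k B] [IsScalarTower k B N]
    (c : k) (f : X →ₗ[A] X') : lTensor A N B (c • f) = c • lTensor A N B f :=
  linearMap_ext fun n x => (smul_left_tmul' A c n (f x)).symm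

instance isScalarTower_op {C : Type*} [Ring C] [Algebra k C] [Module k X] [IsScalarTower k A X]
    [Module Cᵐᵒᵖ X] [IsScalarTower k Cᵐᵒᵖ X] [SMulCommClass A Cᵐᵒᵖ X] :
    IsScalarTower k Cᵐᵒᵖ (BalTensor A N X) where
  smul_assoc c b z := by
    induction z using induction_on with
    | h0 => simp
    | ht n x =>
      obtain ⟨b, rfl⟩ := op_surjective b
      rw [← op_smul, smul_right_tmul, smul_right_tmul, smul_left_tmul', op_smul, smul_assoc]
    | ha z w hz hw => simp only [smul_add, hz, hw]

theorem finiteDimensional [FiniteDimensional k N] [Module.Finite A X] :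
    FiniteDimensional k (BalTensor A N X) :=
  finite A (B := k)

end Bimodule

/-! ### Associativity and the natural splitting of `M ⊗ N ⊗ X`. -/

section Associativity

variable {A B : Type u} [Ring A] [Ring B] {M N X : Type u}
  [AddCommGroup M] [Module A M] [Module Bᵐᵒᵖ M] [SMulCommClass A Bᵐᵒᵖ M]
  [AddCommGroup N] [Module B N] [Module Aᵐᵒᵖ N] [SMulCommClass B Aᵐᵒᵖ N]
  [AddCommGroup X] [Module A X]

variable (B M N X) in
/-- The map `M ⊗_B (N ⊗_A X) → (M ⊗_B N) ⊗_A X`. -/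
def assocHom : BalTensor B M (BalTensor A N X) →ₗ[A] BalTensor A (BalTensor B M N) X :=
  liftLinear B M _ (AddMonoidHom.mk' (fun m => lift A
      (AddMonoidHom.mk' (fun n => tmulRight A (tmul B m n)) fun n n' => by
        ext x; simp [tmul_add, add_tmul])
      fun n a x => by simp [← smul_right_tmul, smul_tmul])
    fun m m' => addHom_ext A fun n x => by simp [add_tmul])
    (fun m b z => by
      induction z using induction_on with
      | h0 => simp
      | ht n x => simp [smul_left_tmul, smul_tmul]
      | ha z w hz hw => simp only [smul_add, map_add, hz, hw])
    (fun a m z => by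
      induction z using induction_on with
      | h0 => simp
      | ht n x => simp [smul_left_tmul]
      | ha z w hz hw => simp only [smul_add, map_add, hz, hw])

@[simp]
theorem assocHom_tmul (m : M) (n : N) (x : X) :
    assocHom B M N X (tmul B m (tmul A n x)) = tmul A (tmul B m n) x := rfl

variable (B M N X) in
/-- The map `(M ⊗_B N) ⊗_A X → M ⊗_B (N ⊗_A X)`. -/
def assocInv : BalTensor A (BalTensor B M N) X →ₗ[A] BalTensor B M (BalTensor A N X) :=
  liftLinear A _ X (lift B (AddMonoidHom.mk' (fun m => AddMonoidHom.mk'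
      (fun n => (tmulRight B m).comp (tmulRight A n)) fun n n' => by
        ext x; simp [tmul_add, add_tmul]) fun m m' => by ext n x; simp [add_tmul])
      fun m b n => by ext x; simp [smul_tmul, smul_left_tmul])
    (fun z a x => by
      induction z using induction_on with
      | h0 => simp
      | ht m n => simp [smul_right_tmul, smul_tmul]
      | ha z w hz hw => simp only [smul_add, map_add, hz, hw, AddMonoidHom.add_apply])
    (fun a z x => by
      induction z using induction_on with
      | h0 => simp
      | ht m n => simp [smul_left_tmul]
      | ha z w hz hw => simp only [smul_add, map_add, hz, hw, AddMonoidHom.add_apply])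

@[simp]
theorem assocInv_tmul (m : M) (n : N) (x : X) :
    assocInv B M N X (tmul A (tmul B m n) x) = tmul B m (tmul A n x) := rfl

variable (B M N X) in
/-- The associativity isomorphism `M ⊗_B (N ⊗_A X) ≅ (M ⊗_B N) ⊗_A X`. -/
def assoc : BalTensor B M (BalTensor A N X) ≃ₗ[A] BalTensor A (BalTensor B M N) X :=
  LinearEquiv.ofLinearMap (assocHom B M N X) (assocInv B M N X)
    (linearMap_ext fun z x => by
      induction z using induction_on with
      | h0 => simp [zero_tmul]
      | ht m n => rfl
      | ha z w hz hw => rw [add_tmul, map_add, map_add, hz, hw])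
    (linearMap_ext fun m z => by
      induction z using induction_on with
      | h0 => simp [tmul_zero]
      | ht m n => rfl
      | ha z w hz hw => rw [tmul_add, map_add, map_add, hz, hw])

variable (X) {P : Type u} [AddCommGroup P] [Module A P] [Module Aᵐᵒᵖ P] [SMulCommClass A Aᵐᵒᵖ P]

/-- The isomorphism `(A × P) ⊗_A X ≅ X × (P ⊗_A X)`. -/
def prodLeft : BalTensor A (A × P) X ≃ₗ[A] X × BalTensor A P X :=
  LinearEquiv.ofLinearMap
    (((lid A X).toLinearMap ∘ₗ rTensor A X (AddMonoidHom.fst A P) (fun _ _ => rfl)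
      fun _ _ => rfl).prod (rTensor A X (AddMonoidHom.snd A P) (fun _ _ => rfl) fun _ _ => rfl))
    ((rTensor A X (AddMonoidHom.inl A P) (fun _ _ => by simp) (fun _ _ => by simp) ∘ₗ
      (lid A X).symm.toLinearMap).coprod
        (rTensor A X (AddMonoidHom.inr A P) (fun _ _ => by simp) (fun _ _ => by simp)))
    (LinearMap.prod_ext (by
        ext x
        · change (1 : A) • x = x
          rw [one_smul]
        · exact zero_tmul A x) (linearMap_ext fun p x => by
        refine Prod.ext ?_ ?_
        · change (1 : A) • (0 : X) + (0 : A) • x = 0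
          simp
        · change tmul A (0 : P) (0 : X) + tmul A p x = tmul A p x
          simp [tmul_zero]))
    (linearMap_ext fun z x => by
      change tmul A ((1 : A), (0 : P)) (z.1 • x) + tmul A ((0 : A), z.2) x = tmul A z x
      rw [← smul_tmul, ← add_tmul]
      congr 1
      ext <;> simp)

/-- The natural isomorphism `M ⊗_B (N ⊗_A X) ≅ X × (P ⊗_A X)` that is induced by an isomorphism
`M ⊗_B N ≅ A ⊕ P` of bimodules. -/
def splitEquiv (e : BimoduleIso A A (BalTensor B M N) (A × P)) :
    BalTensor B M (BalTensor A N X) ≃ₗ[A] X × BalTensor A P X :=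
  assoc B M N X ≪≫ₗ LinearEquiv.ofLinearMap
    (rTensor A X e.toLinearEquiv.toLinearMap.toAddMonoidHom e.map_op_smul'
      (map_smul e.toLinearEquiv))
    (rTensor A X e.toLinearEquiv.symm.toLinearMap.toAddMonoidHom
      (fun a z => by
        obtain ⟨z, rfl⟩ := e.toLinearEquiv.surjective z
        apply e.toLinearEquiv.injective
        change e.toLinearEquiv (e.toLinearEquiv.symm _) =
          e.toLinearEquiv (op a • e.toLinearEquiv.symm _)
        rw [LinearEquiv.apply_symm_apply, LinearEquiv.symm_apply_apply]
        exact (e.map_op_smul' a z).symm)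
      (map_smul e.toLinearEquiv.symm))
    (linearMap_ext fun z x => congrArg (fun w => tmul A w x) (e.toLinearEquiv.apply_symm_apply z))
    (linearMap_ext fun z x => congrArg (fun w => tmul A w x) (e.toLinearEquiv.symm_apply_apply z))
    ≪≫ₗ prodLeft X

variable {X}

theorem splitEquiv_tmul (e : BimoduleIso A A (BalTensor B M N) (A × P)) (m : M) (n : N) (x : X) :
    splitEquiv X e (tmul B m (tmul A n x)) =
      ((e.toLinearEquiv (tmul B m n)).1 • x, tmul A (e.toLinearEquiv (tmul B m n)).2 x) :=
  rfl

theorem splitEquiv_naturality (e : BimoduleIso A A (BalTensor B M N) (A × P)) {X' : Type u}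
    [AddCommGroup X'] [Module A X'] (f : X →ₗ[A] X') (z : BalTensor B M (BalTensor A N X)) :
    splitEquiv X' e (lTensor B M A (lTensor A N B f) z) =
      (f (splitEquiv X e z).1, lTensor A P A f (splitEquiv X e z).2) := by
  induction z using induction_on with
  | h0 => ext <;> simp
  | ht m z =>
    induction z using induction_on with
    | h0 => simp [tmul_zero, Prod.ext_iff]
    | ht n x => simp [splitEquiv_tmul]
    | ha z w hz hw => simp only [tmul_add, map_add, hz, hw, Prod.fst_add, Prod.snd_add,
        Prod.mk_add_mk]
  | ha z w hz hw => simp only [map_add, hz, hw, Prod.fst_add, Prod.snd_add, Prod.mk_add_mk]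

variable (X)

/-- The projection `M ⊗_B (N ⊗_A X) → X`. -/
def proj (e : BimoduleIso A A (BalTensor B M N) (A × P)) :
    BalTensor B M (BalTensor A N X) →ₗ[A] X :=
  LinearMap.fst A _ _ ∘ₗ (splitEquiv X e).toLinearMap

/-- The section `X → M ⊗_B (N ⊗_A X)`. -/
def incl (e : BimoduleIso A A (BalTensor B M N) (A × P)) :
    X →ₗ[A] BalTensor B M (BalTensor A N X) :=
  (splitEquiv X e).symm.toLinearMap ∘ₗ LinearMap.inl A _ _

/-- The projection `M ⊗_B (N ⊗_A X) → P ⊗_A X`. -/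
def proj' (e : BimoduleIso A A (BalTensor B M N) (A × P)) :
    BalTensor B M (BalTensor A N X) →ₗ[A] BalTensor A P X :=
  LinearMap.snd A _ _ ∘ₗ (splitEquiv X e).toLinearMap

/-- The section `P ⊗_A X → M ⊗_B (N ⊗_A X)`. -/
def incl' (e : BimoduleIso A A (BalTensor B M N) (A × P)) :
    BalTensor A P X →ₗ[A] BalTensor B M (BalTensor A N X) :=
  (splitEquiv X e).symm.toLinearMap ∘ₗ LinearMap.inr A _ _

variable {X} (e : BimoduleIso A A (BalTensor B M N) (A × P))

@[simp] theorem proj_incl (x : X) : proj X e (incl X e x) = x := by simp [proj, incl]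

@[simp] theorem proj'_incl' (x : BalTensor A P X) : proj' X e (incl' X e x) = x := by
  simp [proj', incl']

theorem incl_proj_add (z : BalTensor B M (BalTensor A N X)) :
    incl X e (proj X e z) + incl' X e (proj' X e z) = z := by
  apply (splitEquiv X e).injective
  ext <;> simp [proj, incl, proj', incl']

variable {X' : Type u} [AddCommGroup X'] [Module A X'] (f : X →ₗ[A] X')

theorem proj_naturality (z : BalTensor B M (BalTensor A N X)) :
    proj X' e (lTensor B M A (lTensor A N B f) z) = f (proj X e z) := by
  simp [proj, splitEquiv_naturality]

theorem proj'_naturality (z : BalTensor B M (BalTensor A N X)) :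
    proj' X' e (lTensor B M A (lTensor A N B f) z) = lTensor A P A f (proj' X e z) := by
  simp [proj', splitEquiv_naturality]

theorem incl_naturality (x : X) :
    incl X' e (f x) = lTensor B M A (lTensor A N B f) (incl X e x) := by
  apply (splitEquiv X' e).injective
  simp [incl, splitEquiv_naturality]

theorem incl'_naturality (x : BalTensor A P X) :
    incl' X' e (lTensor A P A f x) = lTensor B M A (lTensor A N B f) (incl' X e x) := by
  apply (splitEquiv X' e).injective
  simp [incl', splitEquiv_naturality]

end Associativity

end BalTensor

end BalancedTensorLemmas

/-! ### Dual bases and Fitting's lemma. -/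

section Projectivity

theorem Module.Projective.of_dualBasis {R W ι : Type*} [Ring R] [AddCommGroup W] [Module R W]
    [Fintype ι] (c : ι → W →ₗ[R] R) (w : ι → W) (h : ∀ z, ∑ i, c i z • w i = z) :
    Module.Projective R W := by
  classical
  refine Module.Projective.of_split (LinearMap.pi c) (Fintype.linearCombination R w) ?_
  ext z
  simpa [Fintype.linearCombination_apply] using h z

theorem Module.Projective.exists_dualBasis (R W : Type*) [Ring R] [AddCommGroup W] [Module R W]
    [Module.Finite R W] [Module.Projective R W] :
    ∃ (n : ℕ) (c : Fin n → W →ₗ[R] R) (w : Fin n → W), ∀ z, ∑ i, c i z • w i = z := by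
  obtain ⟨n, f, g, -, -, hfg⟩ := Module.Finite.exists_comp_eq_id_of_projective R W
  refine ⟨n, fun i => LinearMap.proj i ∘ₗ g, fun i => f (Pi.single i 1), fun z => ?_⟩
  have h := LinearMap.congr_fun hfg z
  rw [LinearMap.comp_apply, LinearMap.pi_apply_eq_sum_univ] at h
  refine Eq.trans (Finset.sum_congr rfl fun i _ => ?_) h
  exact congrArg (fun v => g z i • f v) (funext fun j => by simp [Pi.single_apply, eq_comm])

/-- An endomorphism that factors through a projective module is nilpotent if there is no nonzero
projective direct summand. -/
theorem HasNoProjectiveSummand.isNilpotent {R M Z : Type u} [Ring R] [AddCommGroup M] [Module R M]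
    [AddCommGroup Z] [Module R Z] [IsNoetherian R M] [IsArtinian R M] [Module.Projective R Z]
    (hM : HasNoProjectiveSummand R M) (y : M →ₗ[R] Z) (x : Z →ₗ[R] M) :
    IsNilpotent (x ∘ₗ y : Module.End R M) := by
  set f : Module.End R M := x ∘ₗ y with hf
  -- Fitting: a high power of `f` splits `M` into its kernel and range. The exponent `n + 1` leaves
  -- a factor `x ∘ y` through which the range is seen to be a retract of `Z`.
  obtain ⟨n, hn⟩ := Filter.eventually_atTop.1 f.eventually_isCompl_ker_pow_range_pow
  have hc := hn (n + 1) (Nat.le_succ n)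
  set g := f ^ (n + 1) with hg
  have hgf : g = x ∘ₗ (y ∘ₗ f ^ n) := by
    rw [hg, pow_succ']
    rfl
  have hW {w : M} (hw : w ∈ LinearMap.range g) (h0 : g w = 0) : w = 0 := by
    have : w ∈ LinearMap.ker g ⊓ LinearMap.range g := ⟨h0, hw⟩
    rwa [hc.disjoint.eq_bot] at this
  let s : Z →ₗ[R] LinearMap.range g := g.rangeRestrict ∘ₗ x
  let i : LinearMap.range g →ₗ[R] Z := (y ∘ₗ f ^ n) ∘ₗ (LinearMap.range g).subtype
  have hsi (w : LinearMap.range g) : ((s ∘ₗ i) w : M) = g (g w) :=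
    LinearMap.congr_fun (congrArg (fun e => g ∘ₗ e) hgf.symm) (w : M)
  have hinj : Function.Injective (s ∘ₗ i) := by
    refine (injective_iff_map_eq_zero _).2 fun w hw => Subtype.ext ?_
    have h1 := hsi w
    rw [hw] at h1
    exact hW w.2 (hW ⟨_, rfl⟩ h1.symm)
  have hbij := IsArtinian.bijective_of_injective_endomorphism _ hinj
  let θ := LinearEquiv.ofBijective _ hbij
  have : Module.Projective R (LinearMap.range g) :=
    Module.Projective.of_split i (θ.symm.toLinearMap ∘ₗ s) (by
      ext w
      exact congrArg Subtype.val (θ.symm_apply_apply w))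
  exact ⟨n + 1, LinearMap.range_eq_bot.1 (hM _ _ hc.symm this)⟩

end Projectivity

/-! ### Projective bimodules as modules over the enveloping algebra. -/

section Enveloping

attribute [local instance] TensorProduct.Algebra.module

variable {k A B C : Type u} [Field k] [Ring A] [Algebra k A] [Ring B] [Algebra k B]
  [Ring C] [Algebra k C]
  {X Y : Type u} [AddCommGroup X] [Module k X] [Module A X] [Module Bᵐᵒᵖ X]
  [IsScalarTower k A X] [IsScalarTower k Bᵐᵒᵖ X] [SMulCommClass A Bᵐᵒᵖ X]
  [AddCommGroup Y] [Module k Y] [Module A Y] [Module Bᵐᵒᵖ Y]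
  [IsScalarTower k A Y] [IsScalarTower k Bᵐᵒᵖ Y] [SMulCommClass A Bᵐᵒᵖ Y]

theorem enveloping_isScalarTower : IsScalarTower k (A ⊗[k] Bᵐᵒᵖ) X where
  smul_assoc c e x :=
    congrArg (fun f : X →ₗ[k] X => f x)
      ((TensorProduct.Algebra.moduleAux (R := k) (A := A) (B := Bᵐᵒᵖ) (M := X)).map_smul c e)

theorem enveloping_zero_smul (x : X) : (0 : A ⊗[k] Bᵐᵒᵖ) • x = 0 :=
  zero_smul (A ⊗[k] Bᵐᵒᵖ) x

theorem enveloping_finite [FiniteDimensional k X] : Module.Finite (A ⊗[k] Bᵐᵒᵖ) X :=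
  have : IsScalarTower k (A ⊗[k] Bᵐᵒᵖ) X := enveloping_isScalarTower
  Module.Finite.of_restrictScalars_finite k _ X

variable (k) in
/-- A homomorphism of bimodules as a homomorphism of modules over the enveloping algebra. -/
def LinearMap.toEnveloping (f : X →ₗ[A] Y)
    (hf : ∀ (b : B) x, f (op b • x) = op b • f x) : X →ₗ[A ⊗[k] Bᵐᵒᵖ] Y where
  toFun := f
  map_add' := map_add f
  map_smul' e x := by
    induction e using TensorProduct.induction_on with
    | zero => rw [map_zero, enveloping_zero_smul, enveloping_zero_smul, map_zero]
    | tmul a b =>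
      obtain ⟨b, rfl⟩ := op_surjective b
      simp only [RingHom.id_apply, TensorProduct.Algebra.smul_def, map_smul, hf]
    | add e e' h h' => simp only [add_smul, map_add, RingHom.id_apply] at h h' ⊢; rw [h, h']

/-- Tensor products of left projective bimodules with projective bimodules are projective. -/
theorem IsProjectiveBimodule.balTensor [FiniteDimensional k X] [Module.Projective A X]
    [FiniteDimensional k A] {Q : Type u} [AddCommGroup Q] [Module k Q] [Module B Q] [Module Cᵐᵒᵖ Q]
    [IsScalarTower k B Q] [IsScalarTower k Cᵐᵒᵖ Q] [SMulCommClass B Cᵐᵒᵖ Q] [FiniteDimensional k Q]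
    (hQ : IsProjectiveBimodule k B C Q) : IsProjectiveBimodule k A C (BalTensor B X Q) := by
  change Module.Projective (A ⊗[k] Cᵐᵒᵖ) (BalTensor B X Q)
  replace hQ : Module.Projective (B ⊗[k] Cᵐᵒᵖ) Q := hQ
  have : Module.Finite (B ⊗[k] Cᵐᵒᵖ) Q := enveloping_finite
  have : Module.Finite A X := Module.Finite.of_restrictScalars_finite k A X
  obtain ⟨n, γ, x, hx⟩ := Module.Projective.exists_dualBasis A X
  obtain ⟨l, δ, q, hq⟩ := Module.Projective.exists_dualBasis (B ⊗[k] Cᵐᵒᵖ) Q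
  have : SMulCommClass Bᵐᵒᵖ A X := SMulCommClass.symm A Bᵐᵒᵖ X
  -- `T g m` sends `b ⊗ c` to `g (m b) ⊗ c`
  let r (g : X →ₗ[A] A) (m : X) : B →ₗ[k] A :=
    { toFun := fun b => g (op b • m)
      map_add' := fun b b' => by rw [MulOpposite.op_add, add_smul, map_add]
      map_smul' := fun c b => by
        rw [op_smul, smul_assoc, RingHom.id_apply, ← algebraMap_smul A c (op b • m), map_smul,
          algebraMap_smul] }
  let T (g : X →ₗ[A] A) (m : X) : B ⊗[k] Cᵐᵒᵖ →ₗ[k] A ⊗[k] Cᵐᵒᵖ := (r g m).rTensor Cᵐᵒᵖ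
  have hT (g m b) (c : Cᵐᵒᵖ) : T g m (b ⊗ₜ c) = g (op b • m) ⊗ₜ c := rfl
  have hT_add (g m m' e) : T g (m + m') e = T g m e + T g m' e := by
    induction e using TensorProduct.induction_on with
    | zero => simp
    | tmul b c => simp only [hT, smul_add, map_add, TensorProduct.add_tmul]
    | add e e' h h' => simp only [map_add, h, h']; abel
  have hT_bal (g m) (b : B) (e) : T g (op b • m) e = T g m ((b ⊗ₜ 1) * e) := by
    induction e using TensorProduct.induction_on with
    | zero => simp
    | tmul b' c =>
      rw [Algebra.TensorProduct.tmul_mul_tmul, hT, hT, op_mul, mul_smul, one_mul]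
    | add e e' h h' => simp only [map_add, mul_add, h, h']
  have hT_smul (g m) (a : A) (e) : T g (a • m) e = (a ⊗ₜ 1) * T g m e := by
    induction e using TensorProduct.induction_on with
    | zero => simp
    | tmul b c =>
      rw [hT, hT, Algebra.TensorProduct.tmul_mul_tmul, one_mul, ← smul_eq_mul, ← map_smul,
        smul_comm]
    | add e e' h h' => simp only [map_add, mul_add, h, h']
  have hT_op (g m) (c : Cᵐᵒᵖ) (e) : T g m ((1 ⊗ₜ c) * e) = (1 ⊗ₜ c) * T g m e := by
    induction e using TensorProduct.induction_on with
    | zero => simp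
    | tmul b c' =>
      rw [Algebra.TensorProduct.tmul_mul_tmul, hT, hT, Algebra.TensorProduct.tmul_mul_tmul, one_mul,
        one_mul]
    | add e e' h h' => simp only [map_add, mul_add, h, h']
  have hδ_l (d : Q →ₗ[B ⊗[k] Cᵐᵒᵖ] B ⊗[k] Cᵐᵒᵖ) (b : B) (z : Q) :
      d (b • z) = (b ⊗ₜ 1) * d z := by
    rw [← smul_eq_mul, ← map_smul, TensorProduct.Algebra.smul_def, one_smul]
  have hδ_r (d : Q →ₗ[B ⊗[k] Cᵐᵒᵖ] B ⊗[k] Cᵐᵒᵖ) (c : Cᵐᵒᵖ) (z : Q) :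
      d (c • z) = (1 ⊗ₜ c) * d z := by
    rw [← smul_eq_mul, ← map_smul, TensorProduct.Algebra.smul_def, one_smul]
  -- The dual basis of `X ⊗ Q` consists of the tensors `x i ⊗ q j`. Its coordinate forms first apply
  -- the coordinate `d` of `Q` and then feed the resulting `B`-component into the coordinate `g` of
  -- `X`.
  let c₀ (g : X →ₗ[A] A) (d : Q →ₗ[B ⊗[k] Cᵐᵒᵖ] B ⊗[k] Cᵐᵒᵖ) :
      BalTensor B X Q →+ A ⊗[k] Cᵐᵒᵖ := BalTensor.lift B
    (AddMonoidHom.mk' (fun m => AddMonoidHom.mk' (fun z => T g m (d z))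
      fun z z' => by rw [map_add, map_add]) fun m m' => by ext z; exact hT_add g m m' _)
    (fun m b z => by
      simp only [AddMonoidHom.mk'_apply]
      rw [hδ_l, hT_bal])
  have hc₀ (g d m z) : c₀ g d (BalTensor.tmul B m z) = T g m (d z) := rfl
  have hc_l (g d) (a : A) (w) : c₀ g d (a • w) = (a ⊗ₜ 1) * c₀ g d w := by
    induction w using BalTensor.induction_on with
    | h0 => simp
    | ht m z => rw [BalTensor.smul_left_tmul, hc₀, hc₀, hT_smul]
    | ha w w' h h' => rw [smul_add, map_add, map_add, mul_add, h, h']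
  have hc_r (g d) (c : Cᵐᵒᵖ) (w) : c₀ g d (c • w) = (1 ⊗ₜ c) * c₀ g d w := by
    induction w using BalTensor.induction_on with
    | h0 => simp
    | ht m z =>
      obtain ⟨c, rfl⟩ := op_surjective c
      rw [BalTensor.smul_right_tmul, hc₀, hc₀, hδ_r, hT_op]
    | ha w w' h h' => rw [smul_add, map_add, map_add, mul_add, h, h']
  let c (p : Fin n × Fin l) : BalTensor B X Q →ₗ[A ⊗[k] Cᵐᵒᵖ] A ⊗[k] Cᵐᵒᵖ :=
    { toFun := c₀ (γ p.1) (δ p.2)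
      map_add' := map_add _
      map_smul' := fun e w => by
        induction e using TensorProduct.induction_on with
        | zero =>
          rw [map_zero, enveloping_zero_smul, map_zero]
          exact (zero_mul _).symm
        | tmul a c =>
          rw [TensorProduct.Algebra.smul_def, hc_l, hc_r, ← mul_assoc,
            Algebra.TensorProduct.tmul_mul_tmul, mul_one, one_mul]
          rfl
        | add e e' h h' => rw [add_smul, map_add, h, h', ← add_smul, map_add] }
  refine Module.Projective.of_dualBasis c (fun p => BalTensor.tmul B (x p.1) (q p.2)) fun w => ?_
  have key (m : X) (z : Q) (e : B ⊗[k] Cᵐᵒᵖ) :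
      ∑ i, T (γ i) m e • BalTensor.tmul B (x i) z = BalTensor.tmul B m (e • z) := by
    induction e using TensorProduct.induction_on with
    | zero =>
      rw [enveloping_zero_smul, BalTensor.tmul_zero]
      exact Finset.sum_eq_zero fun i _ => by rw [map_zero, enveloping_zero_smul]
    | tmul b c =>
      obtain ⟨c, rfl⟩ := op_surjective c
      simp only [hT, TensorProduct.Algebra.smul_def, BalTensor.smul_right_tmul,
        BalTensor.smul_left_tmul]
      rw [← BalTensor.sum_tmul, hx, BalTensor.smul_tmul]
    | add e e' h h' =>
      simp only [map_add, add_smul, Finset.sum_add_distrib, BalTensor.tmul_add, h, h']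
  induction w using BalTensor.induction_on with
  | h0 => exact Finset.sum_eq_zero fun i _ => by rw [map_zero, enveloping_zero_smul]
  | ht m z =>
    rw [Fintype.sum_prod_type, Finset.sum_comm]
    conv_rhs => rw [← hq z, BalTensor.tmul_sum]
    exact Finset.sum_congr rfl fun j _ => key m (q j) (δ j z)
  | ha w w' h h' =>
    simp only [map_add, add_smul, Finset.sum_add_distrib, h, h']

/-- If `P` is a projective bimodule, then `P ⊗_B Z` is projective for all modules `Z`. -/
theorem IsProjectiveBimodule.projective_balTensor [FiniteDimensional k X]
    (hX : IsProjectiveBimodule k A B X) (Z : Type u) [AddCommGroup Z] [Module B Z] :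
    Module.Projective A (BalTensor B X Z) := by
  have : SMulCommClass Bᵐᵒᵖ A X := SMulCommClass.symm A Bᵐᵒᵖ X
  let : Module k Z := Module.compHom Z (algebraMap k B)
  have : IsScalarTower k B Z := ⟨fun c b z => by rw [Algebra.smul_def, mul_smul]; rfl⟩
  replace hX : Module.Projective (A ⊗[k] Bᵐᵒᵖ) X := hX
  have : Module.Finite (A ⊗[k] Bᵐᵒᵖ) X := enveloping_finite
  obtain ⟨l, δ, p, hp⟩ := Module.Projective.exists_dualBasis (A ⊗[k] Bᵐᵒᵖ) X
  have hδ_l (d : X →ₗ[A ⊗[k] Bᵐᵒᵖ] A ⊗[k] Bᵐᵒᵖ) (a : A) (x : X) :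
      d (a • x) = (a ⊗ₜ 1) * d x := by
    rw [← smul_eq_mul, ← map_smul, TensorProduct.Algebra.smul_def, one_smul]
  have hδ_r (d : X →ₗ[A ⊗[k] Bᵐᵒᵖ] A ⊗[k] Bᵐᵒᵖ) (b : Bᵐᵒᵖ) (x : X) :
      d (b • x) = (1 ⊗ₜ b) * d x := by
    rw [← smul_eq_mul, ← map_smul, TensorProduct.Algebra.smul_def, one_smul]
  let r (z : Z) : Bᵐᵒᵖ →ₗ[k] Z :=
    { toFun := fun b => unop b • z
      map_add' := fun b b' => by rw [MulOpposite.unop_add, add_smul]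
      map_smul' := fun c b => by rw [unop_smul, smul_assoc, RingHom.id_apply] }
  -- This models the isomorphism `(A ⊗ Bᵐᵒᵖ) ⊗_B Z ≅ A ⊗ Z`, whose right side is projective over `A`
  -- because `k` is a field. A dual basis of `X` then exhibits `X ⊗_B Z` as a retract of finitely
  -- many copies.
  let T (z : Z) : A ⊗[k] Bᵐᵒᵖ →ₗ[k] A ⊗[k] Z := (r z).lTensor A
  have hT (z a) (b : Bᵐᵒᵖ) : T z (a ⊗ₜ b) = a ⊗ₜ (unop b • z) := rfl
  have hT_add (z z' e) : T (z + z') e = T z e + T z' e := by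
    induction e using TensorProduct.induction_on with
    | zero => simp
    | tmul a b => simp only [hT, smul_add, TensorProduct.tmul_add]
    | add e e' h h' => simp only [map_add, h, h']; abel
  have hT_bal (z) (b : B) (e) : T z ((1 ⊗ₜ op b) * e) = T (b • z) e := by
    induction e using TensorProduct.induction_on with
    | zero => simp
    | tmul a b' =>
      rw [Algebra.TensorProduct.tmul_mul_tmul, hT, hT, unop_mul, unop_op, mul_smul, one_mul]
    | add e e' h h' => simp only [map_add, mul_add, h, h']
  have hT_smul (z) (a : A) (e) : T z ((a ⊗ₜ 1) * e) = a • T z e := by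
    induction e using TensorProduct.induction_on with
    | zero => simp
    | tmul a' b' =>
      rw [Algebra.TensorProduct.tmul_mul_tmul, hT, hT, one_mul, TensorProduct.smul_tmul',
        smul_eq_mul]
    | add e e' h h' => simp only [map_add, mul_add, h, h', smul_add]
  let c (d : X →ₗ[A ⊗[k] Bᵐᵒᵖ] A ⊗[k] Bᵐᵒᵖ) : BalTensor B X Z →ₗ[A] A ⊗[k] Z :=
    BalTensor.liftLinear B X Z
      (AddMonoidHom.mk' (fun x => AddMonoidHom.mk' (fun z => T z (d x))
        fun z z' => hT_add z z' _) fun x x' => by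
          ext z; simp only [AddMonoidHom.mk'_apply, map_add, AddMonoidHom.add_apply])
      (fun x b z => by simp only [AddMonoidHom.mk'_apply, hδ_r, hT_bal])
      (fun a x z => by simp only [AddMonoidHom.mk'_apply, hδ_l, hT_smul])
  have hc (d x z) : c d (BalTensor.tmul B x z) = T z (d x) := rfl
  let t (x : X) : Z →ₗ[k] BalTensor B X Z :=
    { toFun := fun z => BalTensor.tmul B x z
      map_add' := BalTensor.tmul_add B x
      map_smul' := fun c z => (BalTensor.smul_left_tmul' B c x z).symm }
  let s (x : X) : A ⊗[k] Z →ₗ[A] BalTensor B X Z :=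
    TensorProduct.AlgebraTensorModule.lift (LinearMap.toSpanSingleton A _ (t x))
  have hs (x a z) : s x (a ⊗ₜ z) = BalTensor.tmul B (a • x) z := rfl
  have key (x : X) (z : Z) (e : A ⊗[k] Bᵐᵒᵖ) : s x (T z e) = BalTensor.tmul B (e • x) z := by
    induction e using TensorProduct.induction_on with
    | zero => rw [enveloping_zero_smul, BalTensor.zero_tmul, map_zero, map_zero]
    | tmul a b =>
      obtain ⟨b, rfl⟩ := op_surjective b
      rw [hT, hs, TensorProduct.Algebra.smul_def, unop_op, ← BalTensor.smul_tmul, smul_comm]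
    | add e e' h h' => simp only [map_add, add_smul, BalTensor.add_tmul, h, h']
  refine Module.Projective.of_split (M := Fin l → A ⊗[k] Z) (LinearMap.pi fun j => c (δ j))
    (∑ j, s (p j) ∘ₗ LinearMap.proj j) (BalTensor.linearMap_ext fun x z => ?_)
  simp only [LinearMap.comp_apply, LinearMap.sum_apply, LinearMap.proj_apply, LinearMap.pi_apply,
    hc, key]
  rw [← BalTensor.sum_tmul, hp, LinearMap.id_apply]

end Enveloping

/-! ### The triangle composites and their nilpotent error. -/

section Triangle

namespace BalTensor

/-- The canonical isomorphism `X ⊗_B B ≅ X`. -/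
def rid (A B X : Type u) [Ring A] [Ring B] [AddCommGroup X] [Module A X] [Module Bᵐᵒᵖ X]
    [SMulCommClass A Bᵐᵒᵖ X] : BalTensor B X B ≃ₗ[A] X :=
  LinearEquiv.ofLinearMap
    (liftLinear B X B (AddMonoidHom.mk' (fun x => AddMonoidHom.mk' (fun b => op b • x)
        fun b b' => by rw [MulOpposite.op_add, add_smul]) fun x y => by ext b; simp [smul_add])
      (fun x b b' => by simp [mul_smul])
      (fun a b x => by simp [smul_comm]))
    { toFun := fun x => tmul B x (1 : B)
      map_add' := fun x y => add_tmul B x y 1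
      map_smul' := fun a x => (smul_left_tmul B a x 1).symm }
    (by ext x; simp)
    (linearMap_ext fun x b => by
      change tmul B (op b • x) 1 = tmul B x b
      rw [smul_tmul, smul_eq_mul, mul_one])

variable {A B X : Type u} [Ring A] [Ring B] [AddCommGroup X] [Module A X] [Module Bᵐᵒᵖ X]
  [SMulCommClass A Bᵐᵒᵖ X]

theorem rid_tmul (x : X) (b : B) : rid A B X (tmul B x b) = op b • x := rfl

theorem rid_op_smul (b : B) (z : BalTensor B X B) : rid A B X (op b • z) = op b • rid A B X z := by
  induction z using induction_on with
  | h0 => simp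
  | ht x b' => rw [smul_right_tmul, rid_tmul, rid_tmul, op_smul_eq_mul, op_mul, mul_smul]
  | ha z w hz hw => simp only [smul_add, map_add, hz, hw]

theorem rid_symm_op_smul (b : B) (x : X) :
    (rid A B X).symm (op b • x) = op b • (rid A B X).symm x := by
  apply (rid A B X).injective
  rw [rid_op_smul, LinearEquiv.apply_symm_apply, LinearEquiv.apply_symm_apply]

end BalTensor

section

attribute [local instance] TensorProduct.Algebra.module

variable {k A B : Type u} [Field k] [Ring A] [Algebra k A] [Ring B] [Algebra k B]
  {M : Type u} [AddCommGroup M] [Module k M] [Module A M] [Module Bᵐᵒᵖ M]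
  [IsScalarTower k A M] [IsScalarTower k Bᵐᵒᵖ M] [SMulCommClass A Bᵐᵒᵖ M]
  {Z : Type u} [AddCommGroup Z] [Module k Z] [Module A Z] [Module Bᵐᵒᵖ Z]
  [IsScalarTower k A Z] [IsScalarTower k Bᵐᵒᵖ Z] [SMulCommClass A Bᵐᵒᵖ Z]

/-- Fitting's lemma over the enveloping algebra, where finite dimension supplies both chain
conditions; only the one-sided linear structure is kept in the conclusion. -/
theorem BimoduleHasNoProjectiveSummand.isNilpotent [FiniteDimensional k M]
    (hM : BimoduleHasNoProjectiveSummand k A B M) (hZ : IsProjectiveBimodule k A B Z)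
    (y : M →ₗ[A] Z) (hy : ∀ (b : B) m, y (op b • m) = op b • y m)
    (x : Z →ₗ[A] M) (hx : ∀ (b : B) z, x (op b • z) = op b • x z) :
    IsNilpotent (x ∘ₗ y : Module.End A M) := by
  have : IsScalarTower k (A ⊗[k] Bᵐᵒᵖ) M := enveloping_isScalarTower
  have : IsNoetherian (A ⊗[k] Bᵐᵒᵖ) M := isNoetherian_of_tower k inferInstance
  have : IsArtinian (A ⊗[k] Bᵐᵒᵖ) M := isArtinian_of_tower k inferInstance
  have : Module.Projective (A ⊗[k] Bᵐᵒᵖ) Z := hZ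
  obtain ⟨n, hn⟩ := HasNoProjectiveSummand.isNilpotent (R := A ⊗[k] Bᵐᵒᵖ) hM
    (y.toEnveloping k hy) (x.toEnveloping k hx)
  refine ⟨n, LinearMap.ext fun m => ?_⟩
  have h1 := LinearMap.congr_fun hn m
  rw [Module.End.pow_apply] at h1 ⊢
  exact h1

variable {A B M N P Q : Type u} [Ring A] [Algebra k A] [Ring B] [Algebra k B]
  [AddCommGroup M] [Module k M] [Module A M] [Module Bᵐᵒᵖ M]
  [IsScalarTower k A M] [IsScalarTower k Bᵐᵒᵖ M] [SMulCommClass A Bᵐᵒᵖ M]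
  [AddCommGroup N] [Module k N] [Module B N] [Module Aᵐᵒᵖ N]
  [IsScalarTower k B N] [IsScalarTower k Aᵐᵒᵖ N] [SMulCommClass B Aᵐᵒᵖ N]
  [AddCommGroup P] [Module k P] [Module A P] [Module Aᵐᵒᵖ P]
  [IsScalarTower k A P] [IsScalarTower k Aᵐᵒᵖ P] [SMulCommClass A Aᵐᵒᵖ P]
  [AddCommGroup Q] [Module k Q] [Module B Q] [Module Bᵐᵒᵖ Q]
  [IsScalarTower k B Q] [IsScalarTower k Bᵐᵒᵖ Q] [SMulCommClass B Bᵐᵒᵖ Q]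

namespace BalTensor

/-- The composite `M ⊗ Y → M ⊗ N ⊗ M ⊗ Y → M ⊗ Y` of the inclusion for `N ⊗ M ≅ B ⊕ Q` with the
projection for `M ⊗ N ≅ A ⊕ P`. -/
def triangle (eP : BimoduleIso A A (BalTensor B M N) (A × P))
    (eQ : BimoduleIso B B (BalTensor A N M) (B × Q)) (Y : Type u) [AddCommGroup Y] [Module B Y] :
    BalTensor B M Y →ₗ[A] BalTensor B M Y :=
  proj _ eP ∘ₗ lTensor B M A (incl Y eQ)

/-- The composite `M ⊗ Y → M ⊗ N ⊗ M ⊗ Y → M ⊗ Y` of the inclusion for `M ⊗ N ≅ A ⊕ P` with the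
projection for `N ⊗ M ≅ B ⊕ Q`. -/
def triangle' (eP : BimoduleIso A A (BalTensor B M N) (A × P))
    (eQ : BimoduleIso B B (BalTensor A N M) (B × Q)) (Y : Type u) [AddCommGroup Y] [Module B Y] :
    BalTensor B M Y →ₗ[A] BalTensor B M Y :=
  lTensor B M A (proj Y eQ) ∘ₗ incl _ eP

variable (eP : BimoduleIso A A (BalTensor B M N) (A × P))
    (eQ : BimoduleIso B B (BalTensor A N M) (B × Q))

theorem triangle_naturality {Y Y' : Type u} [AddCommGroup Y] [Module B Y] [AddCommGroup Y']
    [Module B Y'] (f : Y →ₗ[B] Y') (z : BalTensor B M Y) :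
    triangle eP eQ Y' (lTensor B M A f z) = lTensor B M A f (triangle eP eQ Y z) := by
  simp only [triangle, LinearMap.comp_apply]
  rw [← proj_naturality, ← lTensor_comp_apply, ← lTensor_comp_apply]
  exact congrArg (fun φ => proj _ eP (lTensor B M A φ z))
    (LinearMap.ext (incl_naturality eQ f))

theorem triangle'_naturality {Y Y' : Type u} [AddCommGroup Y] [Module B Y] [AddCommGroup Y']
    [Module B Y'] (f : Y →ₗ[B] Y') (z : BalTensor B M Y) :
    triangle' eP eQ Y' (lTensor B M A f z) = lTensor B M A f (triangle' eP eQ Y z) := by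
  simp only [triangle', LinearMap.comp_apply]
  rw [incl_naturality, ← lTensor_comp_apply, ← lTensor_comp_apply]
  exact congrArg (fun φ => lTensor B M A φ _) (LinearMap.ext (proj_naturality eQ f))

/-- The decomposition of the identity of `N ⊗ M ⊗ Y` along `Y` and `Q ⊗ Y` is inserted between the
inclusion and the projection for `eP`, which compose to the identity. The second summand is the
error term, and it passes through `M ⊗ Q ⊗ Y`. -/
theorem triangle_triangle' {Y : Type u} [AddCommGroup Y] [Module B Y] (z : BalTensor B M Y) :
    triangle eP eQ Y (triangle' eP eQ Y z) + proj _ eP (lTensor B M A (incl' Y eQ)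
      (lTensor B M A (proj' Y eQ) (incl _ eP z))) = z := by
  simp only [triangle, triangle', LinearMap.comp_apply]
  rw [← map_add, ← lTensor_comp_apply, ← lTensor_comp_apply, ← LinearMap.add_apply, ← lTensor_add]
  have : incl Y eQ ∘ₗ proj Y eQ + incl' Y eQ ∘ₗ proj' Y eQ = LinearMap.id := by
    ext z
    exact incl_proj_add eQ z
  rw [this, lTensor_id_apply, proj_incl]

/-- An element of `M ⊗ Y` comes from `M ⊗ B` along a sum of maps `B → Y`. -/
theorem surjective_of_naturality {Y : Type u} [AddCommGroup Y] [Module B Y]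
    (t : ∀ (Y : Type u) [AddCommGroup Y] [Module B Y], BalTensor B M Y →ₗ[A] BalTensor B M Y)
    (ht : ∀ (f : B →ₗ[B] Y) z, t Y (lTensor B M A f z) = lTensor B M A f (t B z))
    (hB : Function.Surjective (t B)) : Function.Surjective (t Y) := by
  intro z
  induction z using induction_on with
  | h0 => exact ⟨0, map_zero _⟩
  | ht m y =>
    obtain ⟨w, hw⟩ := hB (tmul B m 1)
    refine ⟨lTensor B M A (LinearMap.toSpanSingleton B Y y) w, ?_⟩
    rw [ht, hw, lTensor_tmul, LinearMap.toSpanSingleton_apply, one_smul]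
  | ha z w hz hw =>
    obtain ⟨z, rfl⟩ := hz
    obtain ⟨w, rfl⟩ := hw
    exact ⟨z + w, map_add _ _ _⟩

-- On `M ⊗ B ≅ M` the error is an endomorphism of bimodules: it commutes with the right action of
-- `B` by naturality with respect to right multiplications. It factors through `M ⊗ (Q ⊗ B)`, a
-- projective bimodule, while `M` has no projective summand.
variable (k) in
theorem isNilpotent_error [FiniteDimensional k A] [FiniteDimensional k M] [FiniteDimensional k Q]
    (hM : BimoduleHasNoProjectiveSummand k A B M) [Module.Projective A M]
    (hQ : IsProjectiveBimodule k B B Q) :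
    IsNilpotent ((proj (BalTensor B M B) eP ∘ₗ lTensor B M A (incl' B eQ)) ∘ₗ
      (lTensor B M A (proj' B eQ) ∘ₗ incl _ eP) : Module.End A (BalTensor B M B)) := by
  set x := proj (BalTensor B M B) eP ∘ₗ lTensor B M A (incl' B eQ) with hx
  set y := lTensor B M A (proj' B eQ) ∘ₗ incl (BalTensor B M B) eP with hy
  -- right multiplications
  let ρ (b : B) : B →ₗ[B] B := LinearMap.toSpanSingleton B B b
  have hρ {R W : Type u} [Ring R] [AddCommGroup W] [Module R W] [Module Bᵐᵒᵖ W]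
      [SMulCommClass R Bᵐᵒᵖ W] (b : B) (z : BalTensor B W B) :
      op b • z = lTensor B W R (ρ b) z := by
    induction z using induction_on with
    | h0 => simp
    | ht m b' => rfl
    | ha z w hz hw => rw [smul_add, map_add, hz, hw]
  have hρ' (b : B) (z : BalTensor B M (BalTensor B Q B)) :
      op b • z = lTensor B M A (lTensor B Q B (ρ b)) z := by
    induction z using induction_on with
    | h0 => simp
    | ht m q => rw [smul_right_tmul, lTensor_tmul, hρ (R := B)]
    | ha z w hz hw => rw [smul_add, map_add, hz, hw]
  have hyb (b : B) (z) : y (op b • z) = op b • y z := by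
    rw [hρ (R := A), hρ', hy, LinearMap.comp_apply, LinearMap.comp_apply, incl_naturality,
      ← lTensor_comp_apply, ← lTensor_comp_apply]
    exact congrArg (fun φ => lTensor B M A φ _) (LinearMap.ext (proj'_naturality eQ (ρ b)))
  have hxb (b : B) (z) : x (op b • z) = op b • x z := by
    rw [hρ (R := A), hρ', hx, LinearMap.comp_apply, LinearMap.comp_apply, ← proj_naturality,
      ← lTensor_comp_apply, ← lTensor_comp_apply]
    exact congrArg (fun φ => proj _ eP (lTensor B M A φ z))
      (LinearMap.ext (incl'_naturality eQ (ρ b)))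
  have hQB : IsProjectiveBimodule k B B (BalTensor B Q B) := by
    have : Module.Projective (B ⊗[k] Bᵐᵒᵖ) Q := hQ
    refine Module.Projective.of_split ((rid B B Q).toLinearMap.toEnveloping k rid_op_smul)
      ((rid B B Q).symm.toLinearMap.toEnveloping k rid_symm_op_smul) ?_
    ext z
    exact (rid B B Q).symm_apply_apply z
  have : FiniteDimensional k (BalTensor B Q B) := finiteDimensional B
  have hZ : IsProjectiveBimodule k A B (BalTensor B M (BalTensor B Q B)) :=
    IsProjectiveBimodule.balTensor hQB
  obtain ⟨n, hn⟩ := hM.isNilpotent hZ (y ∘ₗ (rid A B M).symm.toLinearMap)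
    (fun b m => by
      simp only [LinearMap.comp_apply, LinearEquiv.coe_coe, rid_symm_op_smul, hyb])
    ((rid A B M).toLinearMap ∘ₗ x)
    (fun b m => by simp only [LinearMap.comp_apply, LinearEquiv.coe_coe, rid_op_smul, hxb])
  have : (rid A B M).conjRingEquiv (x ∘ₗ y : Module.End A (BalTensor B M B)) =
      (((rid A B M).toLinearMap ∘ₗ x) ∘ₗ (y ∘ₗ (rid A B M).symm.toLinearMap) :
        Module.End A M) := rfl
  refine ⟨n, (rid A B M).conjRingEquiv.injective ?_⟩
  rw [map_pow, this, hn, map_zero]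

end BalTensor

end

end Triangle

/-! ### Two observations on simple modules. -/

section SimpleModules

/-- A nonzero finitely generated module has a maximal submodule. Vanishing of `P ⊗ X` is tested
below on maps to simple modules, to which the adjunction applies. -/
theorem subsingleton_of_forall_simple_quotient {R X : Type u} [Ring R] [AddCommGroup X] [Module R X]
    [Module.Finite R X] (h : ∀ (S : Type u) [AddCommGroup S] [Module R S], IsSimpleModule R S →
      ∀ r : X →ₗ[R] S, r = 0) : Subsingleton X := by
  by_contra hX
  have : Nontrivial X := not_subsingleton_iff_nontrivial.1 hX
  obtain ⟨W, hW, -⟩ := (eq_top_or_exists_le_coatom (⊥ : Submodule R X)).resolve_left bot_ne_top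
  have h0 := h (X ⧸ W) (isSimpleModule_iff_isCoatom.2 hW) W.mkQ
  exact hW.1 (by rw [← W.ker_mkQ, h0, LinearMap.ker_zero])

/-- By Schur's lemma the composite is an isomorphism, which makes `S` a retract of `Z`. -/
theorem Module.Projective.of_simple_retract {R S Z : Type*} [Ring R] [AddCommGroup S] [Module R S]
    [AddCommGroup Z] [Module R Z] [IsSimpleModule R S] [Module.Projective R Z]
    {S' : Type*} [AddCommGroup S'] [Module R S'] [IsSimpleModule R S']
    (y : S →ₗ[R] Z) (x : Z →ₗ[R] S') (h : x ∘ₗ y ≠ 0) : Module.Projective R S := by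
  let e := LinearEquiv.ofBijective _ (LinearMap.bijective_of_ne_zero h)
  refine Module.Projective.of_split y (e.symm.toLinearMap ∘ₗ x) ?_
  ext s
  exact e.symm_apply_apply s

end SimpleModules

/-! ### Adjuncts, and properties reflected by `N ⊗ -`. -/

namespace BalTensor

variable {A B M N P Q : Type u} [Ring A] [Ring B]
  [AddCommGroup M] [Module A M] [Module Bᵐᵒᵖ M] [SMulCommClass A Bᵐᵒᵖ M]
  [AddCommGroup N] [Module B N] [Module Aᵐᵒᵖ N] [SMulCommClass B Aᵐᵒᵖ N]
  [AddCommGroup P] [Module A P] [Module Aᵐᵒᵖ P] [SMulCommClass A Aᵐᵒᵖ P]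
  [AddCommGroup Q] [Module B Q] [Module Bᵐᵒᵖ Q] [SMulCommClass B Bᵐᵒᵖ Q]
  {X Y : Type u} [AddCommGroup X] [Module A X] [AddCommGroup Y] [Module B Y]
  (eP : BimoduleIso A A (BalTensor B M N) (A × P))
  (eQ : BimoduleIso B B (BalTensor A N M) (B × Q))

/-- The adjunct `Y → N ⊗ X` of a map `M ⊗ Y → X`. -/
def adj (r : BalTensor B M Y →ₗ[A] X) : Y →ₗ[B] BalTensor A N X :=
  lTensor A N B r ∘ₗ incl Y eQ

/-- The adjunct `M ⊗ Y → X` of a map `Y → N ⊗ X`. -/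
def adj' (f : Y →ₗ[B] BalTensor A N X) : BalTensor B M Y →ₗ[A] X :=
  proj X eP ∘ₗ lTensor B M A f

/-- The triangle map measures the failure of the two adjuncts to be inverse to each other, so its
surjectivity suffices for the injectivity of `adj`. -/
theorem adj'_adj (r : BalTensor B M Y →ₗ[A] X) : adj' eP (adj eQ r) = r ∘ₗ triangle eP eQ Y := by
  ext z
  simp only [adj, adj', triangle, LinearMap.comp_apply]
  rw [lTensor_comp_apply, proj_naturality]

theorem adj_adj' (f : Y →ₗ[B] BalTensor A N X) : adj eQ (adj' eP f) = triangle' eQ eP X ∘ₗ f := by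
  ext z
  simp only [adj, adj', triangle', LinearMap.comp_apply]
  rw [lTensor_comp_apply, ← incl_naturality]

/-- `P ⊗ -` is a natural direct summand of `M ⊗ N ⊗ -`, which preserves injections because `M` and
`N` are flat on the right. -/
theorem lTensor_injective_of_split [Module.Projective Bᵐᵒᵖ M] [Module.Projective Aᵐᵒᵖ N]
    {X' : Type u} [AddCommGroup X'] [Module A X'] {f : X →ₗ[A] X'} (hf : Function.Injective f)
    (eP : BimoduleIso A A (BalTensor B M N) (A × P)) :
    Function.Injective (lTensor A P A f) := by
  refine (injective_iff_map_eq_zero _).2 fun z hz => ?_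
  have h1 := incl'_naturality eP f z
  rw [hz, map_zero] at h1
  have h2 := (injective_iff_map_eq_zero _).1
    (lTensor_injective B (B := A) (N := M) (lTensor_injective A (B := B) (N := N) hf)) _ h1.symm
  rw [← proj'_incl' eP z, h2, map_zero]

/-- `X` is a retract of `M ⊗ N ⊗ X`, and `M ⊗ -` preserves projectives. -/
theorem projective_of_balTensor [Module.Projective A M] (hX : Module.Projective B (BalTensor A N X))
    (eP : BimoduleIso A A (BalTensor B M N) (A × P)) : Module.Projective A X := by
  have : Module.Projective A (BalTensor B M (BalTensor A N X)) := projective B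
  exact Module.Projective.of_split (incl X eP) (proj X eP) (LinearMap.ext (proj_incl eP))

/-- Applying `M ⊗ -` to `r` and passing to the natural summands `X'` and `X` turns it into a
retraction of `i`. -/
theorem exists_retraction_of_lTensor {X' : Type u} [AddCommGroup X'] [Module A X']
    {i : X →ₗ[A] X'} (eP : BimoduleIso A A (BalTensor B M N) (A × P))
    {r : BalTensor A N X' →ₗ[B] BalTensor A N X} (hr : r ∘ₗ lTensor A N B i = LinearMap.id) :
    ∃ s : X' →ₗ[A] X, s ∘ₗ i = LinearMap.id := by
  refine ⟨proj X eP ∘ₗ lTensor B M A r ∘ₗ incl X' eP, LinearMap.ext fun x => ?_⟩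
  simp only [LinearMap.comp_apply, LinearMap.id_apply]
  rw [incl_naturality, ← lTensor_comp_apply, hr, lTensor_id_apply, proj_incl]

end BalTensor

/-! ### Invertibility of the triangle maps and injectivity of the adjunct. -/

namespace IsStableEquivOfMoritaType

open BalTensor

variable {k A B M N P Q : Type u} [Field k] [Ring A] [Algebra k A] [Ring B] [Algebra k B]
  [AddCommGroup M] [Module k M] [Module A M] [Module Bᵐᵒᵖ M]
  [IsScalarTower k A M] [IsScalarTower k Bᵐᵒᵖ M] [SMulCommClass A Bᵐᵒᵖ M]
  [AddCommGroup N] [Module k N] [Module B N] [Module Aᵐᵒᵖ N]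
  [IsScalarTower k B N] [IsScalarTower k Aᵐᵒᵖ N] [SMulCommClass B Aᵐᵒᵖ N]
  [AddCommGroup P] [Module k P] [Module A P] [Module Aᵐᵒᵖ P]
  [IsScalarTower k A P] [IsScalarTower k Aᵐᵒᵖ P] [SMulCommClass A Aᵐᵒᵖ P]
  [AddCommGroup Q] [Module k Q] [Module B Q] [Module Bᵐᵒᵖ Q]
  [IsScalarTower k B Q] [IsScalarTower k Bᵐᵒᵖ Q] [SMulCommClass B Bᵐᵒᵖ Q]

theorem symm (h : IsStableEquivOfMoritaType k A B M N P Q) :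
    IsStableEquivOfMoritaType k B A N M Q P where
  projective_left_M := h.projective_left_N
  projective_right_M := h.projective_right_N
  projective_left_N := h.projective_left_M
  projective_right_N := h.projective_right_M
  projective_P := h.projective_Q
  projective_Q := h.projective_P
  iso_P := h.iso_Q
  iso_Q := h.iso_P

variable [FiniteDimensional k A] [FiniteDimensional k B] [FiniteDimensional k M]
  [FiniteDimensional k N]

theorem finiteDimensional_P (h : IsStableEquivOfMoritaType k A B M N P Q) :
    FiniteDimensional k P := by
  obtain ⟨e⟩ := h.iso_P
  have : Module.Finite B N := Module.Finite.of_restrictScalars_finite k B N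
  have : Module.Finite A M := Module.Finite.of_restrictScalars_finite k A M
  have : Module.Finite A (BalTensor B M N) := BalTensor.finite B
  have : Module.Finite A P := Module.Finite.of_surjective
    (LinearMap.snd A A P ∘ₗ e.toLinearEquiv.toLinearMap)
    ((LinearMap.snd_surjective (R := A)).comp e.toLinearEquiv.surjective)
  exact Module.Finite.trans (R := k) A P

theorem finite_balTensor_P (h : IsStableEquivOfMoritaType k A B M N P Q) {X : Type u}
    [AddCommGroup X] [Module A X] [Module.Finite A X] : Module.Finite A (BalTensor A P X) := by
  have := h.finiteDimensional_P
  have : Module.Finite A P := Module.Finite.of_restrictScalars_finite k A P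
  exact BalTensor.finite A

theorem projective_balTensor_P (h : IsStableEquivOfMoritaType k A B M N P Q) (X : Type u)
    [AddCommGroup X] [Module A X] : Module.Projective A (BalTensor A P X) :=
  have := h.finiteDimensional_P
  h.projective_P.projective_balTensor X

section Adjunction

variable (h : IsStableEquivOfMoritaType k A B M N P Q)
  (hM : BimoduleHasNoProjectiveSummand k A B M)
  (eP : BimoduleIso A A (BalTensor B M N) (A × P))
  (eQ : BimoduleIso B B (BalTensor A N M) (B × Q))
  (Y : Type u) [AddCommGroup Y] [Module B Y]

include h hM

/-- The composite is the identity minus the nilpotent error, hence a unit. -/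
theorem triangle_comp_triangle'_bijective :
    Function.Bijective (triangle eP eQ B ∘ₗ triangle' eP eQ B) := by
  have := h.symm.finiteDimensional_P
  have := h.projective_left_M
  have hn := isNilpotent_error k eP eQ hM h.projective_Q
  have hu : IsUnit (triangle eP eQ B ∘ₗ triangle' eP eQ B : Module.End A (BalTensor B M B)) := by
    have h1 := hn.isUnit_one_sub
    rwa [sub_eq_of_eq_add (b := _) (c := triangle eP eQ B ∘ₗ triangle' eP eQ B)
      (LinearMap.ext fun z => (triangle_triangle' eP eQ z).symm)] at h1
  exact (Module.End.isUnit_iff _).1 hu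

theorem triangle_surjective : Function.Surjective (triangle eP eQ Y) :=
  surjective_of_naturality (fun Y _ _ => triangle eP eQ Y) (triangle_naturality eP eQ)
    (Function.Surjective.of_comp (g := triangle' eP eQ B)
      (h.triangle_comp_triangle'_bijective hM eP eQ).2)

/-- Naturality spreads surjectivity, but not injectivity, from `B` to `Y`. So the injectivity on `M
⊗ B` is first turned into surjectivity by finite dimension, and the converse passage is made on `M ⊗
Y`. -/
theorem triangle'_bijective [Module.Finite B Y] : Function.Bijective (triangle' eP eQ Y) := by
  have hfin (Y : Type u) [AddCommGroup Y] [Module B Y] [Module.Finite B Y] :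
      IsNoetherian A (BalTensor B M Y) ∧ IsArtinian A (BalTensor B M Y) := by
    have : FiniteDimensional k (BalTensor B M Y) := finiteDimensional B
    exact ⟨isNoetherian_of_tower k inferInstance, isArtinian_of_tower k inferInstance⟩
  have h1 : Function.Injective (triangle' eP eQ B) :=
    Function.Injective.of_comp (f := triangle eP eQ B)
      (h.triangle_comp_triangle'_bijective hM eP eQ).1
  have := (hfin B).2
  have h2 := (IsArtinian.bijective_of_injective_endomorphism _ h1).2
  have := (hfin Y).1
  exact IsNoetherian.bijective_of_surjective_endomorphism _
    (surjective_of_naturality (fun Y _ _ => triangle' eP eQ Y) (triangle'_naturality eP eQ) h2)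

variable {Y} {X : Type u} [AddCommGroup X] [Module A X]

/-- If `adj r` vanishes, then so does `r` composed with the surjective triangle map, by `adj'_adj`.
-/
theorem eq_zero_of_adj_eq_zero (eP : BimoduleIso A A (BalTensor B M N) (A × P))
    {r : BalTensor B M Y →ₗ[A] X} (hr : adj eQ r = 0) : r = 0 := by
  refine LinearMap.ext fun z => ?_
  obtain ⟨z, rfl⟩ := h.triangle_surjective hM eP eQ Y z
  have := LinearMap.congr_fun (adj'_adj eP eQ r) z
  rw [hr] at this
  rw [← LinearMap.comp_apply, ← this]
  simp only [adj', LinearMap.comp_apply, lTensor_zero, LinearMap.zero_apply, map_zero]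

end Adjunction

end IsStableEquivOfMoritaType

/-! ### Preservation of simple modules forces `P = 0`. -/

namespace IsStableEquivOfMoritaType

open BalTensor

variable {k A B M N P Q : Type u} [Field k] [Ring A] [Algebra k A] [Ring B] [Algebra k B]
  [AddCommGroup M] [Module k M] [Module A M] [Module Bᵐᵒᵖ M]
  [IsScalarTower k A M] [IsScalarTower k Bᵐᵒᵖ M] [SMulCommClass A Bᵐᵒᵖ M]
  [AddCommGroup N] [Module k N] [Module B N] [Module Aᵐᵒᵖ N]
  [IsScalarTower k B N] [IsScalarTower k Aᵐᵒᵖ N] [SMulCommClass B Aᵐᵒᵖ N]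
  [AddCommGroup P] [Module k P] [Module A P] [Module Aᵐᵒᵖ P]
  [IsScalarTower k A P] [IsScalarTower k Aᵐᵒᵖ P] [SMulCommClass A Aᵐᵒᵖ P]
  [AddCommGroup Q] [Module k Q] [Module B Q] [Module Bᵐᵒᵖ Q]
  [IsScalarTower k B Q] [IsScalarTower k Bᵐᵒᵖ Q] [SMulCommClass B Bᵐᵒᵖ Q]
  [FiniteDimensional k A] [FiniteDimensional k B] [FiniteDimensional k M]
  [FiniteDimensional k N]
  (h : IsStableEquivOfMoritaType k A B M N P Q)
  (hM : BimoduleHasNoProjectiveSummand k A B M)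
  (hsimple : ∀ (S : Type u) [AddCommGroup S] [Module A S], IsSimpleModule A S →
    IsSimpleModule B (BalTensor A N S))

include h hM hsimple

/-- The adjunct of `M ⊗ N ⊗ S → P ⊗ S → S'` is a map `N ⊗ S → N ⊗ S'` between simple modules that
factors through the projective module `N ⊗ P ⊗ S`. If it were nonzero, `N ⊗ S` would be projective,
and so would `S`. -/
theorem subsingleton_balTensor_of_not_projective (S : Type u) [AddCommGroup S] [Module A S]
    [IsSimpleModule A S] (hS : ¬ Module.Projective A S) : Subsingleton (BalTensor A P S) := by
  obtain ⟨eP⟩ := h.iso_P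
  obtain ⟨eQ⟩ := h.iso_Q
  have := h.projective_left_M
  have := h.projective_left_N
  have := h.projective_balTensor_P S
  have := h.finite_balTensor_P (X := S)
  refine subsingleton_of_forall_simple_quotient (R := A) fun S' _ _ hS' r => ?_
  have := hsimple S ‹_›
  have := hsimple S' hS'
  have h1 : r ∘ₗ proj' S eP = 0 := by
    refine h.eq_zero_of_adj_eq_zero hM eQ eP ?_
    by_contra h0
    have : Module.Projective B (BalTensor A N (BalTensor A P S)) := projective A
    refine hS (projective_of_balTensor (B := B) (N := N) ?_ eP)
    refine Module.Projective.of_simple_retract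
      (lTensor A N B (proj' S eP) ∘ₗ incl _ eQ) (lTensor A N B r) ?_
    rwa [← LinearMap.comp_assoc, ← lTensor_comp]
  refine LinearMap.ext fun z => ?_
  rw [← proj'_incl' eP z]
  exact LinearMap.congr_fun h1 (incl' S eP z)

/-- The quotient `T'` is not projective, since the extension does not split; hence `P ⊗ T' = 0` and
`P ⊗ T` maps onto `P ⊗ E`. It is shown that `P ⊗ E` has no simple quotient, so that its submodule `P
⊗ T` vanishes. -/
theorem subsingleton_balTensor_of_nonsplit {T E : Type u} [AddCommGroup T] [Module A T]
    [IsSimpleModule A T] [Module.Projective A T] [AddCommGroup E] [Module A E] [Module.Finite A E]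
    {i : T →ₗ[A] E} (hi : Function.Injective i) (hE : IsSimpleModule A (E ⧸ LinearMap.range i))
    (hsplit : ∀ s : E →ₗ[A] T, s ∘ₗ i ≠ LinearMap.id) : Subsingleton (BalTensor A P T) := by
  obtain ⟨eP⟩ := h.iso_P
  obtain ⟨eQ⟩ := h.iso_Q
  have := h.projective_left_M
  have := h.projective_right_M
  have := h.projective_left_N
  have := h.projective_right_N
  set T' := E ⧸ LinearMap.range i
  let q : E →ₗ[A] T' := (LinearMap.range i).mkQ
  have hq : Function.Surjective q := Submodule.mkQ_surjective _
  have hqi : LinearMap.ker q ≤ LinearMap.range i := (Submodule.ker_mkQ _).le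
  have hT' : ¬ Module.Projective A T' := fun _ => by
    obtain ⟨s, hs⟩ := Module.projective_lifting_property q LinearMap.id hq
    have hr (e : E) : e - s (q e) ∈ LinearMap.range i := by
      refine hqi ?_
      rw [LinearMap.mem_ker, map_sub, ← LinearMap.comp_apply q s, hs, LinearMap.id_apply, sub_self]
    let j := LinearEquiv.ofInjective i hi
    refine hsplit (j.symm.toLinearMap ∘ₗ (LinearMap.id - s ∘ₗ q).codRestrict _ hr) ?_
    ext t
    simp only [LinearMap.comp_apply, LinearEquiv.coe_coe, LinearMap.id_apply]
    rw [LinearEquiv.symm_apply_eq]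
    ext
    have : q (i t) = 0 := (Submodule.Quotient.mk_eq_zero _).2 ⟨t, rfl⟩
    simp [this, j]
  have hPT' := h.subsingleton_balTensor_of_not_projective hM hsimple T' hT'
  have hsurj : Function.Surjective (lTensor A P A i) := lTensor_surjective_of_exact A hq hqi
  have := hsimple T ‹_›
  have := hsimple T' ‹_›
  have hFT : Module.Projective B (BalTensor A N T) := projective A
  have hPE : Subsingleton (BalTensor A P E) := by
    have := h.finite_balTensor_P (X := E)
    refine subsingleton_of_forall_simple_quotient (R := A) fun T₁ _ _ hT₁ r => ?_
    have := hsimple T₁ hT₁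
    by_cases hproj : Module.Projective A T₁
    · have hFT₁ : Module.Projective B (BalTensor A N T₁) := projective A
      have h1 : r ∘ₗ proj' E eP = 0 := by
        refine h.eq_zero_of_adj_eq_zero hM eQ eP ?_
        set f := adj eQ (r ∘ₗ proj' E eP)
        -- If `f` kills `N ⊗ T`, a nonzero `f` would identify `N ⊗ T'` with the projective module `N
        -- ⊗ T₁`. Otherwise `f` restricts to an isomorphism on `N ⊗ T`, which splits `N ⊗ i` and
        -- therefore `i`.
        by_cases hfi : f ∘ₗ lTensor A N B i = 0
        · obtain ⟨f', hf'⟩ := exists_factor_lTensor A hq hqi f hfi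
          rw [← hf']
          by_cases hf0 : f' = 0
          · rw [hf0, LinearMap.zero_comp]
          · exact absurd (projective_of_balTensor (B := B) (N := N)
              (Module.Projective.of_simple_retract (Z := BalTensor A N T₁) f' LinearMap.id
                (by rwa [LinearMap.id_comp])) eP) hT'
        · let θ := LinearEquiv.ofBijective _ (LinearMap.bijective_of_ne_zero hfi)
          obtain ⟨s, hs⟩ := exists_retraction_of_lTensor (B := B) (i := i)
            (r := θ.symm.toLinearMap ∘ₗ f) eP (LinearMap.ext fun z => θ.symm_apply_apply z)
          exact absurd hs (hsplit s)
      refine LinearMap.ext fun z => ?_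
      rw [← proj'_incl' eP z]
      exact LinearMap.congr_fun h1 (incl' E eP z)
    -- Here `r` can be tested on `P ⊗ T`. A nonzero adjunct would be an isomorphism from the
    -- projective module `N ⊗ T` to `N ⊗ T₁`, making `T₁` projective.
    · have h1 : (r ∘ₗ lTensor A P A i) ∘ₗ proj' T eP = 0 := by
        refine h.eq_zero_of_adj_eq_zero hM eQ eP ?_
        by_contra h0
        refine hproj (projective_of_balTensor (B := B) (N := N) ?_ eP)
        let θ := LinearEquiv.ofBijective _ (LinearMap.bijective_of_ne_zero h0)
        exact Module.Projective.of_equiv θ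
      refine LinearMap.ext fun z => ?_
      obtain ⟨z, rfl⟩ := hsurj z
      rw [← proj'_incl' eP z]
      exact LinearMap.congr_fun h1 (incl' T eP z)
  exact (lTensor_injective_of_split hi eP).subsingleton

/-- `P = 0 = Q` if `N ⊗_A -` preserves simple modules. -/
theorem subsingleton_P (hE : ∀ (T : Type u) [AddCommGroup T] [Module A T], IsSimpleModule A T →
      Module.Projective A T → ∃ (E : Type u) (_ : AddCommGroup E) (_ : Module A E)
      (_ : Module.Finite A E) (i : T →ₗ[A] E), Function.Injective i ∧
      IsSimpleModule A (E ⧸ LinearMap.range i) ∧ ∀ s : E →ₗ[A] T, s ∘ₗ i ≠ LinearMap.id) :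
    Subsingleton P := by
  have hS (S : Type u) [AddCommGroup S] [Module A S] (hS : IsSimpleModule A S) :
      Subsingleton (BalTensor A P S) := by
    by_cases hp : Module.Projective A S
    · obtain ⟨E, _, _, _, i, hi, hE, hs⟩ := hE S hS hp
      exact h.subsingleton_balTensor_of_nonsplit hM hsimple hi hE hs
    · exact h.subsingleton_balTensor_of_not_projective hM hsimple S hp
  -- Induction along a composition series, applied to the regular module since `P ⊗ A ≅ P`.
  have hX (X : Type u) [AddCommGroup X] [Module A X] (hX : IsFiniteLength A X) :
      Subsingleton (BalTensor A P X) := by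
    induction hX with
    | of_subsingleton =>
      refine subsingleton_of_forall_eq 0 fun z => ?_
      induction z using induction_on with
      | h0 => rfl
      | ht p x => rw [Subsingleton.elim x 0, tmul_zero]
      | ha z w hz hw => rw [hz, hw, add_zero]
    | @of_simple_quotient X _ _ W hW _ ih =>
      have := hS _ hW
      exact subsingleton_of_exact A P A (f := W.subtype) W.mkQ_surjective (by simp)
  have : IsArtinianRing A := IsArtinianRing.of_finite k A
  have h1 := hX A (isFiniteLength_iff_isNoetherian_isArtinian.2 ⟨inferInstance, inferInstance⟩)
  exact (rid A A P).symm.injective.subsingleton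

end IsStableEquivOfMoritaType

/-! ### Nonsplit extensions of simple projective modules. -/

section SemisimpleSummand

/-- A simple module that splits off every extension of a simple module by it splits off every
Noetherian and Artinian module. -/
theorem exists_retraction_of_simple_extensions {R T : Type u} [Ring R] [AddCommGroup T] [Module R T]
    [IsNoetherianRing R] [IsArtinianRing R]
    (hT : ∀ (E : Type u) [AddCommGroup E] [Module R E] [Module.Finite R E] (i : T →ₗ[R] E),
      Function.Injective i → IsSimpleModule R (E ⧸ LinearMap.range i) →
      ∃ s : E →ₗ[R] T, s ∘ₗ i = LinearMap.id)
    {Y : Type u} [AddCommGroup Y] [Module R Y] [Module.Finite R Y] {i : T →ₗ[R] Y}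
    (hi : Function.Injective i) : ∃ s : Y →ₗ[R] T, s ∘ₗ i = LinearMap.id := by
  -- `J` is maximal among the submodules meeting `i(T)` trivially, so `T` still embeds in `Y ⧸ J`;
  -- the aim is to show that it fills it.
  obtain ⟨J, hJ, hmax⟩ := wellFounded_gt.has_min {J : Submodule R Y | ∀ t, i t ∈ J → t = 0}
    ⟨⊥, fun t ht => hi (by rw [map_zero]; exact ht)⟩
  set j : T →ₗ[R] Y ⧸ J := J.mkQ ∘ₗ i
  have hj : Function.Injective j := (injective_iff_map_eq_zero _).2 fun t ht =>
    hJ t ((Submodule.Quotient.mk_eq_zero J).1 ht)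
  by_cases htop : LinearMap.range j = ⊤
  · let θ := LinearEquiv.ofBijective j ⟨hj, LinearMap.range_eq_top.1 htop⟩
    exact ⟨θ.symm.toLinearMap ∘ₗ J.mkQ, LinearMap.ext fun t => θ.symm_apply_apply t⟩
  · exfalso
    -- `W` is an extension of a simple module by `T`, so it splits by a retraction `s`. The preimage
    -- of `ker s` in `Y` still meets `i(T)` trivially, hence equals `J` by maximality. Thus `ker s =
    -- 0`, and `W` is no larger than `T`.
    obtain ⟨W, hW, -⟩ := exists_covBy_le_of_lt (lt_top_iff_ne_top.2 htop)
    have hjW (t : T) : j t ∈ W := hW.le ⟨t, rfl⟩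
    have hsW : IsSimpleModule R (W ⧸ LinearMap.range (j.codRestrict W hjW)) := by
      rw [LinearMap.range_codRestrict]
      exact (covBy_iff_quot_is_simple hW.le).1 hW
    obtain ⟨s, hs⟩ := hT W (j.codRestrict W hjW)
      (fun t t' h => hj (congrArg Subtype.val h)) hsW
    have hs' (t : T) : s ⟨j t, hjW t⟩ = t := LinearMap.congr_fun hs t
    have hle : J ≤ ((LinearMap.ker s).map W.subtype).comap J.mkQ := fun y hy => by
      rw [Submodule.mem_comap, Submodule.mkQ_apply, (Submodule.Quotient.mk_eq_zero J).2 hy]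
      exact Submodule.zero_mem _
    have hmem : ∀ t, i t ∈ ((LinearMap.ker s).map W.subtype).comap J.mkQ → t = 0 := by
      rintro t ⟨w, hw, hwt⟩
      have : w = ⟨j t, hjW t⟩ := Subtype.ext hwt
      rw [← hs' t, ← this]
      exact hw
    have heq := hle.eq_of_not_lt (hmax _ hmem)
    refine hW.lt.not_ge fun w hw => ?_
    have hk : (⟨w, hw⟩ : W) - ⟨j (s ⟨w, hw⟩), hjW _⟩ ∈ LinearMap.ker s := by
      rw [LinearMap.mem_ker, map_sub, hs', sub_self]
    obtain ⟨y, hy⟩ := J.mkQ_surjective (w - j (s ⟨w, hw⟩))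
    have hyJ : y ∈ J := by
      rw [heq]
      exact ⟨_, hk, hy.symm⟩
    rw [Submodule.mkQ_apply, (Submodule.Quotient.mk_eq_zero J).2 hyJ] at hy
    exact ⟨_, (sub_eq_zero.1 hy.symm).symm⟩

variable {k A : Type u} [Field k] [Ring A] [Algebra k A] [FiniteDimensional k A]

/-- An algebra has a nonzero semisimple direct summand if it has a simple projective module that
splits off every finitely generated module containing it. -/
theorem HasNoSemisimpleSummand.not_forall_exists_retraction (hA : HasNoSemisimpleSummand k A)
    (T : Type u) [AddCommGroup T] [Module A T] [IsSimpleModule A T] [Module.Projective A T] :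
    ¬ ∀ i : T →ₗ[A] A, Function.Injective i → ∃ s : A →ₗ[A] T, s ∘ₗ i = LinearMap.id := by
  classical
  intro hsplit
  have : Nontrivial T := IsSimpleModule.nontrivial A T
  let : Module k T := Module.compHom T (algebraMap k A)
  have : IsScalarTower k A T := ⟨fun c b z => by rw [Algebra.smul_def, mul_smul]; rfl⟩
  have : Module.Finite k T := Module.Finite.trans A T
  let b := Module.finBasis k T
  -- Acting on a `k`-basis of `T` embeds `A ⧸ K` in a finite power of `T`; its image is therefore
  -- semisimple and projective.
  let φ : A →ₗ[A] Fin (Module.finrank k T) → T :=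
    LinearMap.pi fun i => LinearMap.toSpanSingleton A T (b i)
  set K := Module.annihilator A T
  have hφ (a : A) : φ a = 0 ↔ a ∈ K := by
    rw [Module.mem_annihilator]
    refine ⟨fun h t => ?_, fun h => funext fun i => h (b i)⟩
    rw [← b.sum_repr t, Finset.smul_sum]
    refine Finset.sum_eq_zero fun i _ => ?_
    rw [smul_comm, show a • b i = 0 from congrFun h i, smul_zero]
  obtain ⟨C, hC⟩ := exists_isCompl (LinearMap.range φ)
  let p := (LinearMap.range φ).projectionOnto C hC
  have hp (v : LinearMap.range φ) : p v = v := Submodule.projectionOnto_apply_left hC v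
  have : Module.Projective A (Fin (Module.finrank k T) →₀ T) :=
    Module.Projective.of_equiv (finsuppLEquivDirectSum A T _).symm
  have : Module.Projective A (Fin (Module.finrank k T) → T) :=
    Module.Projective.of_equiv (Finsupp.linearEquivFunOnFinite A T _)
  have : Module.Projective A (LinearMap.range φ) :=
    Module.Projective.of_split (LinearMap.range φ).subtype p (LinearMap.ext hp)
  -- Splitting `A → A ⧸ K` gives an element `e` such that `1 - e` lies in `K` and `K e = 0`. The
  -- remaining point is that `e` is central, for which `e K = 0` is needed.
  obtain ⟨σ, hσ⟩ := Module.projective_lifting_property φ.rangeRestrict LinearMap.id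
    φ.surjective_rangeRestrict
  set e := σ (φ.rangeRestrict 1)
  have hσφ (a : A) : σ (φ.rangeRestrict a) = a * e := by
    rw [← smul_eq_mul, ← map_smul, ← map_smul, smul_eq_mul, mul_one]
  have hφe (a : A) : a - a * e ∈ K := by
    rw [← hφ, map_sub, ← hσφ, sub_eq_zero]
    exact (congrArg Subtype.val (LinearMap.congr_fun hσ (φ.rangeRestrict a))).symm
  have hKe {x : A} (hx : x ∈ K) : x * e = 0 := by
    rw [← hσφ, show φ.rangeRestrict x = 0 from Subtype.ext ((hφ x).2 hx), map_zero]
  -- If `e * x ≠ 0`, right multiplication by `x` embeds a copy of `T` in `K`. A retraction `s` onto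
  -- it would give `t = s (i t) = i t • s 1 = 0`, because `i t` lies in the annihilator of `T`.
  have heK {x : A} (hx : x ∈ K) : e * x = 0 := by
    by_contra hex
    let ρ : (Fin (Module.finrank k T) → T) →ₗ[A] A :=
      LinearMap.toSpanSingleton A A x ∘ₗ σ ∘ₗ p
    have hρK (v) : ρ v ∈ K := K.smul_mem _ hx
    have hρ : ρ ≠ 0 := fun h0 => hex <| by
      have h1 := LinearMap.congr_fun h0 (φ.rangeRestrict 1)
      change σ (p (φ.rangeRestrict 1)) * x = 0 at h1
      rwa [hp] at h1
    obtain ⟨i, hi⟩ : ∃ i, ρ ∘ₗ LinearMap.single A (fun _ => T) i ≠ 0 := by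
      by_contra! h0
      exact hρ (LinearMap.pi_ext' h0)
    obtain ⟨s, hs⟩ := hsplit _ (LinearMap.injective_of_ne_zero hi)
    obtain ⟨t, ht⟩ := exists_ne (0 : T)
    refine ht ?_
    rw [← LinearMap.id_apply (R := A) t, ← hs, LinearMap.comp_apply,
      ← mul_one ((ρ ∘ₗ LinearMap.single A (fun _ => T) i) t), ← smul_eq_mul, map_smul]
    exact Module.mem_annihilator.1 (hρK _) _
  have he1 : 1 - e ∈ K := by simpa using hφe 1
  have hee : e * e = e := by
    have := hKe he1
    rwa [sub_mul, one_mul, sub_eq_zero, eq_comm] at this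
  have hcomm (a : A) : a * e = e * a := by
    have h1 := hKe (K.mul_mem_right a he1)
    have h2 := heK (hφe a)
    rw [sub_mul, sub_mul, one_mul, sub_eq_zero] at h1
    rw [mul_sub, sub_eq_zero] at h2
    exact h1.trans ((mul_assoc _ _ _).trans h2.symm)
  set K' : Ideal A := Ideal.span {e}
  have hK' (x : A) : x ∈ K' ↔ x * e = x := by
    rw [Ideal.mem_span_singleton']
    refine ⟨?_, fun h => ⟨x, h⟩⟩
    rintro ⟨a, rfl⟩
    rw [mul_assoc, hee]
  have : K'.IsTwoSided := ⟨fun {a} b ha => by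
    rw [hK'] at ha ⊢
    rw [mul_assoc, hcomm, ← mul_assoc, ha]⟩
  -- The central idempotent `e` decomposes `A`; the factor `A ⧸ K` is semisimple, and it is nonzero
  -- because it acts on `T`.
  let f : A →ₐ[k] (A ⧸ K) × (A ⧸ K') :=
    AlgHom.prod (Ideal.Quotient.mkₐ k K) (Ideal.Quotient.mkₐ k K')
  have hf (a : A) : f a = (Ideal.Quotient.mk K a, Ideal.Quotient.mk K' a) := rfl
  have hbij : Function.Bijective f := by
    constructor
    · refine (injective_iff_map_eq_zero f).2 fun a ha => ?_
      rw [hf, Prod.mk_eq_zero, Ideal.Quotient.eq_zero_iff_mem, Ideal.Quotient.eq_zero_iff_mem] at ha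
      rw [← (hK' a).1 ha.2, hKe ha.1]
    · rintro ⟨x, y⟩
      obtain ⟨a, rfl⟩ := Ideal.Quotient.mk_surjective x
      obtain ⟨c, rfl⟩ := Ideal.Quotient.mk_surjective y
      refine ⟨a * e + c * (1 - e), ?_⟩
      rw [hf, Prod.mk.injEq, Ideal.Quotient.eq, Ideal.Quotient.eq]
      constructor
      · have : a * e + c * (1 - e) - a = (c - a) * (1 - e) := by noncomm_ring
        rw [this]
        exact K.mul_mem_left _ he1
      · rw [hK']
        have : a * e + c * (1 - e) - c = (a - c) * e := by noncomm_ring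
        rw [this, mul_assoc, hee]
  have hker : LinearMap.ker φ = K := Submodule.ext hφ
  have hss : IsSemisimpleModule A (A ⧸ K) := by
    rw [← hker]
    exact IsSemisimpleModule.congr φ.quotKerEquivRange
  have : IsSemisimpleRing (A ⧸ K) := by
    let g : (A ⧸ K) →ₛₗ[Ideal.Quotient.mk K] (A ⧸ K) :=
      { toFun := id
        map_add' := fun _ _ => rfl
        map_smul' := fun a x => by
          obtain ⟨x, rfl⟩ := Ideal.Quotient.mk_surjective x
          rfl }
    have : RingHomSurjective (Ideal.Quotient.mk K) := ⟨Ideal.Quotient.mk_surjective⟩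
    exact (g.isSemisimpleModule_iff_of_bijective Function.bijective_id).1 hss
  have hsub := hA (A ⧸ K) (A ⧸ K') ⟨AlgEquiv.ofBijective f hbij⟩ this
  obtain ⟨t, ht⟩ := exists_ne (0 : T)
  refine ht ?_
  rw [← one_smul A t]
  exact Module.mem_annihilator.1 (Ideal.Quotient.eq_zero_iff_mem.1
    (Subsingleton.elim (Ideal.Quotient.mk K 1) 0)) t

/-- A simple projective module over an algebra without semisimple direct summands has a nonsplit
extension by a simple module. -/
theorem HasNoSemisimpleSummand.exists_nonsplit (hA : HasNoSemisimpleSummand k A)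
    (T : Type u) [AddCommGroup T] [Module A T] [IsSimpleModule A T] [Module.Projective A T] :
    ∃ (E : Type u) (_ : AddCommGroup E) (_ : Module A E)
      (_ : Module.Finite A E) (i : T →ₗ[A] E), Function.Injective i ∧
      IsSimpleModule A (E ⧸ LinearMap.range i) ∧ ∀ s : E →ₗ[A] T, s ∘ₗ i ≠ LinearMap.id := by
  by_contra! hcon
  have : IsArtinianRing A := IsArtinianRing.of_finite k A
  exact hA.not_forall_exists_retraction T fun i hi =>
    exists_retraction_of_simple_extensions (fun E _ _ _ i hi hE => hcon E _ _ ‹_› i hi hE) hi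

end SemisimpleSummand

/-! ### From `P = 0` to `Q = 0` and an equivalence. -/

namespace IsStableEquivOfMoritaType

open BalTensor

variable {k A B M N P Q : Type u} [Field k] [Ring A] [Algebra k A] [Ring B] [Algebra k B]
  [AddCommGroup M] [Module k M] [Module A M] [Module Bᵐᵒᵖ M]
  [IsScalarTower k A M] [IsScalarTower k Bᵐᵒᵖ M] [SMulCommClass A Bᵐᵒᵖ M]
  [AddCommGroup N] [Module k N] [Module B N] [Module Aᵐᵒᵖ N]
  [IsScalarTower k B N] [IsScalarTower k Aᵐᵒᵖ N] [SMulCommClass B Aᵐᵒᵖ N]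
  [AddCommGroup P] [Module k P] [Module A P] [Module Aᵐᵒᵖ P]
  [IsScalarTower k A P] [IsScalarTower k Aᵐᵒᵖ P] [SMulCommClass A Aᵐᵒᵖ P]
  [AddCommGroup Q] [Module k Q] [Module B Q] [Module Bᵐᵒᵖ Q]
  [IsScalarTower k B Q] [IsScalarTower k Bᵐᵒᵖ Q] [SMulCommClass B Bᵐᵒᵖ Q]
  [FiniteDimensional k A] [FiniteDimensional k B] [FiniteDimensional k M]
  [FiniteDimensional k N]

theorem triangle_bijective (h : IsStableEquivOfMoritaType k A B M N P Q)
    (hM : BimoduleHasNoProjectiveSummand k A B M)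
    (eP : BimoduleIso A A (BalTensor B M N) (A × P))
    (eQ : BimoduleIso B B (BalTensor A N M) (B × Q))
    (Y : Type u) [AddCommGroup Y] [Module B Y] [Module.Finite B Y] :
    Function.Bijective (triangle eP eQ Y) := by
  have : FiniteDimensional k (BalTensor B M Y) := finiteDimensional B
  have : IsNoetherian A (BalTensor B M Y) := isNoetherian_of_tower k inferInstance
  exact IsNoetherian.bijective_of_surjective_endomorphism _ (h.triangle_surjective hM eP eQ Y)

omit [FiniteDimensional k A] [FiniteDimensional k B] [FiniteDimensional k M]
  [FiniteDimensional k N] in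
theorem incl_bijective [Subsingleton P] (eP : BimoduleIso A A (BalTensor B M N) (A × P))
    (X : Type u) [AddCommGroup X] [Module A X] : Function.Bijective (incl X eP) := by
  have hPX (z : BalTensor A P X) : z = 0 := by
    induction z using induction_on with
    | h0 => rfl
    | ht p x => rw [Subsingleton.elim p 0, zero_tmul]
    | ha z w hz hw => rw [hz, hw, add_zero]
  refine ⟨Function.LeftInverse.injective (proj_incl eP), fun z => ⟨proj X eP z, ?_⟩⟩
  conv_rhs => rw [← incl_proj_add eP z, hPX (proj' X eP z), map_zero, add_zero]

/-- If `P = 0`, then `Q = 0`. -/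
theorem subsingleton_Q (h : IsStableEquivOfMoritaType k A B M N P Q)
    (hN : BimoduleHasNoProjectiveSummand k B A N) [Subsingleton P] : Subsingleton Q := by
  obtain ⟨eP⟩ := h.iso_P
  obtain ⟨eQ⟩ := h.iso_Q
  have hX (X : Type u) [AddCommGroup X] [Module A X] [Module.Finite A X] :
      Subsingleton (BalTensor B Q (BalTensor A N X)) := by
    refine subsingleton_of_forall_eq 0 fun q => ?_
    -- As `P = 0`, every element of `N ⊗ M ⊗ N ⊗ X` comes from `N ⊗ X`. Followed by the projection
    -- for `eQ` this is the bijective triangle map, so the summand `Q ⊗ N ⊗ X`, killed by that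
    -- projection, is zero.
    obtain ⟨w, hw⟩ := lTensor_surjective A (B := B) (N := N) (incl_bijective eP X).2
      (incl' _ eQ q)
    have h1 : triangle eQ eP X w = 0 := by
      change proj _ eQ (lTensor A N B (incl X eP) w) = 0
      rw [hw]
      simp [proj, incl']
    have h2 : w = 0 := (h.symm.triangle_bijective hN eQ eP X).1 (by rw [h1, map_zero])
    rw [h2, map_zero] at hw
    rw [← proj'_incl' eQ q, ← hw, map_zero]
  have : Module.Finite A M := Module.Finite.of_restrictScalars_finite k A M
  have : Module.Finite A (BalTensor B M B) := BalTensor.finite B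
  have := hX (BalTensor B M B)
  -- `B` is a retract of `N ⊗ M ⊗ B`, so `Q ≅ Q ⊗ B` embeds in a module already known to vanish.
  have h1 : Function.Injective (lTensor B Q B (incl B eQ)) :=
    lTensor_injective_of_leftInverse B (g := proj B eQ) (LinearMap.ext (proj_incl eQ))
  have := h1.subsingleton
  exact (rid B B Q).symm.injective.subsingleton

/-- If `P = 0 = Q`, then `N ⊗_A -` is an equivalence. -/
theorem isEquivalence (h : IsStableEquivOfMoritaType k A B M N P Q) [Subsingleton P]
    [Subsingleton Q] : (tensorFunctor k A B N).IsEquivalence := by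
  obtain ⟨eP⟩ := h.iso_P
  obtain ⟨eQ⟩ := h.iso_Q
  let η : 𝟭 (FGModuleCat.{u} A) ≅ tensorFunctor k A B N ⋙ tensorFunctor k B A M :=
    NatIso.ofComponents (fun X =>
      ObjectProperty.isoMk _ (LinearEquiv.ofBijective (incl X eP) (incl_bijective eP X)).toModuleIso)
      (fun f => by
        apply FGModuleCat.hom_ext
        exact LinearMap.ext (incl_naturality eP f.hom.hom))
  let ε : 𝟭 (FGModuleCat.{u} B) ≅ tensorFunctor k B A M ⋙ tensorFunctor k A B N :=
    NatIso.ofComponents (fun X =>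
      ObjectProperty.isoMk _ (LinearEquiv.ofBijective (incl X eQ) (incl_bijective eQ X)).toModuleIso)
      (fun f => by
        apply FGModuleCat.hom_ext
        exact LinearMap.ext (incl_naturality eQ f.hom.hom))
  exact Functor.IsEquivalence.mk' (tensorFunctor k B A M) η ε.symm

end IsStableEquivOfMoritaType

/-! ### Simple modules under equivalences, and lifts of the stable functor. -/

section Categorical

theorem FGModuleCat.injective_of_mono {A : Type u} [Ring A] [IsNoetherianRing A]
    {X Y : FGModuleCat.{u} A} (f : X ⟶ Y) [Mono f] : Function.Injective f.hom.hom := by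
  refine LinearMap.ker_eq_bot.1 (eq_bot_iff.2 fun x hx => ?_)
  let K := FGModuleCat.of A (LinearMap.ker f.hom.hom)
  let ι : K ⟶ X := FGModuleCat.ofHom (LinearMap.ker f.hom.hom).subtype
  have h1 : ι ≫ f = 0 ≫ f := by
    apply FGModuleCat.hom_ext
    refine LinearMap.ext fun z => ?_
    change f.hom.hom z.1 = f.hom.hom 0
    rw [map_zero]
    exact z.2
  have h2 : ι.hom.hom ⟨x, hx⟩ = (0 : K ⟶ X).hom.hom ⟨x, hx⟩ := by rw [(cancel_mono f).1 h1]
  exact h2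

/-- A description by morphisms alone: every quotient map out of a simple module is zero or
injective. In this form simplicity visibly passes along equivalences. -/
theorem FGModuleCat.isSimpleModule_iff {A : Type u} [Ring A] [IsNoetherianRing A]
    (X : FGModuleCat.{u} A) :
    IsSimpleModule A X ↔ 𝟙 X ≠ 0 ∧ ∀ (Y : FGModuleCat.{u} A) (f : X ⟶ Y), f = 0 ∨ Mono f := by
  constructor
  · intro hX
    have : Nontrivial X := IsSimpleModule.nontrivial A X
    refine ⟨fun h0 => ?_, fun Y f => ?_⟩
    · obtain ⟨x, hx⟩ := exists_ne (0 : X)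
      have h1 : (𝟙 X : X ⟶ X).hom.hom x = (0 : X ⟶ X).hom.hom x := by rw [h0]
      exact hx h1
    · rcases LinearMap.injective_or_eq_zero f.hom.hom with hf | hf
      · exact Or.inr (ConcreteCategory.mono_of_injective f hf)
      · exact Or.inl (FGModuleCat.hom_ext hf)
  · rintro ⟨h0, hX⟩
    have : Nontrivial X := by
      by_contra hX
      have := not_nontrivial_iff_subsingleton.1 hX
      exact h0 (FGModuleCat.hom_ext (LinearMap.ext fun x => Subsingleton.elim _ _))
    have key (W : Submodule A X) : W = ⊥ ∨ W = ⊤ := by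
      let f : X ⟶ FGModuleCat.of A (X ⧸ W) := FGModuleCat.ofHom W.mkQ
      rcases hX _ f with h1 | h1
      · right
        rw [← W.ker_mkQ, LinearMap.ker_eq_top]
        exact congrArg (fun f => f.hom.hom) h1
      · left
        rw [← W.ker_mkQ, LinearMap.ker_eq_bot]
        exact FGModuleCat.injective_of_mono f
    exact { toIsSimpleOrder := { eq_bot_or_eq_top := key } }

/-- Equivalences preserve simple modules. -/
theorem FGModuleCat.isSimpleModule_obj {A B : Type u} [Ring A] [IsNoetherianRing A] [Ring B]
    [IsNoetherianRing B] (F : FGModuleCat.{u} A ⥤ FGModuleCat.{u} B) [F.IsEquivalence]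
    {S : FGModuleCat.{u} A} (hS : IsSimpleModule A S) : IsSimpleModule B (F.obj S) := by
  rw [FGModuleCat.isSimpleModule_iff] at hS ⊢
  refine ⟨fun h0 => hS.1 (F.map_injective ?_), fun Y f => ?_⟩
  · rw [F.map_id, h0, F.map_zero]
  · let e := F.objObjPreimageIso Y
    obtain ⟨g, hg⟩ := F.map_surjective (f ≫ e.inv)
    have hf : f = F.map g ≫ e.hom := by rw [hg, Category.assoc, e.inv_hom_id, Category.comp_id]
    rcases hS.2 _ g with h1 | h1
    · left
      rw [hf, h1, F.map_zero, Limits.zero_comp]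
    · right
      rw [hf]
      infer_instance

open scoped ModuleCat.Algebra in
theorem liftsToMoritaEquivalence_of_isEquivalence (k A B : Type u) [Field k] [Ring A] [Algebra k A]
    [Ring B] [Algebra k B] (N : Type u) [AddCommGroup N] [Module k N] [Module B N] [Module Aᵐᵒᵖ N]
    [IsScalarTower k B N] [IsScalarTower k Aᵐᵒᵖ N] [SMulCommClass B Aᵐᵒᵖ N] [FiniteDimensional k N]
    (hN : Module.Projective B N) (h : (tensorFunctor k A B N).IsEquivalence) :
    LiftsToMoritaEquivalence k A B (stableTensorFunctor k A B N hN) := by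
  have hadd : (tensorFunctor k A B N).Additive :=
    { map_add := fun {X Y f g} => by
        apply FGModuleCat.hom_ext
        exact BalTensor.lTensor_add A f.hom.hom g.hom.hom }
  refine ⟨tensorFunctor k A B N, h, ⟨hadd, ⟨fun {X Y} f c => ?_⟩⟩,
    ⟨(CategoryTheory.Quotient.lift.isLift _ _ _).symm⟩⟩
  apply FGModuleCat.hom_ext
  refine BalTensor.linearMap_ext fun n x => ?_
  change BalTensor.tmul A n ((algebraMap k A c) • f.hom.hom x) =
    (algebraMap k B c) • BalTensor.tmul A n (f.hom.hom x)
  rw [← BalTensor.smul_tmul, BalTensor.smul_left_tmul, ← MulOpposite.algebraMap_apply,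
    algebraMap_smul, algebraMap_smul]

end Categorical

/-! ### Hom dimensions and the injectivity of `P ⊗ Y`. -/

section HomDimension

theorem LinearMap.finiteDimensional_of_tower (k : Type*) {A X Y : Type*} [Field k] [Ring A]
    [Algebra k A] [AddCommGroup X] [Module k X] [Module A X] [IsScalarTower k A X]
    [AddCommGroup Y] [Module k Y] [Module A Y] [IsScalarTower k A Y]
    [FiniteDimensional k X] [FiniteDimensional k Y] : FiniteDimensional k (X →ₗ[A] Y) :=
  Module.Finite.of_injective (LinearMap.restrictScalarsₗ k A X Y k)
    (LinearMap.restrictScalars_injective k)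

namespace IsStableEquivOfMoritaType

open BalTensor Module

variable {k A B M N P Q : Type u} [Field k] [Ring A] [Algebra k A] [Ring B] [Algebra k B]
  [AddCommGroup M] [Module k M] [Module A M] [Module Bᵐᵒᵖ M]
  [IsScalarTower k A M] [IsScalarTower k Bᵐᵒᵖ M] [SMulCommClass A Bᵐᵒᵖ M]
  [AddCommGroup N] [Module k N] [Module B N] [Module Aᵐᵒᵖ N]
  [IsScalarTower k B N] [IsScalarTower k Aᵐᵒᵖ N] [SMulCommClass B Aᵐᵒᵖ N]
  [AddCommGroup P] [Module k P] [Module A P] [Module Aᵐᵒᵖ P]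
  [IsScalarTower k A P] [IsScalarTower k Aᵐᵒᵖ P] [SMulCommClass A Aᵐᵒᵖ P]
  [AddCommGroup Q] [Module k Q] [Module B Q] [Module Bᵐᵒᵖ Q]
  [IsScalarTower k B Q] [IsScalarTower k Bᵐᵒᵖ Q] [SMulCommClass B Bᵐᵒᵖ Q]
  [FiniteDimensional k A] [FiniteDimensional k B] [FiniteDimensional k M]
  [FiniteDimensional k N]
  (h : IsStableEquivOfMoritaType k A B M N P Q)
  (hM : BimoduleHasNoProjectiveSummand k A B M)
  (hN : BimoduleHasNoProjectiveSummand k B A N)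

include h hM hN

/-- `adj` and `adj'` are injective `k`-linear maps in opposite directions between finite-dimensional
spaces; injectivity of `adj'` rests on the triangle map for `N`. -/
theorem finrank_adj (X Y : Type u) [AddCommGroup X] [Module k X] [Module A X] [IsScalarTower k A X]
    [Module.Finite A X] [AddCommGroup Y] [Module k Y] [Module B Y] [IsScalarTower k B Y]
    [Module.Finite B Y] :
    finrank k (BalTensor B M Y →ₗ[A] X) = finrank k (Y →ₗ[B] BalTensor A N X) := by
  obtain ⟨eP⟩ := h.iso_P
  obtain ⟨eQ⟩ := h.iso_Q
  have : FiniteDimensional k X := Module.Finite.trans A X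
  have : FiniteDimensional k Y := Module.Finite.trans B Y
  have : FiniteDimensional k (BalTensor B M Y) := finiteDimensional B
  have : FiniteDimensional k (BalTensor A N X) := finiteDimensional A
  have := LinearMap.finiteDimensional_of_tower k (A := A) (X := BalTensor B M Y) (Y := X)
  have := LinearMap.finiteDimensional_of_tower k (A := B) (X := Y) (Y := BalTensor A N X)
  let φ : (BalTensor B M Y →ₗ[A] X) →ₗ[k] (Y →ₗ[B] BalTensor A N X) :=
    { toFun := adj eQ
      map_add' := fun r r' => by rw [adj, lTensor_add, LinearMap.add_comp]; rfl
      map_smul' := fun c r => by rw [adj, lTensor_smul, LinearMap.smul_comp]; rfl }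
  let ψ : (Y →ₗ[B] BalTensor A N X) →ₗ[k] (BalTensor B M Y →ₗ[A] X) :=
    { toFun := adj' eP
      map_add' := fun r r' => by rw [adj', lTensor_add, LinearMap.comp_add]; rfl
      map_smul' := fun c r => by
        rw [adj', lTensor_smul]
        exact LinearMap.ext fun z =>
          (proj X eP).map_smul_of_tower c (lTensor B M A r z) }
  refine le_antisymm (LinearMap.finrank_le_finrank_of_injective (f := φ)
    ((injective_iff_map_eq_zero φ).2 fun r hr => h.eq_zero_of_adj_eq_zero hM eQ eP hr))
    (LinearMap.finrank_le_finrank_of_injective (f := ψ)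
    ((injective_iff_map_eq_zero ψ).2 fun f hf => ?_))
  have h1 := adj_adj' eP eQ f
  rw [show adj' eP f = 0 from hf, show adj eQ 0 = 0 from map_zero φ] at h1
  refine LinearMap.ext fun y => (h.symm.triangle'_bijective hN eQ eP X).1 ?_
  rw [LinearMap.zero_apply, map_zero]
  exact (LinearMap.congr_fun h1 y).symm

/-- Applying the adjunction twice gives `dim Hom(M ⊗ N ⊗ X, Y) = dim Hom(X, M ⊗ N ⊗ Y)`. Both sides
split off `dim Hom(X, Y)`, and cancelling it leaves the claim. -/
theorem finrank_hom_balTensor_P (X Y : Type u) [AddCommGroup X] [Module k X] [Module A X]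
    [IsScalarTower k A X] [Module.Finite A X] [AddCommGroup Y] [Module k Y] [Module A Y]
    [IsScalarTower k A Y] [Module.Finite A Y] :
    finrank k (BalTensor A P X →ₗ[A] Y) = finrank k (X →ₗ[A] BalTensor A P Y) := by
  obtain ⟨eP⟩ := h.iso_P
  have : FiniteDimensional k P := h.finiteDimensional_P
  have : Module.Finite B N := Module.Finite.of_restrictScalars_finite k B N
  have : Module.Finite B (BalTensor A N X) := BalTensor.finite A
  have : Module.Finite B (BalTensor A N Y) := BalTensor.finite A
  have h1 := (h.finrank_adj hM hN Y (BalTensor A N X)).trans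
    (h.symm.finrank_adj hN hM (BalTensor A N Y) X)
  have : FiniteDimensional k X := Module.Finite.trans A X
  have : FiniteDimensional k Y := Module.Finite.trans A Y
  have : FiniteDimensional k (BalTensor A P X) := finiteDimensional A
  have : FiniteDimensional k (BalTensor A P Y) := finiteDimensional A
  have := LinearMap.finiteDimensional_of_tower k (A := A) (X := X) (Y := Y)
  have := LinearMap.finiteDimensional_of_tower k (A := A) (X := BalTensor A P X) (Y := Y)
  have := LinearMap.finiteDimensional_of_tower k (A := A) (X := X) (Y := BalTensor A P Y)
  have e1 := ((splitEquiv X eP).congrLeft (M := Y) k ≪≫ₗ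
    (LinearMap.coprodEquiv (R := A) (M := X) (M₂ := BalTensor A P X) (M₃ := Y) k).symm).finrank_eq
  have e2 : finrank k (X →ₗ[A] BalTensor B M (BalTensor A N Y)) =
      finrank k ((X →ₗ[A] Y) × (X →ₗ[A] BalTensor A P Y)) := by
    refine LinearEquiv.finrank_eq ((LinearEquiv.ofLinearMap
      (LinearMap.compRight k (splitEquiv Y eP).toLinearMap)
      (LinearMap.compRight k (splitEquiv Y eP).symm.toLinearMap) ?_ ?_) ≪≫ₗ
      (LinearMap.prodEquiv (R := A) (M := X) (M₂ := Y) (M₃ := BalTensor A P Y) k).symm)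
    · ext f x <;> simp
    · ext f x; simp
  rw [finrank_prod] at e1 e2
  omega

/-- Maps to `P ⊗ Y` extend along injective maps. -/
theorem exists_extension_to_balTensor_P {X X₁ Y : Type u} [AddCommGroup X] [Module A X]
    [Module.Finite A X] [AddCommGroup X₁] [Module A X₁] [Module.Finite A X₁] [AddCommGroup Y]
    [Module A Y] [Module.Finite A Y] {i : X →ₗ[A] X₁} (hi : Function.Injective i)
    (f : X →ₗ[A] BalTensor A P Y) : ∃ g : X₁ →ₗ[A] BalTensor A P Y, g ∘ₗ i = f := by
  obtain ⟨eP⟩ := h.iso_P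
  have := h.projective_right_M
  have := h.projective_right_N
  have : FiniteDimensional k P := h.finiteDimensional_P
  let : Module k X := Module.compHom X (algebraMap k A)
  have : IsScalarTower k A X := ⟨fun c b z => by rw [Algebra.smul_def, mul_smul]; rfl⟩
  let : Module k X₁ := Module.compHom X₁ (algebraMap k A)
  have : IsScalarTower k A X₁ := ⟨fun c b z => by rw [Algebra.smul_def, mul_smul]; rfl⟩
  let : Module k Y := Module.compHom Y (algebraMap k A)
  have : IsScalarTower k A Y := ⟨fun c b z => by rw [Algebra.smul_def, mul_smul]; rfl⟩
  let X₂ := X₁ ⧸ LinearMap.range i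
  let q : X₁ →ₗ[A] X₂ := (LinearMap.range i).mkQ
  have hq : Function.Surjective q := Submodule.mkQ_surjective _
  have hqi : LinearMap.ker q ≤ LinearMap.range i := (Submodule.ker_mkQ _).le
  have : FiniteDimensional k X := Module.Finite.trans A X
  have : FiniteDimensional k X₁ := Module.Finite.trans A X₁
  have : FiniteDimensional k X₂ := Module.Finite.trans A X₂
  have : FiniteDimensional k Y := Module.Finite.trans A Y
  have : FiniteDimensional k (BalTensor A P X) := finiteDimensional A
  have : FiniteDimensional k (BalTensor A P X₁) := finiteDimensional A
  have : FiniteDimensional k (BalTensor A P X₂) := finiteDimensional A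
  have : FiniteDimensional k (BalTensor A P Y) := finiteDimensional A
  have := LinearMap.finiteDimensional_of_tower k (A := A) (X := X) (Y := BalTensor A P Y)
  have := LinearMap.finiteDimensional_of_tower k (A := A) (X := X₁) (Y := BalTensor A P Y)
  have := LinearMap.finiteDimensional_of_tower k (A := A) (X := X₂) (Y := BalTensor A P Y)
  have := LinearMap.finiteDimensional_of_tower k (A := A) (X := BalTensor A P X) (Y := Y)
  have := LinearMap.finiteDimensional_of_tower k (A := A) (X := BalTensor A P X₁) (Y := Y)
  have := LinearMap.finiteDimensional_of_tower k (A := A) (X := BalTensor A P X₂) (Y := Y)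
  -- `P ⊗ -` is exact with projective values
  have hPi : Function.Injective (lTensor A P A i) := lTensor_injective_of_split hi eP
  have hPq : Function.Surjective (lTensor A P A q) := lTensor_surjective A hq
  have hPqi : lTensor A P A q ∘ₗ lTensor A P A i = 0 := by
    rw [← lTensor_comp, LinearMap.range_mkQ_comp, lTensor_zero]
  have hPex : Function.Exact (lTensor A P A i) (lTensor A P A q) := by
    obtain ⟨m, hm⟩ := exists_factor_lTensor (B := A) (N := P) A hq hqi
      (LinearMap.range (lTensor A P A i)).mkQ (LinearMap.range_mkQ_comp _)
    refine LinearMap.exact_iff.2 (le_antisymm (fun z hz => ?_)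
      (LinearMap.range_le_ker_iff.2 hPqi))
    rw [← Submodule.ker_mkQ (LinearMap.range (lTensor A P A i)), ← hm]
    exact (congrArg m hz).trans (map_zero m)
  have := h.projective_balTensor_P X₂
  -- Since `P ⊗ X₂` is projective, the sequence `P ⊗ X → P ⊗ X₁ → P ⊗ X₂` splits, so restriction to
  -- `P ⊗ X` is onto on Hom spaces.
  obtain ⟨l, hl⟩ := Module.projective_lifting_property (lTensor A P A q) LinearMap.id hPq
  obtain ⟨s, hs⟩ : ∃ s, s ∘ₗ lTensor A P A i = LinearMap.id :=
    ((hPex.split_tfae hPi hPq).out 0 1 (a := ∃ l, lTensor A P A q ∘ₗ l = LinearMap.id)).1 ⟨l, hl⟩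
  -- dimension count
  have h1 : finrank k (BalTensor A P X →ₗ[A] Y) + finrank k (BalTensor A P X₂ →ₗ[A] Y) ≤
      finrank k (BalTensor A P X₁ →ₗ[A] Y) := by
    rw [← LinearMap.finrank_range_add_finrank_ker (LinearMap.lcomp k Y (lTensor A P A i))]
    refine add_le_add (le_of_eq ?_) ?_
    · rw [LinearMap.range_eq_top.2, finrank_top]
      exact fun r => ⟨r ∘ₗ s, by
        rw [LinearMap.lcomp_apply', LinearMap.comp_assoc, hs, LinearMap.comp_id]⟩
    · refine LinearMap.finrank_le_finrank_of_injective (f := LinearMap.codRestrict _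
        (LinearMap.lcomp k Y (lTensor A P A q)) fun r => ?_) fun r r' hr => ?_
      · rw [LinearMap.mem_ker, LinearMap.lcomp_apply', LinearMap.lcomp_apply', LinearMap.comp_assoc,
          hPqi, LinearMap.comp_zero]
      · exact LinearMap.ext fun z => by
          obtain ⟨z, rfl⟩ := hPq z
          exact LinearMap.congr_fun (congrArg Subtype.val hr) z
  have h2 : finrank k (LinearMap.ker (LinearMap.lcomp k (BalTensor A P Y) i)) ≤
      finrank k (X₂ →ₗ[A] BalTensor A P Y) := by
    have h3 (r : LinearMap.ker (LinearMap.lcomp k (BalTensor A P Y) i)) :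
        LinearMap.range i ≤ LinearMap.ker r.1 := LinearMap.range_le_ker_iff.2 r.2
    refine le_trans (Submodule.finrank_mono (t := LinearMap.range
      (LinearMap.lcomp k (BalTensor A P Y) q)) fun r hr => ?_) (LinearMap.finrank_range_le _)
    exact ⟨(LinearMap.range i).liftQ r (h3 ⟨r, hr⟩),
      Submodule.liftQ_mkQ (LinearMap.range i) r (h3 ⟨r, hr⟩)⟩
  have h3 := LinearMap.finrank_range_add_finrank_ker (LinearMap.lcomp k (BalTensor A P Y) i)
  -- Moving `P` to the second argument turns `h1` into a lower bound for `dim Hom(X₁, P ⊗ Y)`. The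
  -- kernel of restriction along `i` is at most `Hom(X₂, P ⊗ Y)`, which leaves room only for a
  -- surjective restriction.
  rw [h.finrank_hom_balTensor_P hM hN, h.finrank_hom_balTensor_P hM hN,
    h.finrank_hom_balTensor_P hM hN] at h1
  have h4 : LinearMap.range (LinearMap.lcomp k (BalTensor A P Y) i) = ⊤ :=
    Submodule.eq_top_of_finrank_eq (le_antisymm (Submodule.finrank_le _) (by omega))
  exact LinearMap.range_eq_top.1 h4 f

end IsStableEquivOfMoritaType

end HomDimension

/-! ### Separable algebras and the Jacobson radical. -/

section Separable

variable {k A B : Type u} [Field k] [Ring A] [Algebra k A] [Ring B] [Algebra k B]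

/-- A separable algebra has a separability idempotent. -/
theorem IsSeparableAlgebra.exists_idempotent (hA : IsSeparableAlgebra k A) :
    ∃ ω : A ⊗[k] Aᵐᵒᵖ, (∀ a : A, (a ⊗ₜ 1) * ω = (1 ⊗ₜ op a) * ω) ∧
      LinearMap.mul' k A (TensorProduct.map LinearMap.id
        (MulOpposite.opLinearEquiv k).symm.toLinearMap ω) = 1 := by
  let : Module (A ⊗[k] Aᵐᵒᵖ) A := TensorProduct.Algebra.module
  have : Module.Projective (A ⊗[k] Aᵐᵒᵖ) A := hA
  have hsmul (t : A ⊗[k] Aᵐᵒᵖ) : t • (1 : A) = LinearMap.mul' k A (TensorProduct.map LinearMap.id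
        (MulOpposite.opLinearEquiv k).symm.toLinearMap t) := by
    induction t using TensorProduct.induction_on with
    | zero => exact (enveloping_zero_smul _).trans (by rw [map_zero, map_zero])
    | tmul x y => simp [TensorProduct.Algebra.smul_def]
    | add s t hs ht => rw [add_smul, hs, ht, map_add, map_add]
  obtain ⟨s, hs⟩ := Module.projective_lifting_property
    (LinearMap.toSpanSingleton (A ⊗[k] Aᵐᵒᵖ) A 1) LinearMap.id fun a => ⟨a ⊗ₜ 1, by
      simp [TensorProduct.Algebra.smul_def]⟩
  refine ⟨s 1, fun a => ?_, (hsmul _).symm.trans (LinearMap.congr_fun hs 1)⟩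
  rw [← smul_eq_mul, ← smul_eq_mul, ← map_smul, ← map_smul]
  simp [TensorProduct.Algebra.smul_def]

/-- The tensor product of a semisimple algebra and the opposite of a separable algebra is
semisimple. -/
theorem IsSeparableAlgebra.isSemisimpleRing_tensorProduct (hA : IsSeparableAlgebra k A)
    [IsSemisimpleRing B] : IsSemisimpleRing (B ⊗[k] Aᵐᵒᵖ) := by
  obtain ⟨ω, hω, hω1⟩ := hA.exists_idempotent
  refine (isSemisimpleModule_iff _ _).2 ⟨fun W => ?_⟩
  obtain ⟨C, hC⟩ := exists_isCompl (W.restrictScalars B)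
  let p₀ := (W.restrictScalars B).projectionOnto C hC
  let p : (B ⊗[k] Aᵐᵒᵖ) →ₗ[B] (B ⊗[k] Aᵐᵒᵖ) := (W.restrictScalars B).subtype ∘ₗ p₀
  have hpW (e) : p e ∈ W := (p₀ e).2
  have hp {e} (he : e ∈ W) : p e = e :=
    congrArg Subtype.val (Submodule.projectionOnto_apply_left hC ⟨e, he⟩)
  let pk : (B ⊗[k] Aᵐᵒᵖ) →ₗ[k] (B ⊗[k] Aᵐᵒᵖ) := p.restrictScalars k
  -- averaging with respect to an element of `A ⊗ Aᵐᵒᵖ`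
  let j : Aᵐᵒᵖ →ₐ[k] B ⊗[k] Aᵐᵒᵖ := Algebra.TensorProduct.includeRight
  have hc (c : k) (u v : B ⊗[k] Aᵐᵒᵖ) : (c • u) * v = c • (u * v) := smul_mul_assoc c u v
  -- For the separability idempotent `ω`, the map `Ψ ω` averages the `B`-linear projection onto `W`:
  -- the commutation rule of `ω` makes it linear over `Aᵐᵒᵖ`, and the normalization makes it the
  -- identity on `W`.
  let Ψ : A ⊗[k] Aᵐᵒᵖ →ₗ[k] (B ⊗[k] Aᵐᵒᵖ) →ₗ[k] (B ⊗[k] Aᵐᵒᵖ) :=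
    TensorProduct.lift (LinearMap.mk₂ k
      (fun x y => LinearMap.mulLeft k (j y) ∘ₗ pk ∘ₗ LinearMap.mulLeft k (j (op x)))
      (fun x x' y => LinearMap.ext fun e => by simp [add_mul, mul_add])
      (fun c x y => LinearMap.ext fun e => by simp [hc])
      (fun x y y' => LinearMap.ext fun e => by simp [add_mul])
      (fun c x y => LinearMap.ext fun e => by simp [hc]))
  have hΨ (x : A) (y : Aᵐᵒᵖ) (e) : Ψ (x ⊗ₜ y) e = j y * p (j (op x) * e) := rfl
  have hΨW (t e) : Ψ t e ∈ W := by
    induction t using TensorProduct.induction_on with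
    | zero => rw [map_zero]; exact W.zero_mem
    | tmul x y => exact W.smul_mem (j y) (hpW _)
    | add s t hs ht => rw [map_add]; exact W.add_mem hs ht
  have hΨid {e} (he : e ∈ W) (t) : Ψ t e = j (op (LinearMap.mul' k A (TensorProduct.map
      LinearMap.id (MulOpposite.opLinearEquiv k).symm.toLinearMap t))) * e := by
    induction t using TensorProduct.induction_on with
    | zero => simp
    | tmul x y =>
      have h1 : p (j (op x) * e) = j (op x) * e := hp (W.smul_mem (j (op x)) he)
      rw [hΨ, h1, ← mul_assoc, ← map_mul]
      rfl
    | add s t hs ht =>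
      rw [map_add, LinearMap.add_apply, hs, ht, map_add, map_add, MulOpposite.op_add, map_add,
        add_mul]
  have hΨl (b : B) (t e) : Ψ t (b ⊗ₜ 1 * e) = b ⊗ₜ 1 * Ψ t e := by
    have hb (e : B ⊗[k] Aᵐᵒᵖ) : b ⊗ₜ 1 * e = b • e := by
      rw [← one_mul e, ← smul_mul_assoc, one_mul, Algebra.TensorProduct.one_def,
        TensorProduct.smul_tmul', smul_eq_mul, mul_one]
    have hj (y : Aᵐᵒᵖ) (e : B ⊗[k] Aᵐᵒᵖ) : j y * (b • e) = b • (j y * e) := by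
      rw [← hb, ← hb, ← mul_assoc, ← mul_assoc]
      congr 1
      simp [j]
    rw [hb, hb]
    induction t using TensorProduct.induction_on with
    | zero => simp
    | tmul x y => rw [hΨ, hΨ, hj, map_smul, hj]
    | add s t hs ht => rw [map_add, LinearMap.add_apply, LinearMap.add_apply, hs, ht, smul_add]
  have hΨr (a : A) (t e) : Ψ t (j (op a) * e) = Ψ (a ⊗ₜ 1 * t) e := by
    induction t using TensorProduct.induction_on with
    | zero => simp
    | tmul x y =>
      rw [Algebra.TensorProduct.tmul_mul_tmul, hΨ, hΨ, ← mul_assoc, ← map_mul, one_mul]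
      rfl
    | add s t hs ht => rw [mul_add, map_add, map_add, LinearMap.add_apply, hs, ht]; rfl
  have hΨr' (a : A) (t e) : j (op a) * Ψ t e = Ψ (1 ⊗ₜ op a * t) e := by
    induction t using TensorProduct.induction_on with
    | zero => simp
    | tmul x y =>
      rw [Algebra.TensorProduct.tmul_mul_tmul, hΨ, hΨ, ← mul_assoc, ← map_mul, one_mul]
    | add s t hs ht =>
      rw [mul_add, map_add, map_add, LinearMap.add_apply, LinearMap.add_apply, mul_add, hs, ht]
  let π : (B ⊗[k] Aᵐᵒᵖ) →ₗ[B ⊗[k] Aᵐᵒᵖ] W :=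
    { toFun := fun e => ⟨Ψ ω e, hΨW ω e⟩
      map_add' := fun e e' => Subtype.ext (map_add (Ψ ω) e e')
      map_smul' := fun c e => Subtype.ext <| by
        change Ψ ω (c * e) = c * Ψ ω e
        induction c using TensorProduct.induction_on with
        | zero => simp
        | tmul b a =>
          have hba : b ⊗ₜ[k] a = b ⊗ₜ 1 * j (op (unop a)) := by
            simp [j]
          rw [hba, mul_assoc, hΨl, hΨr, hω, ← hΨr', mul_assoc]
        | add c c' hc hc' => rw [add_mul, map_add, hc, hc', add_mul] }
  refine ⟨LinearMap.ker π, LinearMap.isCompl_of_proj (f := π) fun w => Subtype.ext ?_⟩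
  change Ψ ω w = w
  rw [hΨid w.2, hω1, op_one, map_one, one_mul]

/-- A left ideal of nilpotent elements is contained in the Jacobson radical. -/
theorem mem_jacobson_of_forall_isNilpotent {R : Type*} [Ring R] {x : R}
    (h : ∀ y, IsNilpotent (y * x)) : x ∈ Ring.jacobson R := by
  rw [← Ideal.jacobson_bot, Ideal.mem_jacobson_iff]
  intro y
  obtain ⟨u, hu⟩ := (h y).isUnit_one_add
  refine ⟨(u⁻¹ : Rˣ), ?_⟩
  have : ((u⁻¹ : Rˣ) : R) * y * x + (u⁻¹ : Rˣ) - 1 = (u⁻¹ : Rˣ) * (1 + y * x) - 1 := by noncomm_ring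
  rw [this, ← hu, Units.inv_mul, sub_self]
  exact Submodule.zero_mem _

variable (k A) in
/-- The left module structure `(a · f) (x) = f (x · a)` on the dual of an algebra. -/
@[reducible]
def LinearMap.dualModule : Module A (A →ₗ[k] k) where
  smul a f := f ∘ₗ LinearMap.mulRight k a
  one_smul f := LinearMap.ext fun x => congrArg f (mul_one x)
  mul_smul a b f := LinearMap.ext fun x => congrArg f (mul_assoc x a b).symm
  smul_zero a := LinearMap.ext fun _ => rfl
  smul_add a f g := LinearMap.ext fun _ => rfl
  add_smul a b f := LinearMap.ext fun x => by
    change f (x * (a + b)) = f (x * a) + f (x * b)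
    rw [mul_add, map_add]
  zero_smul f := LinearMap.ext fun x => by
    change f (x * 0) = 0
    rw [mul_zero, map_zero]

attribute [local instance] LinearMap.dualModule

theorem LinearMap.dualModule_smul_apply (a : A) (f : A →ₗ[k] k) (x : A) : (a • f) x = f (x * a) :=
  rfl

theorem LinearMap.dualModule_isScalarTower : IsScalarTower k A (A →ₗ[k] k) :=
  ⟨fun c a f => LinearMap.ext fun x => by
    rw [dualModule_smul_apply, mul_smul_comm, map_smul]; rfl⟩

section

attribute [local instance] TensorProduct.Algebra.module

open BalTensor

variable {N : Type u} [AddCommGroup N] [Module k N] [Module B N] [Module Aᵐᵒᵖ N]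
  [IsScalarTower k B N] [IsScalarTower k Aᵐᵒᵖ N] [SMulCommClass B Aᵐᵒᵖ N]

/-- A `B`-linear map `N ⊗ DA → B` amounts to a homomorphism of bimodules `N → B ⊗ A`. -/
theorem exists_toEnveloping_of_balTensor_dual [FiniteDimensional k A]
    (w : BalTensor A N (A →ₗ[k] k) →ₗ[B] B) :
    ∃ φ : N →ₗ[B ⊗[k] Aᵐᵒᵖ] (B ⊗[k] Aᵐᵒᵖ), ∀ n (f : A →ₗ[k] k), w (tmul A n f) =
      TensorProduct.rid k B (TensorProduct.map LinearMap.id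
        (f ∘ₗ (MulOpposite.opLinearEquiv k).symm.toLinearMap) (φ n)) := by
  have := LinearMap.dualModule_isScalarTower (k := k) (A := A)
  let b := Module.finBasis k A
  let w' (n : N) : (A →ₗ[k] k) →ₗ[k] B :=
    { toFun := fun f => w (tmul A n f)
      map_add' := fun f g => by rw [tmul_add, map_add]
      map_smul' := fun c f => by
        rw [← smul_left_tmul']
        exact w.map_smul_of_tower c _ }
  -- The preimage of `w' n` under `B ⊗ A ≅ Hom(DA, B)`, written in a basis of `A` and its dual
  -- basis.
  let φ (n : N) : B ⊗[k] Aᵐᵒᵖ := ∑ i, w' n (b.coord i) ⊗ₜ op (b i)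
  have hadd (n n') : φ (n + n') = φ n + φ n' := by
    rw [← Finset.sum_add_distrib]
    refine Finset.sum_congr rfl fun i _ => ?_
    rw [← TensorProduct.add_tmul]
    congr 1
    exact (congrArg w (add_tmul A n n' _)).trans (map_add w _ _)
  have hop (a : A) (n : N) : φ (op a • n) = 1 ⊗ₜ op a * φ n := by
    have h1 (i) : w' (op a • n) (b.coord i) = ∑ j, b.coord i (b j * a) • w' n (b.coord j) := by
      have h2 : a • b.coord i = ∑ j, b.coord i (b j * a) • b.coord j :=
        (b.sum_dual_apply_smul_coord (a • b.coord i)).symm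
      change w (tmul A (op a • n) _) = _
      rw [smul_tmul]
      change w' n (a • b.coord i) = _
      rw [h2, map_sum]
      exact Finset.sum_congr rfl fun j _ => map_smul _ _ _
    have h2 (j) : ∑ i, b.coord i (b j * a) • op (b i) = op a * op (b j) := by
      have h3 := congrArg (MulOpposite.opLinearEquiv k) (b.sum_repr (b j * a))
      rw [map_sum] at h3
      exact h3
    simp only [φ, h1, TensorProduct.sum_tmul, TensorProduct.smul_tmul, Finset.mul_sum,
      Algebra.TensorProduct.tmul_mul_tmul, one_mul]
    rw [Finset.sum_comm]
    refine Finset.sum_congr rfl fun j _ => ?_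
    rw [← TensorProduct.tmul_sum, h2]
  have hsmul (c : B) (n : N) : φ (c • n) = c ⊗ₜ 1 * φ n := by
    simp only [φ, Finset.mul_sum, Algebra.TensorProduct.tmul_mul_tmul, one_mul]
    refine Finset.sum_congr rfl fun i _ => ?_
    congr 1
    change w (tmul A (c • n) _) = c * w _
    rw [← smul_left_tmul, map_smul, smul_eq_mul]
  have hzero : φ 0 = 0 := by simpa using hadd 0 0
  refine ⟨{ toFun := φ, map_add' := hadd, map_smul' := fun e n => ?_ }, fun n f => ?_⟩
  · change φ (e • n) = e * φ n
    induction e using TensorProduct.induction_on with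
    | zero => rw [enveloping_zero_smul, hzero, zero_mul]
    | tmul c a =>
      rw [TensorProduct.Algebra.smul_def, hsmul, ← op_unop a, hop, ← mul_assoc,
        Algebra.TensorProduct.tmul_mul_tmul, mul_one, one_mul]
    | add e e' he he' => rw [add_mul, ← he, ← he', ← hadd, ← add_smul]
  · change w' n f = TensorProduct.rid k B (TensorProduct.map _ _ (φ n))
    conv_lhs => rw [← b.sum_dual_apply_smul_coord f, map_sum]
    simp [φ]

/-- The bimodule map `φ : N → B ⊗ Aᵐᵒᵖ` attached to `w` has values in the Jacobson radical, since
`N` has no projective summand. They vanish in the quotient `B/rad B ⊗ (A/rad A)ᵐᵒᵖ`, which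
separability makes semisimple, and a form `f` that is zero on `rad A` can be evaluated there. -/
theorem mem_jacobson_of_balTensor_dual [FiniteDimensional k A] [FiniteDimensional k B]
    [FiniteDimensional k N] (hN : BimoduleHasNoProjectiveSummand k B A N)
    (hA : IsSeparableAlgebra k (A ⧸ Ring.jacobson A)) (w : BalTensor A N (A →ₗ[k] k) →ₗ[B] B)
    (n : N) {f : A →ₗ[k] k} (hf : ∀ a ∈ Ring.jacobson A, f a = 0) :
    w (tmul A n f) ∈ Ring.jacobson B := by
  obtain ⟨φ, hφ⟩ := exists_toEnveloping_of_balTensor_dual w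
  have : IsScalarTower k (B ⊗[k] Aᵐᵒᵖ) N := enveloping_isScalarTower
  have : IsNoetherian (B ⊗[k] Aᵐᵒᵖ) N := isNoetherian_of_tower k inferInstance
  have : IsArtinian (B ⊗[k] Aᵐᵒᵖ) N := isArtinian_of_tower k inferInstance
  have hnil (n : N) : IsNilpotent (φ n) := by
    -- The endomorphism `z ↦ φ z • n` of `N` factors through the free module of rank one, so it is
    -- nilpotent. Its powers send `n` to `φ n ^ j • n`, and one more application of `φ` shows that
    -- `φ n` itself is nilpotent.
    obtain ⟨m, hm⟩ := HasNoProjectiveSummand.isNilpotent hN φ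
      (LinearMap.toSpanSingleton (B ⊗[k] Aᵐᵒᵖ) N n)
    have hpow (j : ℕ) : ((LinearMap.toSpanSingleton (B ⊗[k] Aᵐᵒᵖ) N n ∘ₗ φ :
        Module.End (B ⊗[k] Aᵐᵒᵖ) N) ^ j) n = φ n ^ j • n := by
      induction j with
      | zero => rw [pow_zero, pow_zero, one_smul]; rfl
      | succ j ih =>
        rw [pow_succ', Module.End.mul_apply, ih, LinearMap.comp_apply, map_smul,
          LinearMap.toSpanSingleton_apply, smul_eq_mul, pow_succ]
    refine ⟨m + 1, ?_⟩
    rw [pow_succ, ← smul_eq_mul, ← map_smul, ← hpow, hm, LinearMap.zero_apply, map_zero]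
  have hjac : φ n ∈ Ring.jacobson (B ⊗[k] Aᵐᵒᵖ) := mem_jacobson_of_forall_isNilpotent fun c => by
    rw [← smul_eq_mul, ← map_smul]
    exact hnil _
  -- pass to the semisimple quotient
  have : IsArtinianRing B := IsArtinianRing.of_finite k B
  have : IsSemisimpleRing (B ⧸ Ring.jacobson B) := IsSemiprimaryRing.isSemisimpleRing
  have : IsSemisimpleRing ((B ⧸ Ring.jacobson B) ⊗[k] (A ⧸ Ring.jacobson A)ᵐᵒᵖ) :=
    hA.isSemisimpleRing_tensorProduct
  let qA := Ideal.Quotient.mkₐ k (Ring.jacobson A)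
  let qB := Ideal.Quotient.mkₐ k (Ring.jacobson B)
  let τ : B ⊗[k] Aᵐᵒᵖ →ₐ[k] (B ⧸ Ring.jacobson B) ⊗[k] (A ⧸ Ring.jacobson A)ᵐᵒᵖ :=
    Algebra.TensorProduct.map qB (AlgHom.op qA)
  have hqA : Function.Surjective qA := Ideal.Quotient.mk_surjective
  have hτ : Function.Surjective τ := TensorProduct.map_surjective Ideal.Quotient.mk_surjective
    fun a => by
      obtain ⟨a', ha'⟩ := hqA (unop a)
      exact ⟨op a', congrArg op ha'⟩
  have : RingHomSurjective τ.toRingHom := ⟨hτ⟩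
  have h0 : τ (φ n) = 0 := by
    have h1 : τ.toRingHom (φ n) ∈ Ring.jacobson _ := Ring.le_comap_jacobson τ.toRingHom hjac
    exact (IsSemisimpleRing.jacobson_eq_bot _).le h1
  obtain ⟨σ, hσ⟩ := qA.toLinearMap.exists_rightInverse_of_surjective (LinearMap.range_eq_top.2 hqA)
  have hfσ (a : A) : (f ∘ₗ σ) (qA a) = f a := by
    rw [LinearMap.comp_apply, ← sub_eq_zero, ← map_sub]
    refine hf _ (Ideal.Quotient.eq.1 ?_)
    exact LinearMap.congr_fun hσ (qA a)
  have h2 (t : B ⊗[k] Aᵐᵒᵖ) : qB (TensorProduct.rid k B (TensorProduct.map LinearMap.id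
      (f ∘ₗ (MulOpposite.opLinearEquiv k).symm.toLinearMap) t)) =
      TensorProduct.rid k _ (TensorProduct.map LinearMap.id
        ((f ∘ₗ σ) ∘ₗ (MulOpposite.opLinearEquiv k).symm.toLinearMap) (τ t)) := by
    induction t using TensorProduct.induction_on with
    | zero => simp
    | tmul c a =>
      have h3 := hfσ (unop a)
      rw [LinearMap.comp_apply] at h3
      simp [τ, h3]
    | add s t hs ht => simp only [map_add, hs, ht]
  refine Ideal.Quotient.eq_zero_iff_mem.1 ?_
  change qB (w (tmul A n f)) = 0
  rw [hφ, h2, h0, map_zero, map_zero]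

end

end Separable

/-- A finitely generated projective module vanishes if all its linear forms take values in the
Jacobson radical. -/
theorem Module.Projective.subsingleton_of_forall_mem_jacobson {R W : Type*} [Ring R]
    [AddCommGroup W] [Module R W] [Module.Finite R W] [Module.Projective R W]
    (h : ∀ (ρ : W →ₗ[R] R) z, ρ z ∈ Ring.jacobson R) : Subsingleton W := by
  obtain ⟨n, c, w, hw⟩ := Module.Projective.exists_dualBasis R W
  have h0 : (⊤ : Submodule R W) = ⊥ :=
    Module.Finite.fg_top.eq_bot_of_le_jacobson_smul fun z _ => by
      rw [← hw z]
      exact Submodule.sum_mem _ fun i _ => Submodule.smul_mem_smul (h _ _) trivial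
  exact (Submodule.subsingleton_iff R).1 (subsingleton_of_bot_eq_top h0.symm)

/-! ### From stably simple to simple. -/

namespace IsStableEquivOfMoritaType

open BalTensor

variable {k A B M N P Q : Type u} [Field k] [Ring A] [Algebra k A] [Ring B] [Algebra k B]
  [AddCommGroup M] [Module k M] [Module A M] [Module Bᵐᵒᵖ M]
  [IsScalarTower k A M] [IsScalarTower k Bᵐᵒᵖ M] [SMulCommClass A Bᵐᵒᵖ M]
  [AddCommGroup N] [Module k N] [Module B N] [Module Aᵐᵒᵖ N]
  [IsScalarTower k B N] [IsScalarTower k Aᵐᵒᵖ N] [SMulCommClass B Aᵐᵒᵖ N]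
  [AddCommGroup P] [Module k P] [Module A P] [Module Aᵐᵒᵖ P]
  [IsScalarTower k A P] [IsScalarTower k Aᵐᵒᵖ P] [SMulCommClass A Aᵐᵒᵖ P]
  [AddCommGroup Q] [Module k Q] [Module B Q] [Module Bᵐᵒᵖ Q]
  [IsScalarTower k B Q] [IsScalarTower k Bᵐᵒᵖ Q] [SMulCommClass B Bᵐᵒᵖ Q]

/-- `M ⊗ -` is exact, and faithful because `N ⊗ M ⊗ -` contains the identity functor; a proper
nonzero submodule of `Y` would give one of `M ⊗ Y`. -/
theorem isSimpleModule_of_balTensor (h : IsStableEquivOfMoritaType k A B M N P Q)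
    {Y : Type u} [AddCommGroup Y] [Module B Y] (hY : IsSimpleModule A (BalTensor B M Y)) :
    IsSimpleModule B Y := by
  obtain ⟨eQ⟩ := h.iso_Q
  have := h.projective_right_M
  have hzero {W X : Type u} [AddCommGroup W] [Module B W] [AddCommGroup X] [Module B X]
      (f : W →ₗ[B] X) (hf : lTensor B M A f = 0) : f = 0 := LinearMap.ext fun z => by
    rw [← proj_incl eQ (f z), incl_naturality, hf, lTensor_zero, LinearMap.zero_apply, map_zero,
      LinearMap.zero_apply]
  have hnt : Nontrivial Y := by
    by_contra hY'
    have := not_nontrivial_iff_subsingleton.1 hY'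
    have := IsSimpleModule.nontrivial A (BalTensor B M Y)
    obtain ⟨z, hz⟩ := exists_ne (0 : BalTensor B M Y)
    refine hz ?_
    rw [← lTensor_id_apply B (B := A) z, Subsingleton.elim (LinearMap.id : Y →ₗ[B] Y) 0,
      lTensor_zero, LinearMap.zero_apply]
  have key (W : Submodule B Y) : W = ⊥ ∨ W = ⊤ := by
    by_cases h0 : lTensor B M A W.mkQ = 0
    · right
      rw [← W.ker_mkQ, LinearMap.ker_eq_top]
      exact hzero _ h0
    · left
      have h1 := LinearMap.injective_of_ne_zero h0
      have h2 : lTensor B M A W.subtype = 0 := LinearMap.ext fun z => h1 <| by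
        rw [← lTensor_comp_apply, show W.mkQ ∘ₗ W.subtype = 0 by ext; simp, lTensor_zero,
          LinearMap.zero_apply, LinearMap.zero_apply, map_zero]
      rw [← W.range_subtype, hzero _ h2, LinearMap.range_zero]
  exact { toIsSimpleOrder := { eq_bot_or_eq_top := key } }

variable [FiniteDimensional k A] [FiniteDimensional k B] [FiniteDimensional k M]
  [FiniteDimensional k N]
  (h : IsStableEquivOfMoritaType k A B M N P Q)
  (hM : BimoduleHasNoProjectiveSummand k A B M)
  (hN : BimoduleHasNoProjectiveSummand k B A N)

include h hM hN

/-- A simple submodule `Y` of `P ⊗ S` gives, by the dimension formula, a nonzero map `P ⊗ Y → S`,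
which splits as `S` is projective. So `S` is a retract of `P ⊗ Y`, to which maps extend, and every
extension of a module by `S` splits, contrary to `exists_nonsplit`. -/
theorem subsingleton_balTensor_P_of_projective (hA : HasNoSemisimpleSummand k A) (S : Type u)
    [AddCommGroup S] [Module A S] [IsSimpleModule A S] [Module.Projective A S] :
    Subsingleton (BalTensor A P S) := by
  by_contra hPS
  have := not_subsingleton_iff_nontrivial.1 hPS
  have : FiniteDimensional k P := h.finiteDimensional_P
  have : IsArtinianRing A := IsArtinianRing.of_finite k A
  have := h.finite_balTensor_P (X := S)
  let : Module k S := Module.compHom S (algebraMap k A)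
  have : IsScalarTower k A S := ⟨fun c b z => by rw [Algebra.smul_def, mul_smul]; rfl⟩
  have : FiniteDimensional k S := Module.Finite.trans A S
  obtain ⟨Y, hY, -⟩ := (eq_bot_or_exists_atom_le (⊤ : Submodule A (BalTensor A P S))).resolve_left
    top_ne_bot
  have : IsSimpleModule A Y := isSimpleModule_iff_isAtom.2 hY
  have : FiniteDimensional k Y := Module.Finite.trans A Y
  have : FiniteDimensional k (BalTensor A P S) := finiteDimensional A
  have : FiniteDimensional k (BalTensor A P Y) := finiteDimensional A
  have := LinearMap.finiteDimensional_of_tower k (A := A) (X := Y) (Y := BalTensor A P S)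
  have h1 := h.finrank_hom_balTensor_P hM hN Y S
  have : Nontrivial (Y →ₗ[A] BalTensor A P S) := ⟨Y.subtype, 0, fun h0 => hY.1 <| by
    rw [← Y.range_subtype, h0, LinearMap.range_zero]⟩
  have h2 := Module.finrank_pos (R := k) (M := Y →ₗ[A] BalTensor A P S)
  rw [← h1] at h2
  have := Module.nontrivial_of_finrank_pos h2
  obtain ⟨r, hr⟩ := exists_ne (0 : BalTensor A P Y →ₗ[A] S)
  obtain ⟨s, hs⟩ := Module.projective_lifting_property r LinearMap.id
    (LinearMap.surjective_of_ne_zero hr)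
  obtain ⟨E, _, _, _, i, hi, -, hE⟩ := hA.exists_nonsplit S
  obtain ⟨g, hg⟩ := h.exists_extension_to_balTensor_P hM hN hi s
  exact hE (r ∘ₗ g) (by rw [LinearMap.comp_assoc, hg, hs])

/-- With `P ⊗ S = 0` the projection `M ⊗ N ⊗ S → S` is an isomorphism, and `M ⊗ -` reflects
simplicity. -/
theorem isSimpleModule_balTensor_of_projective (hA : HasNoSemisimpleSummand k A) (S : Type u)
    [AddCommGroup S] [Module A S] [IsSimpleModule A S] [Module.Projective A S] :
    IsSimpleModule B (BalTensor A N S) := by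
  obtain ⟨eP⟩ := h.iso_P
  have := h.subsingleton_balTensor_P_of_projective hM hN hA S
  refine h.isSimpleModule_of_balTensor (IsSimpleModule.congr (N := S) ?_)
  refine LinearEquiv.ofBijective (proj S eP) ⟨fun z w hzw => ?_, fun s => ⟨_, proj_incl eP s⟩⟩
  rw [← incl_proj_add eP z, ← incl_proj_add eP w, hzw,
    Subsingleton.elim (proj' S eP z) (proj' S eP w)]

/-- For a simple module `S`, maps to a projective direct summand of `M ⊗ N ⊗ S` extend along
injective maps. -/
theorem exists_extension_of_retract {S X D : Type u} [AddCommGroup S] [Module A S]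
    [IsSimpleModule A S] (hS : ¬ Module.Projective A S) [AddCommGroup X] [Module A X]
    [Module.Projective A X] (eP : BimoduleIso A A (BalTensor B M N) (A × P))
    {ι : X →ₗ[A] BalTensor B M (BalTensor A N S)} {π : BalTensor B M (BalTensor A N S) →ₗ[A] X}
    (hπι : π ∘ₗ ι = LinearMap.id) [AddCommGroup D] [Module A D] [Module.Finite A D]
    {i : S →ₗ[A] D} (hi : Function.Injective i) (u : S →ₗ[A] X) :
    ∃ g : D →ₗ[A] X, g ∘ₗ i = u := by
  -- The identity of `X` is the sum of `n`, which passes through `S`, and a map through `P ⊗ S`.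
  -- Since `S` is not projective, the composite `S → X → S` is zero and `n ∘ n = 0`.
  have h0 : (proj S eP ∘ₗ ι) ∘ₗ (π ∘ₗ incl S eP) = 0 := by
    by_contra h0
    exact hS (Module.Projective.of_simple_retract (π ∘ₗ incl S eP) (proj S eP ∘ₗ ι) h0)
  set n := (π ∘ₗ incl S eP) ∘ₗ (proj S eP ∘ₗ ι) with hn
  have hn2 (x : X) : n (n x) = 0 := by
    have := LinearMap.congr_fun h0 ((proj S eP ∘ₗ ι) x)
    change π (incl S eP (((proj S eP ∘ₗ ι) ∘ₗ (π ∘ₗ incl S eP)) ((proj S eP ∘ₗ ι) x))) = 0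
    rw [this, LinearMap.zero_apply, map_zero, map_zero]
  have hn1 (x : X) : n x + π (incl' S eP (proj' S eP (ι x))) = x := by
    have h1 := congrArg π (incl_proj_add eP (ι x))
    rw [map_add] at h1
    exact h1.trans (LinearMap.congr_fun hπι x)
  obtain ⟨g, hg⟩ := h.exists_extension_to_balTensor_P hM hN hi ((proj' S eP ∘ₗ ι) ∘ₗ u)
  -- The part through `P ⊗ S` is `1 - n`, with inverse `1 + n`. Thus `X` is a retract of `P ⊗ S` and
  -- inherits its extension property.
  refine ⟨(LinearMap.id + n) ∘ₗ (π ∘ₗ incl' S eP) ∘ₗ g, LinearMap.ext fun s => ?_⟩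
  have h2 : g (i s) = proj' S eP (ι (u s)) := LinearMap.congr_fun hg s
  have h3 := eq_sub_of_add_eq' (hn1 (u s))
  simp only [LinearMap.comp_apply, h2, h3, LinearMap.add_apply, LinearMap.id_apply, map_sub, hn2]
  abel

section

attribute [local instance] LinearMap.dualModule

/-- Since `M ⊗ R` is a projective summand of `M ⊗ N ⊗ S`, the canonical map `S → M ⊗ R` extends to
the dual of `A`. Every linear form on `R` can then be computed through `N ⊗ DA → B` on tensors `n ⊗
f` with `f` zero on `rad A`, so its values lie in `rad B`; Nakayama's lemma concludes. -/
theorem subsingleton_of_projective_retract (hA : IsSeparableAlgebra k (A ⧸ Ring.jacobson A))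
    {S R : Type u} [AddCommGroup S] [Module A S] [IsSimpleModule A S]
    (hS : ¬ Module.Projective A S) [AddCommGroup R] [Module B R] [Module.Projective B R]
    {ι : R →ₗ[B] BalTensor A N S} {π : BalTensor A N S →ₗ[B] R}
    (hπι : π ∘ₗ ι = LinearMap.id) : Subsingleton R := by
  obtain ⟨eP⟩ := h.iso_P
  obtain ⟨eQ⟩ := h.iso_Q
  have := h.projective_left_M
  have hπ : Function.Surjective π := fun r => ⟨ι r, LinearMap.congr_fun hπι r⟩
  have : Module.Finite B N := Module.Finite.of_restrictScalars_finite k B N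
  have : Module.Finite B (BalTensor A N S) := BalTensor.finite A
  have : Module.Finite B R := Module.Finite.of_surjective π hπ
  have : Module.Projective A (BalTensor B M R) := projective B
  -- embed `S` into the dual of `A`
  have := LinearMap.dualModule_isScalarTower (k := k) (A := A)
  have : Module.Finite A (A →ₗ[k] k) := Module.Finite.of_restrictScalars_finite k A _
  let : Module k S := Module.compHom S (algebraMap k A)
  have : IsScalarTower k A S := ⟨fun c b z => by rw [Algebra.smul_def, mul_smul]; rfl⟩
  have : Nontrivial S := IsSimpleModule.nontrivial A S
  obtain ⟨s, hs⟩ := exists_ne (0 : S)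
  obtain ⟨l, hl⟩ : ∃ l : Module.Dual k S, l s ≠ 0 := by
    by_contra! hl
    exact hs ((Module.forall_dual_apply_eq_zero_iff k s).1 hl)
  let i : S →ₗ[A] (A →ₗ[k] k) :=
    { toFun := fun s => l ∘ₗ (LinearMap.toSpanSingleton A S s).restrictScalars k
      map_add' := fun s t => LinearMap.ext fun x => by simp
      map_smul' := fun a s => LinearMap.ext fun x => by
        rw [RingHom.id_apply, LinearMap.dualModule_smul_apply]
        simp [mul_smul] }
  have hi : Function.Injective i := LinearMap.injective_of_ne_zero fun h0 => hl <| by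
    have h1 := LinearMap.congr_fun (LinearMap.congr_fun h0 s) 1
    change l ((1 : A) • s) = 0 at h1
    rwa [one_smul] at h1
  have hirad (s : S) (a : A) (ha : a ∈ Ring.jacobson A) : i s a = 0 := by
    change l (a • s) = 0
    rw [Module.mem_annihilator.1 (IsSemisimpleModule.jacobson_le_annihilator A S ha), map_zero]
  obtain ⟨g, hg⟩ := h.exists_extension_of_retract hM hN hS eP
    (ι := lTensor B M A ι) (π := lTensor B M A π) (by rw [← lTensor_comp, hπι, lTensor_id]) hi
    (lTensor B M A π ∘ₗ incl S eP)
  refine Module.Projective.subsingleton_of_forall_mem_jacobson (R := B) fun ρ r => ?_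
  obtain ⟨z, rfl⟩ := hπ r
  -- Elements of `N ⊗ S` are taken in the image of the triangle map, because `π` after the triangle
  -- map is the adjunct of the map that was extended to the dual.
  obtain ⟨z, rfl⟩ := h.symm.triangle_surjective hN eQ eP S z
  have h1 : π (triangle eQ eP S z) = proj R eQ (lTensor A N B g (lTensor A N B i z)) := by
    rw [← lTensor_comp_apply, hg, lTensor_comp_apply, proj_naturality]
    rfl
  rw [h1]
  clear h1
  induction z using induction_on with
  | h0 => simp
  | ht n s =>
    exact mem_jacobson_of_balTensor_dual hN hA (ρ ∘ₗ proj R eQ ∘ₗ lTensor A N B g) n (hirad s)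
  | ha z w hz hw =>
    rw [map_add, map_add, map_add, map_add]
    exact Submodule.add_mem _ hz hw

end

/-- If `N ⊗ S` is isomorphic to a simple module in the stable category, for a simple module `S`
that is not projective, then `N ⊗ S` is simple. -/
theorem isSimpleModule_balTensor_of_not_projective
    (hA : IsSeparableAlgebra k (A ⧸ Ring.jacobson A))
    {S T Z Z' : Type u} [AddCommGroup S] [Module A S] [IsSimpleModule A S]
    (hS : ¬ Module.Projective A S) [AddCommGroup T] [Module B T] [IsSimpleModule B T]
    [AddCommGroup Z] [Module B Z] [Module.Projective B Z] [AddCommGroup Z'] [Module B Z']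
    [Module.Projective B Z'] {α : BalTensor A N S →ₗ[B] T} {β : T →ₗ[B] BalTensor A N S}
    {p : BalTensor A N S →ₗ[B] Z} {q : Z →ₗ[B] BalTensor A N S}
    (hqp : q ∘ₗ p = β ∘ₗ α - LinearMap.id) {p' : T →ₗ[B] Z'} {q' : Z' →ₗ[B] T}
    (hqp' : q' ∘ₗ p' = α ∘ₗ β - LinearMap.id) : IsSimpleModule B (BalTensor A N S) := by
  obtain ⟨eP⟩ := h.iso_P
  have := h.projective_left_M
  have hFS : ¬ Module.Projective B (BalTensor A N S) := fun hFS =>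
    hS (projective_of_balTensor hFS eP)
  -- From `β ∘ α - q ∘ p = 1`, the module `N ⊗ S` is a retract of `T × Z`.
  have hT : ¬ Module.Projective B T := fun hT => hFS <|
    Module.Projective.of_split (α.prod p) (β.coprod (-q)) <| LinearMap.ext fun x => by
      have := LinearMap.congr_fun hqp x
      simp only [LinearMap.comp_apply, LinearMap.sub_apply, LinearMap.id_apply] at this
      simp [this]
  -- An endomorphism of the nonprojective simple module `T` that factors through a projective module
  -- is zero, so the stable identity holds exactly.
  have hαβ : α ∘ₗ β = LinearMap.id := by
    rw [← sub_eq_zero, ← hqp']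
    by_contra h0
    exact hT (Module.Projective.of_simple_retract p' q' h0)
  -- Now `-e` is the idempotent projecting onto the complement of `β(T)`. Its range is a retract of
  -- `Z` as well as of `N ⊗ S`, so it is the projective summand that has to vanish.
  set e : BalTensor A N S →ₗ[B] BalTensor A N S := β ∘ₗ α - LinearMap.id with he
  have hee (x) : e (e x) = - e x := by
    have (t : T) : α (β t) = t := LinearMap.congr_fun hαβ t
    simp only [he, LinearMap.sub_apply, LinearMap.comp_apply, LinearMap.id_apply, map_sub, this]
    abel
  have hsplit : (-e.rangeRestrict) ∘ₗ (LinearMap.range e).subtype = LinearMap.id := by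
    ext ⟨_, x, rfl⟩
    exact (congrArg Neg.neg (hee x)).trans (neg_neg _)
  have : Module.Projective B (LinearMap.range e) := by
    refine Module.Projective.of_split (p ∘ₗ (LinearMap.range e).subtype)
      (e.rangeRestrict ∘ₗ q) ?_
    ext ⟨_, x, rfl⟩
    have h1 : q (p (e x)) = e (e x) := LinearMap.congr_fun hqp _
    change e (q (p (e x))) = e x
    rw [h1, hee, hee, neg_neg]
  have hR := h.subsingleton_of_projective_retract hM hN hA hS hsplit
  have hβα : β ∘ₗ α = LinearMap.id := by
    rw [← sub_eq_zero, ← he]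
    exact LinearMap.range_eq_bot.1 (Submodule.eq_bot_of_subsingleton)
  exact IsSimpleModule.congr (LinearEquiv.ofLinearMap α β hαβ hβα)

theorem isSimpleModule_tensorFunctor_obj (hA : HasNoSemisimpleSummand k A)
    (hA' : IsSeparableAlgebra k (A ⧸ Ring.jacobson A)) {S : FGModuleCat.{u} A}
    (hS : IsSimpleModule A S) {T : FGModuleCat.{u} B} (hT : IsSimpleModule B T)
    (e : (toStable B).obj ((tensorFunctor k A B N).obj S) ≅ (toStable B).obj T) :
    IsSimpleModule B ((tensorFunctor k A B N).obj S) := by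
  by_cases hp : Module.Projective A S
  · exact h.isSimpleModule_balTensor_of_projective hM hN hA S
  · obtain ⟨α, hα⟩ := (toStable B).map_surjective e.hom
    obtain ⟨β, hβ⟩ := (toStable B).map_surjective e.inv
    have h1 : (toStable B).map (α ≫ β) = (toStable B).map (𝟙 _) := by
      rw [Functor.map_comp, hα, hβ, e.hom_inv_id, CategoryTheory.Functor.map_id]
    have h2 : (toStable B).map (β ≫ α) = (toStable B).map (𝟙 _) := by
      rw [Functor.map_comp, hα, hβ, e.inv_hom_id, CategoryTheory.Functor.map_id]
    obtain ⟨Z, p, q, hZ, hqp⟩ := (CategoryTheory.Quotient.functor_map_eq_iff _ _ _).1 h1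
    obtain ⟨Z', p', q', hZ', hqp'⟩ := (CategoryTheory.Quotient.functor_map_eq_iff _ _ _).1 h2
    exact h.isSimpleModule_balTensor_of_not_projective hM hN hA' hp (S := S) (T := T)
      (α := α.hom.hom) (β := β.hom.hom) (p := p.hom.hom) (q := q.hom.hom)
      (congrArg (fun f => f.hom.hom) hqp) (p' := p'.hom.hom) (q' := q'.hom.hom)
      (congrArg (fun f => f.hom.hom) hqp')

end IsStableEquivOfMoritaType

/-! ### Assembly of the equivalences. -/

theorem mainTheorem8 (k A B : Type u) [Field k]
    [Ring A] [Algebra k A] [FiniteDimensional k A]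
    [Ring B] [Algebra k B] [FiniteDimensional k B]
    (M : Type u) [AddCommGroup M] [Module k M] [Module A M] [Module Bᵐᵒᵖ M]
    [IsScalarTower k A M] [IsScalarTower k Bᵐᵒᵖ M] [SMulCommClass A Bᵐᵒᵖ M]
    [FiniteDimensional k M]
    (N : Type u) [AddCommGroup N] [Module k N] [Module B N] [Module Aᵐᵒᵖ N]
    [IsScalarTower k B N] [IsScalarTower k Aᵐᵒᵖ N] [SMulCommClass B Aᵐᵒᵖ N]
    [FiniteDimensional k N]
    (P : Type u) [AddCommGroup P] [Module k P] [Module A P] [Module Aᵐᵒᵖ P]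
    [IsScalarTower k A P] [IsScalarTower k Aᵐᵒᵖ P] [SMulCommClass A Aᵐᵒᵖ P]
    (Q : Type u) [AddCommGroup Q] [Module k Q] [Module B Q] [Module Bᵐᵒᵖ Q]
    [IsScalarTower k B Q] [IsScalarTower k Bᵐᵒᵖ Q] [SMulCommClass B Bᵐᵒᵖ Q]
    (hA : HasNoSemisimpleSummand k A) (hB : HasNoSemisimpleSummand k B)
    (hM : BimoduleHasNoProjectiveSummand k A B M)
    (hN : BimoduleHasNoProjectiveSummand k B A N)
    (h : IsStableEquivOfMoritaType k A B M N P Q) :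
    [(tensorFunctor k A B N).IsEquivalence,
      Subsingleton P ∧ Subsingleton Q,
      ∀ S : FGModuleCat.{u} A, IsSimpleModule A S →
        IsSimpleModule B ((tensorFunctor k A B N).obj S)].TFAE ∧
    (IsSeparableAlgebra k (A ⧸ Ring.jacobson A) → IsSeparableAlgebra k (B ⧸ Ring.jacobson B) →
      [(tensorFunctor k A B N).IsEquivalence,
        Subsingleton P ∧ Subsingleton Q,
        ∀ S : FGModuleCat.{u} A, IsSimpleModule A S →
          IsSimpleModule B ((tensorFunctor k A B N).obj S),
        LiftsToMoritaEquivalence k A B (stableTensorFunctor k A B N h.projective_left_N),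
        ∀ S : FGModuleCat.{u} A, IsSimpleModule A S →
          ∃ T : FGModuleCat.{u} B, IsSimpleModule B T ∧
            Nonempty ((stableTensorFunctor k A B N h.projective_left_N).obj
              ((toStable A).obj S) ≅ (toStable B).obj T)].TFAE) := by
  have : IsArtinianRing A := IsArtinianRing.of_finite k A
  have : IsArtinianRing B := IsArtinianRing.of_finite k B
  have h12 (hF : (tensorFunctor k A B N).IsEquivalence) (S : FGModuleCat.{u} A)
      (hS : IsSimpleModule A S) : IsSimpleModule B ((tensorFunctor k A B N).obj S) :=
    FGModuleCat.isSimpleModule_obj _ hS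
  have h23 (hS : ∀ S : FGModuleCat.{u} A, IsSimpleModule A S →
      IsSimpleModule B ((tensorFunctor k A B N).obj S)) : Subsingleton P ∧ Subsingleton Q := by
    have hP : Subsingleton P := h.subsingleton_P hM
      (fun S _ _ hS' => hS (FGModuleCat.of A S) hS') fun T _ _ _ _ => hA.exists_nonsplit T
    exact ⟨hP, h.subsingleton_Q hN⟩
  have h31 (hPQ : Subsingleton P ∧ Subsingleton Q) : (tensorFunctor k A B N).IsEquivalence :=
    have := hPQ.1
    have := hPQ.2
    h.isEquivalence
  constructor
  · tfae_have 1 → 3 := h12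
    tfae_have 3 → 2 := h23
    tfae_have 2 → 1 := h31
    tfae_finish
  · intro hA' _
    tfae_have 1 → 4 := liftsToMoritaEquivalence_of_isEquivalence k A B N h.projective_left_N
    tfae_have 4 → 5 := by
      -- The simple module required is `F S`, as equivalences preserve simplicity and `F` agrees
      -- stably with `N ⊗ -`.
      rintro ⟨F, hF, -, ⟨e⟩⟩ S hS
      exact ⟨F.obj S, FGModuleCat.isSimpleModule_obj F hS, ⟨(e.app S).symm⟩⟩
    tfae_have 5 → 3 := fun h5 S hS => by
      obtain ⟨T, hT, ⟨e⟩⟩ := h5 S hS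
      exact h.isSimpleModule_tensorFunctor_obj hM hN hA hA' hS hT e
    tfae_have 3 → 2 := h23
    tfae_have 2 → 1 := h31
    tfae_finish
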